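/- Let $d\in\{2,3\}$ and let $\mathbb T^d=\mathbb R^d/\mathbb Z^d$ be the torus. Let $H$ be the closed subspace of $L^2(\mathbb T^d;\mathbb R^d)$ of the vector fields with zero mean and zero divergence, let $\Pi$ be the orthogonal (Leray) projection of $L^2(\mathbb T^d;\mathbb R^d)$ onto $H$, and let $b(u,v)=\Pi\big((u\cdot\nabla)v\big)$ for all $u,v\in H$ such that $\nabla v$ and $(u\cdot\nabla)v$ are in $L^2$ (set $b(u,v)=0$ for other $u,v\in H$). For $s\ge 0$ let $H^s=\mathrm{Dom}((-A)^{s/2})\subseteq H$ with $\|u\|_{H^s}^2=\|(-A)^{s/2}u\|_{L^2}^2$, where $A=\Pi\Delta$ is the Stokes operator. Let $\xi>\frac d2+2$, let $(e_i)_{i\ge1}$ be an orthonormal system in $H$ with $e_i\in H^\xi$, let $\sigma_i\ge 0$ with $\sum_{i}\sigma_i^2\|e_i\|_{H^\xi}^2<\infty$, and let $Q=\sum_i\sigma_i^2\,e_i\otimes e_i$. Let $C:D(C)\subseteq H\to H$ be a densely defined closed linear operator that commutes with $Q$ (that is, $QD(C)\subseteq D(C)$ and $CQ=QC$ on $D(C)$),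 has $0$ in its resolvent set, satisfies $Ce_k=\lambda_ke_k$ with real $\lambda_k$ such that $\sup_k\lambda_k=\lambda_1<0$, and for which there are $\gamma\ge0$ and $c>0$ with $D(C)\subseteq H^\gamma$ and $-\langle x,Cx\rangle\ge c\|x\|_{H^\gamma}^2$ for all $x\in D(C)$. Let $\mathcal H\in(\frac14,\frac12]$. On a probability space $\Omega$ let $(W^{\mathcal H,i})_{i\ge1}$ be independent real fractional Brownian motions with Hurst parameter $\mathcal H$, let $W^{\mathcal H}_t=\sum_i\sigma_ie_iW^{\mathcal H,i}_t$, and let $w$ be the fractional Ornstein–Uhlenbeck process $$dw=Cw\,dt+dW^{\mathcal H},\qquad w(0)=0,$$ that is, an $H$-valued process with continuous paths such that, for every $t\ge0$, almost surely $\int_0^tw_s\,ds\in D(C)$ and $w_t=C\int_0^tw_s\,ds+W^{\mathcal H}_t$. Let $\mu$ be the centered Gaussian measure on $H$ with covariance operator $$\overline Q=\sum_{i\ge1}\frac{\sigma_i^2\;e_i\otimes e_i}{2|\lambda_i|^{2\mathcal H}}\int_0^{\infty}e^{-s}s^{2\mathcal H}\,ds .$$ Then $r\mapsto(-C)^{-1}b(r,r)$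 is Bochner integrable with respect to $\mu$; almost surely $s\mapsto(-C)^{-1}b(w_s,w_s)$ is Bochner integrable on $[0,T]$ for all $T>0$; for every $T>0$ the time average $\frac1T\int_0^T(-C)^{-1}b(w_s,w_s)\,ds$ is in $L^2(\Omega;H)$; and, with the Itô–Stokes drift $\overline r=\int_H(-C)^{-1}b(r,r)\,d\mu(r)$, $$\frac1T\int_0^T(-C)^{-1}b(w_s,w_s)\,ds\;\longrightarrow\;\overline r\qquad\text{in }L^2(\Omega;H)\text{ as }T\to\infty .$$ -/

import Mathlib

open MeasureTheory ProbabilityTheory Filter Topology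
open scoped ENNReal NNReal

namespace ItoStokes

noncomputable section

/-! ### Vector fields on the torus `𝕋ᵈ = ℝᵈ / ℤᵈ` -/

/-- The normalized Lebesgue (Haar) measure on `𝕋ᵈ`. -/
abbrev torusMeasure (d : ℕ) : Measure (UnitAddTorus (Fin d)) :=
  Measure.pi fun _ => AddCircle.haarAddCircle

/-- The real Hilbert space `L²(𝕋ᵈ; ℝᵈ)`. -/
abbrev L2Field (d : ℕ) : Type := Lp (EuclideanSpace ℝ (Fin d)) 2 (torusMeasure d)

/-- The `k`-th Fourier coefficient `∫ u_j(x) e^{-2πi k·x} dx` of the `j`-th component of `u`. -/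
def coeff {d : ℕ} (u : L2Field d) (j : Fin d) (k : Fin d → ℤ) : ℂ :=
  UnitAddTorus.mFourierCoeff (fun x => ((u x j : ℝ) : ℂ)) k

/-- The `j`-th Cartesian component, as a continuous linear map into `L²(𝕋ᵈ; ℂ)`. -/
def component {d : ℕ} (j : Fin d) : L2Field d →L[ℝ] Lp ℂ 2 (torusMeasure d) :=
  (Complex.ofRealCLM ∘L (EuclideanSpace.proj j : EuclideanSpace ℝ (Fin d) →L[ℝ] ℝ)).compLpL
    2 (torusMeasure d)

lemma coeff_eq_inner {d : ℕ} (u : L2Field d) (j : Fin d) (k : Fin d → ℤ) :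
    coeff u j k = inner ℂ (UnitAddTorus.mFourierLp (d := Fin d) 2 k) (component j u) := by
  have h1 := UnitAddTorus.mFourierBasis_repr (d := Fin d) (component j u) k
  rw [HilbertBasis.repr_apply_apply, UnitAddTorus.coe_mFourierBasis] at h1
  refine Eq.trans ?_ h1.symm
  have h2 : (component j u : UnitAddTorus (Fin d) → ℂ) =ᵐ[torusMeasure d]
      fun x => ((u x j : ℝ) : ℂ) :=
    ContinuousLinearMap.coeFn_compLpL _ u
  refine integral_congr_ae ?_
  filter_upwards [h2] with x hx
  rw [hx]

lemma coeff_add {d : ℕ} (u v : L2Field d) (j : Fin d) (k : Fin d → ℤ) :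
    coeff (u + v) j k = coeff u j k + coeff v j k := by
  simp only [coeff_eq_inner, map_add, inner_add_right]

lemma coeff_smul {d : ℕ} (c : ℝ) (u : L2Field d) (j : Fin d) (k : Fin d → ℤ) :
    coeff (c • u) j k = (c : ℂ) * coeff u j k := by
  rw [coeff_eq_inner, coeff_eq_inner, map_smul, ← inner_smul_right]
  rfl

lemma continuous_coeff {d : ℕ} (j : Fin d) (k : Fin d → ℤ) :
    Continuous fun u : L2Field d => coeff u j k := by
  simp only [coeff_eq_inner]
  exact continuous_const.inner (component j).continuous

/-- The space `H` of the fields in `L²(𝕋ᵈ; ℝᵈ)` with zero mean and zero (distributional)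
divergence; both conditions are read off the Fourier coefficients. -/
def divFree (d : ℕ) : Submodule ℝ (L2Field d) where
  carrier := {u | (∀ j, coeff u j 0 = 0) ∧ ∀ k : Fin d → ℤ, ∑ j, (k j : ℂ) * coeff u j k = 0}
  zero_mem' := by
    have h : ∀ j k, coeff (0 : L2Field d) j k = 0 := fun j k => by
      rw [coeff_eq_inner, map_zero, inner_zero_right]
    simp [h]
  add_mem' := by
    rintro u v ⟨hu, hu'⟩ ⟨hv, hv'⟩
    refine ⟨fun j => by rw [coeff_add, hu, hv, add_zero], fun k => ?_⟩
    simp only [coeff_add, mul_add, Finset.sum_add_distrib, hu', hv', add_zero]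
  smul_mem' := by
    rintro c u ⟨hu, hu'⟩
    refine ⟨fun j => by rw [coeff_smul, hu, mul_zero], fun k => ?_⟩
    simp only [coeff_smul, mul_left_comm _ (c : ℂ), ← Finset.mul_sum, hu', mul_zero]

/-- The Hilbert space `H`, with the `L²` inner product. -/
abbrev H (d : ℕ) : Type := divFree d

lemma isClosed_divFree (d : ℕ) : IsClosed (divFree d : Set (L2Field d)) := by
  have h : (divFree d : Set (L2Field d)) = (⋂ j, {u | coeff u j 0 = 0}) ∩
      ⋂ k : Fin d → ℤ, {u | ∑ j, (k j : ℂ) * coeff u j k = 0} := by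
    ext u
    simp [divFree]
  rw [h]
  refine (isClosed_iInter fun j => ?_).inter (isClosed_iInter fun k => ?_)
  · exact isClosed_eq (continuous_coeff j 0) continuous_const
  · exact isClosed_eq (continuous_finsetSum _ fun j _ =>
      continuous_const.mul (continuous_coeff j k)) continuous_const

instance (d : ℕ) : CompleteSpace (divFree d) := (isClosed_divFree d).completeSpace_coe

instance (d : ℕ) : MeasurableSpace (divFree d) := borel _

instance (d : ℕ) : BorelSpace (divFree d) := ⟨rfl⟩

/-- The Leray projector `Π`: the orthogonal projection of `L²(𝕋ᵈ; ℝᵈ)` onto `H`. -/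
def leray (d : ℕ) : L2Field d →L[ℝ] H d := (divFree d).orthogonalProjectionOnto

/-- The square of the norm of `Hˢ = Dom((-A)^{s/2})`, where `A` is the Stokes operator, i.e.
the Fourier multiplier `-4π²|k|²`; the value is `∞` exactly when `u ∉ Hˢ`. -/
def sobolevNormSq {d : ℕ} (s : ℝ) (u : H d) : ℝ≥0∞ :=
  ∑' k : Fin d → ℤ, ENNReal.ofReal
    ((4 * Real.pi ^ 2 * ∑ j, (k j : ℝ) ^ 2) ^ s * ∑ j, ‖coeff (u : L2Field d) j k‖ ^ 2)

/-- `g` is the distributional derivative `∂_j v`. -/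
def IsPartialDeriv {d : ℕ} (j : Fin d) (v g : L2Field d) : Prop :=
  ∀ (i : Fin d) (k : Fin d → ℤ), coeff g i k = 2 * Real.pi * Complex.I * (k j : ℂ) * coeff v i k

/-- `F = (u·∇)v = ∑_j u_j ∂_j v`, where `v` has weak derivatives in `L²` and `F` is in `L²`. -/
def IsAdvection {d : ℕ} (u v : H d) (F : L2Field d) : Prop :=
  ∃ g : Fin d → L2Field d, (∀ j, IsPartialDeriv j (v : L2Field d) (g j)) ∧
    ∀ᵐ x ∂(torusMeasure d), F x = ∑ j, ((u : L2Field d) x j) • g j x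

lemma ext_coeff {d : ℕ} {u v : L2Field d} (h : ∀ j k, coeff u j k = coeff v j k) : u = v := by
  have hc : ∀ j, component j u = component j v := fun j => by
    refine (UnitAddTorus.mFourierBasis (d := Fin d)).repr.injective ?_
    ext k
    rw [HilbertBasis.repr_apply_apply, HilbertBasis.repr_apply_apply,
      UnitAddTorus.coe_mFourierBasis]
    exact (coeff_eq_inner u j k).symm.trans ((h j k).trans (coeff_eq_inner v j k))
  have hu : ∀ (z : L2Field d) j, (component j z : UnitAddTorus (Fin d) → ℂ) =ᵐ[torusMeasure d]
      fun x => ((z x j : ℝ) : ℂ) := fun z j => ContinuousLinearMap.coeFn_compLpL _ z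
  have hall : ∀ᵐ x ∂(torusMeasure d), ∀ j, u x j = v x j := by
    rw [ae_all_iff]
    intro j
    have h1 := hu u j
    rw [hc j] at h1
    filter_upwards [h1, hu v j] with x hx hx'
    exact_mod_cast hx.symm.trans hx'
  refine Lp.ext ?_
  filter_upwards [hall] with x hx
  ext j
  exact hx j

/-- The field `(u·∇)v` is unique. -/
lemma IsAdvection.unique {d : ℕ} {u v : H d} {F G : L2Field d} (hF : IsAdvection u v F)
    (hG : IsAdvection u v G) : F = G := by
  obtain ⟨f, hf, hF⟩ := hF
  obtain ⟨g, hg, hG⟩ := hG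
  have hfg : f = g := funext fun j => ext_coeff fun i k => (hf j i k).trans (hg j i k).symm
  subst hfg
  refine Lp.ext ?_
  filter_upwards [hF, hG] with x hx hx'
  exact hx.trans hx'.symm

open Classical in
/-- The Navier–Stokes nonlinearity `b(u, v) = Π((u·∇)v)`, for all `u, v ∈ H` for which `∇v` and
`(u·∇)v` are in `L²` (and `0` for the others). -/
def nsB {d : ℕ} (u v : H d) : H d :=
  if h : ∃ F : L2Field d, IsAdvection u v F then leray d h.choose else 0

lemma nsB_eq {d : ℕ} {u v : H d} {F : L2Field d} (hF : IsAdvection u v F) :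
    nsB u v = leray d F := by
  have h : ∃ F : L2Field d, IsAdvection u v F := ⟨F, hF⟩
  rw [nsB, dif_pos h, h.choose_spec.unique hF]

/-! ### The operators and the noise -/

/-- The operator `∑_i q_i e_i ⊗ e_i` on `H`. -/
def diagOp {d : ℕ} (q : ℕ → ℝ) (e : ℕ → H d) (x : H d) : H d :=
  ∑' i, (q i * inner ℝ (e i) x) • e i

/-- The assumptions on the spatial structure of the noise and on the friction operator `C`, an
unbounded operator on `H`; `R` is `(-C)⁻¹`. The space covariance of the noise is
`Q = ∑_i σ_i² e_i ⊗ e_i`. -/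
structure SmallScale (d : ℕ) (ξ : ℝ) (e : ℕ → H d) (σ lam : ℕ → ℝ)
    (C : H d →ₗ.[ℝ] H d) (R : H d →L[ℝ] H d) : Prop where
  xi_gt : (d : ℝ) / 2 + 2 < ξ
  orthonormal : Orthonormal ℝ e
  mem_sobolev : ∀ i, sobolevNormSq ξ (e i) < ∞
  sigma_nonneg : ∀ i, 0 ≤ σ i
  summable : ∑' i, ENNReal.ofReal (σ i ^ 2) * sobolevNormSq ξ (e i) < ∞
  closed : C.IsClosed
  dense : Dense (C.domain : Set (H d))
  /-- `C` commutes with `Q`. -/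
  comm : ∀ x : C.domain, ∃ h : diagOp (fun i => σ i ^ 2) e x ∈ C.domain,
    C ⟨diagOp (fun i => σ i ^ 2) e x, h⟩ = diagOp (fun i => σ i ^ 2) e (C x)
  /-- `0` is in the resolvent set of `C`, and `R` is the bounded inverse of `-C`. -/
  neg_right_inv : ∀ y, ∃ h : R y ∈ C.domain, -C ⟨R y, h⟩ = y
  neg_left_inv : ∀ x : C.domain, R (-C x) = x
  eigen : ∀ i, ∃ h : e i ∈ C.domain, C ⟨e i, h⟩ = lam i • e i
  sup_eigen : IsLUB (Set.range lam) (lam 0)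
  sup_neg : lam 0 < 0
  /-- `-⟨x, Cx⟩ ≳ ‖x‖²_{H^γ}` for some `γ ≥ 0`. -/
  coercive : ∃ γ : ℝ, 0 ≤ γ ∧ ∃ c : ℝ, 0 < c ∧ ∀ x : C.domain,
    ENNReal.ofReal c * sobolevNormSq γ (x : H d) ≤ ENNReal.ofReal (-inner ℝ (x : H d) (C x))

section Probability

variable {Ω : Type*} [MeasurableSpace Ω]

/-- `B` (restricted to times `t ≥ 0`) is a real fractional Brownian motion with Hurst parameter
`hurst`. -/
structure IsFBM (hurst : ℝ) (P : Measure Ω) (B : ℝ → Ω → ℝ) : Prop where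
  measurable : ∀ t, 0 ≤ t → Measurable (B t)
  gaussian : IsGaussianProcess (fun t : ℝ≥0 => B t) P
  mean : ∀ t, 0 ≤ t → ∫ ω, B t ω ∂P = 0
  cov : ∀ s t, 0 ≤ s → 0 ≤ t → ∫ ω, B s ω * B t ω ∂P =
    (t ^ (2 * hurst) + s ^ (2 * hurst) - |t - s| ^ (2 * hurst)) / 2
  continuous : ∀ᵐ ω ∂P, ContinuousOn (fun t => B t ω) (Set.Ici 0)

/-- `w` is a solution of `dw = C w dt + dW`, `w(0) = 0`, with noise `W_t = ∑_i σ_i e_i W^i_t`: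
a process with values in `H` and continuous paths such that `∫₀ᵗ w_s ds` is in the domain of `C`
and `w_t = C ∫₀ᵗ w_s ds + W_t` almost surely, for every `t ≥ 0`. -/
structure IsFOU {d : ℕ} (e : ℕ → H d) (σ : ℕ → ℝ) (C : H d →ₗ.[ℝ] H d) (P : Measure Ω)
    (W : ℕ → ℝ → Ω → ℝ) (w : ℝ → Ω → H d) : Prop where
  measurable : ∀ t, 0 ≤ t → AEStronglyMeasurable (w t) P
  continuous : ∀ᵐ ω ∂P, ContinuousOn (fun t => w t ω) (Set.Ici 0)
  initial : ∀ᵐ ω ∂P, w 0 ω = 0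
  equation : ∀ t, 0 ≤ t → ∀ᵐ ω ∂P, ∃ h : (∫ s in (0 : ℝ)..t, w s ω) ∈ C.domain,
    w t ω = C ⟨∫ s in (0 : ℝ)..t, w s ω, h⟩ + ∑' i, (σ i * W i t ω) • e i

end Probability

/-- `μ` is the centered Gaussian measure on `H` with covariance operator `K`. -/
structure IsCenteredGaussian {d : ℕ} (K : H d → H d) (μ : Measure (H d)) : Prop where
  gaussian : IsGaussian μ
  mean : ∀ x : H d, ∫ r, inner ℝ x r ∂μ = 0
  cov : ∀ x y : H d, ∫ r, inner ℝ x r * inner ℝ y r ∂μ = inner ℝ (K x) y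

/-- The eigenvalues `σ_i² / (2|λ_i|^{2𝓗}) ∫₀^∞ e^{-s} s^{2𝓗} ds` of the covariance `Q̄`. -/
def qBar (hurst : ℝ) (σ lam : ℕ → ℝ) (i : ℕ) : ℝ :=
  σ i ^ 2 / (2 * |lam i| ^ (2 * hurst)) *
    ∫ s in Set.Ioi (0 : ℝ), Real.exp (-s) * s ^ (2 * hurst)

/-- The time average `T⁻¹ ∫₀ᵀ (-C)⁻¹ b(w_s, w_s) ds`. -/
def timeAverage {d : ℕ} {Ω : Type*} (R : H d →L[ℝ] H d) (w : ℝ → Ω → H d) (T : ℝ) (ω : Ω) : H d :=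
  T⁻¹ • ∫ s in (0 : ℝ)..T, R (nsB (w s ω) (w s ω))

/-- The Itô–Stokes drift `r̄ = ∫ (-C)⁻¹ b(r, r) dμ(r)`. -/
def drift {d : ℕ} (R : H d →L[ℝ] H d) (μ : Measure (H d)) : H d :=
  ∫ r, R (nsB r r) ∂μ

end

end ItoStokes

namespace ItoStokes

noncomputable section

set_option linter.unusedSectionVars false

/-! ### Absolutely convergent Fourier series of real vector fields -/

/-! The functional `r ↦ (-C)⁻¹ b(r, r)` is quadratic, so on finitely many modes the claim is a mean
ergodic statement for products of two Gaussian coordinates. The rest is a truncation error, which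
has to be small uniformly in time.

Modes. The vectors `e i` need not span `H`, and `C` is not assumed self-adjoint. Commutation with
`Q` shows that `R = (-C)⁻¹` respects both the closed span of the active modes (those with `σ i ≠ 0`)
and its orthogonal complement. The component of `w` in the complement solves `z' = C z`, `z(0) = 0`,
and vanishes because `C` is dissipative. So `w` is the sum of its modes (`SmallScale.hasSum_modes`,
`ae_modes`), each solving a scalar linear equation. Integration by parts turns the scalar solution
into an average of increments `B_t - B_{(t - u/α)⁺}` over an exponential variable `u` (`ouInt_eq`),
so no stochastic integral is needed. Its covariance `ouCov` averages increment covariances over two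
independent exponentials. For `2 * hurst ≤ 1` these are dominated uniformly in time, and dominated
convergence gives both the limiting variance, which is the eigenvalue of `Q̄`
(`tendsto_ouCov_self`), and the decay of correlations (`tendsto_ouCov_of_ne`).

Ergodicity. The modes lie in the closed Gaussian span of the noise. Isserlis' formula writes the
covariance of two products through covariances of modes; these decay when the two rescaled times
differ. Hence the variance of the time average tends to zero (`tendsto_lintegral_average_mul`).

Truncation. `b` is bounded by the product of two Wiener norms (`enorm_nsB_le`), and the Wiener norm
is controlled by the `H^ξ` norm (`exists_wienerNorm_sq_le`). Fourth moments of Gaussian `H^ξ` norms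
are bounded by the weighted trace `∑ v i ‖e i‖²_{H^ξ}` (`GaussBound.lintegral_sobolevNormSq_sq_le`).
The process at every time and the stationary measure `μ` satisfy such a bound with the same weights,
so replacing the argument by its first `n` modes costs an `L²` error governed by the tail of one
convergent series (`exists_truncation_error`). Fixing `n` and letting `T → ∞` finishes the proof. -/

open UnitAddTorus in
/-- The real field `x ↦ Re (c e^{2πi k·x})`. -/
def modeField {d : ℕ} (k : Fin d → ℤ) (c : Fin d → ℂ) :
    C(UnitAddTorus (Fin d), EuclideanSpace ℝ (Fin d)) where
  toFun x := WithLp.toLp 2 fun i => (c i * mFourier k x).re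
  continuous_toFun := by fun_prop

lemma norm_mFourier_apply {d : ℕ} (k : Fin d → ℤ) (x : UnitAddTorus (Fin d)) :
    ‖UnitAddTorus.mFourier k x‖ = 1 := by
  simp [UnitAddTorus.mFourier, Circle.norm_coe]

lemma euclidean_norm_le_sum {d : ℕ} (x : EuclideanSpace ℝ (Fin d)) : ‖x‖ ≤ ∑ i, ‖x i‖ := by
  rw [EuclideanSpace.norm_eq]
  refine Real.sqrt_le_iff.2 ⟨by positivity, ?_⟩
  exact Finset.sum_sq_le_sq_sum_of_nonneg fun i _ => norm_nonneg _

lemma norm_modeField_le {d : ℕ} (k : Fin d → ℤ) (c : Fin d → ℂ) :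
    ‖modeField k c‖ ≤ ∑ i, ‖c i‖ := by
  refine (ContinuousMap.norm_le _ (by positivity)).2 fun x => ?_
  refine (euclidean_norm_le_sum _).trans (Finset.sum_le_sum fun i _ => ?_)
  calc ‖(c i * UnitAddTorus.mFourier k x).re‖ ≤ ‖c i * UnitAddTorus.mFourier k x‖ :=
        Complex.abs_re_le_norm _
    _ = ‖c i‖ := by rw [norm_mul, norm_mFourier_apply, mul_one]

/-- A continuous field as an element of `L²`. -/
def contToL2 (d : ℕ) : C(UnitAddTorus (Fin d), EuclideanSpace ℝ (Fin d)) →L[ℝ] L2Field d :=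
  ContinuousMap.toLp 2 (torusMeasure d) ℝ

lemma coeFn_contToL2 {d : ℕ} (f : C(UnitAddTorus (Fin d), EuclideanSpace ℝ (Fin d))) :
    contToL2 d f =ᵐ[torusMeasure d] f :=
  ContinuousMap.coeFn_toLp _ f

lemma norm_contToL2_le {d : ℕ} (f : C(UnitAddTorus (Fin d), EuclideanSpace ℝ (Fin d))) :
    ‖contToL2 d f‖ ≤ ‖f‖ := by
  have h := ContinuousMap.toLp_norm_le (p := 2) (E := EuclideanSpace ℝ (Fin d)) (𝕜 := ℝ)
    (torusMeasure d)
  refine ((contToL2 d).le_opNorm f).trans ?_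
  have h1 : ‖contToL2 d‖ ≤ 1 := by
    refine h.trans (le_of_eq ?_)
    simp [measureUnivNNReal]
  exact (mul_le_mul_of_nonneg_right h1 (norm_nonneg _)).trans (one_mul _).le

lemma integral_mFourier {d : ℕ} (k : Fin d → ℤ) :
    ∫ x, UnitAddTorus.mFourier k x ∂(torusMeasure d) = if k = 0 then 1 else 0 := by
  have h := orthonormal_iff_ite.1 (UnitAddTorus.orthonormal_mFourier (d := Fin d)) 0 k
  rw [ContinuousMap.inner_toLp] at h
  simp only [UnitAddTorus.mFourier_zero, ContinuousMap.one_apply, map_one, mul_one,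
    eq_comm (a := (0 : Fin d → ℤ))] at h
  exact h

lemma coeff_contToL2 {d : ℕ} (f : C(UnitAddTorus (Fin d), EuclideanSpace ℝ (Fin d)))
    (j : Fin d) (k : Fin d → ℤ) : coeff (contToL2 d f) j k =
      ∫ x, UnitAddTorus.mFourier (-k) x * ((f x j : ℝ) : ℂ) ∂(torusMeasure d) := by
  refine integral_congr_ae ?_
  filter_upwards [coeFn_contToL2 f] with x hx
  rw [hx, smul_eq_mul]

/-- The real part is half the mode plus half its conjugate, and the conjugate carries the opposite
frequency. Both terms are present when `k = 0`. -/
lemma coeff_modeField {d : ℕ} (k : Fin d → ℤ) (c : Fin d → ℂ) (j : Fin d) (m : Fin d → ℤ) :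
    coeff (contToL2 d (modeField k c)) j m =
      ((if m = k then c j else 0) + if m = -k then starRingEnd ℂ (c j) else 0) / 2 := by
  have hint : ∀ n : Fin d → ℤ, Integrable (fun x => UnitAddTorus.mFourier n x) (torusMeasure d) :=
    fun n => (UnitAddTorus.mFourier n).continuous.integrable_of_hasCompactSupport
      (HasCompactSupport.of_compactSpace _)
  have h1 : ∀ x, UnitAddTorus.mFourier (-m) x * (((modeField k c x) j : ℝ) : ℂ) =
      c j / 2 * UnitAddTorus.mFourier (k - m) x +
        starRingEnd ℂ (c j) / 2 * UnitAddTorus.mFourier (-k - m) x := by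
    intro x
    have h2 : (((modeField k c x) j : ℝ) : ℂ) = (c j * UnitAddTorus.mFourier k x +
        starRingEnd ℂ (c j * UnitAddTorus.mFourier k x)) / 2 := by
      rw [Complex.add_conj]
      simp [modeField]
    rw [h2, map_mul, ← UnitAddTorus.mFourier_neg, sub_eq_add_neg, sub_eq_add_neg,
      UnitAddTorus.mFourier_add, UnitAddTorus.mFourier_add]
    ring
  rw [coeff_contToL2]
  simp_rw [h1]
  rw [integral_add ((hint _).const_mul _) ((hint _).const_mul _), integral_const_mul,
    integral_const_mul, integral_mFourier, integral_mFourier]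
  have e1 : (k - m = 0) ↔ m = k := by rw [sub_eq_zero, eq_comm]
  have e2 : (-k - m = 0) ↔ m = -k := by rw [sub_eq_zero, eq_comm]
  simp only [e1, e2]
  split_ifs <;> ring

/-- The `k`-th Fourier coefficient of the `j`-th component, as a continuous linear map. -/
def coeffL {d : ℕ} (j : Fin d) (k : Fin d → ℤ) : L2Field d →L[ℝ] ℂ where
  toFun u := coeff u j k
  map_add' u v := coeff_add u v j k
  map_smul' c u := by simp [coeff_smul]
  cont := continuous_coeff j k

/-- An absolutely summable Hermitian family is the family of Fourier coefficients of a continuous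
real field. -/
lemma exists_contField {d : ℕ} (c : (Fin d → ℤ) → Fin d → ℂ)
    (hc : ∑' k, ∑ i, ‖c k i‖ₑ ≠ ∞) (hherm : ∀ k i, c (-k) i = starRingEnd ℂ (c k i)) :
    ∃ f : C(UnitAddTorus (Fin d), EuclideanSpace ℝ (Fin d)),
      ‖f‖ₑ ≤ ∑' k, ∑ i, ‖c k i‖ₑ ∧ ∀ j k, coeff (contToL2 d f) j k = c k j := by
  have hle : ∀ k, ‖modeField k (c k)‖ₑ ≤ ∑ i, ‖c k i‖ₑ := by
    intro k
    have := norm_modeField_le k (c k)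
    rw [← ofReal_norm, ← Finset.sum_congr rfl fun i _ => ofReal_norm (c k i),
      ← ENNReal.ofReal_sum_of_nonneg fun i _ => norm_nonneg _]
    exact ENNReal.ofReal_le_ofReal this
  have hlt : ∑' k, ‖modeField k (c k)‖ₑ ≠ ∞ := ne_top_of_le_ne_top hc (ENNReal.tsum_le_tsum hle)
  have hs : Summable fun k => modeField k (c k) := by
    refine Summable.of_nnnorm (ENNReal.tsum_coe_ne_top_iff_summable.1 ?_)
    exact hlt
  refine ⟨∑' k, modeField k (c k), ?_, fun j m => ?_⟩
  · exact (enorm_tsum_le_tsum_enorm (f := fun k => modeField k (c k))).trans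
      (ENNReal.tsum_le_tsum hle)
  · have h1 := hs.hasSum.mapL ((coeffL j m).comp (contToL2 d))
    have h2 : HasSum (fun k => ((if m = k then c k j else 0) +
        if m = -k then starRingEnd ℂ (c k j) else 0) / 2) (c m j) := by
      have e1 : HasSum (fun k => if m = k then c k j else 0) (c m j) := by
        refine (hasSum_ite_eq m (c m j)).congr_fun fun k => ?_
        by_cases h : k = m
        · simp [h]
        · simp [h, Ne.symm h]
      have e2 : HasSum (fun k => if m = -k then starRingEnd ℂ (c k j) else 0) (c m j) := by
        refine (hasSum_ite_eq (-m) (c m j)).congr_fun fun k => ?_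
        by_cases h : k = -m
        · simp [h, hherm]
        · have : ¬ m = -k := fun h' => h (by rw [h', neg_neg])
          simp [h, this]
      simpa using (e1.add e2).div_const 2
    refine h1.unique (h2.congr_fun fun k => ?_)
    exact coeff_modeField k (c k) j m

/-! ### Fields whose gradient has an absolutely convergent Fourier series -/

/-- Real-valuedness of the field; this supplies the Hermitian hypothesis of `exists_contField`. -/
lemma coeff_neg_freq {d : ℕ} (u : L2Field d) (j : Fin d) (k : Fin d → ℤ) :
    coeff u j (-k) = starRingEnd ℂ (coeff u j k) := by
  unfold coeff UnitAddTorus.mFourierCoeff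
  rw [← integral_conj]
  refine integral_congr_ae (.of_forall fun x => ?_)
  simp only [smul_eq_mul, map_mul, Complex.conj_ofReal, UnitAddTorus.mFourier_neg,
    Complex.conj_conj]

/-- The weight `1 + 2π ∑_j |k_j|`. -/
def freqWeight {d : ℕ} (k : Fin d → ℤ) : ℝ := 1 + 2 * Real.pi * ∑ j, |(k j : ℝ)|

lemma one_le_freqWeight {d : ℕ} (k : Fin d → ℤ) : 1 ≤ freqWeight k := by
  unfold freqWeight
  have : 0 ≤ 2 * Real.pi * ∑ j, |(k j : ℝ)| := by positivity
  linarith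

/-- The norm `∑_k (1 + 2π|k|₁) ∑_j |u_j(k)|`, with values in `[0, ∞]`. -/
def wienerNorm {d : ℕ} (u : H d) : ℝ≥0∞ :=
  ∑' k : Fin d → ℤ, ENNReal.ofReal (freqWeight k) * ∑ j, ‖coeff (u : L2Field d) j k‖ₑ

/-- The weights are at least `1`, so a finite Wiener norm makes the Fourier series itself absolutely
convergent. -/
lemma exists_contField_self {d : ℕ} {u : H d} (hu : wienerNorm u ≠ ∞) :
    ∃ f : C(UnitAddTorus (Fin d), EuclideanSpace ℝ (Fin d)),
      ‖f‖ₑ ≤ wienerNorm u ∧ contToL2 d f = u := by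
  have hle : ∑' k, ∑ i, ‖coeff (u : L2Field d) i k‖ₑ ≤ wienerNorm u := by
    refine ENNReal.tsum_le_tsum fun k => ?_
    have : 1 ≤ ENNReal.ofReal (freqWeight k) := by
      rw [ENNReal.one_le_ofReal]; exact one_le_freqWeight k
    calc _ = 1 * ∑ i, ‖coeff (u : L2Field d) i k‖ₑ := (one_mul _).symm
      _ ≤ _ := mul_le_mul_left this _
  obtain ⟨f, hf, hf'⟩ := exists_contField (fun k i => coeff (u : L2Field d) i k)
    (ne_top_of_le_ne_top hu hle) fun k i => coeff_neg_freq _ i k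
  exact ⟨f, hf.trans hle, ext_coeff hf'⟩

/-- The multiplier of `∂_l` has modulus `2π|k_l|`, which the weight `freqWeight k` dominates. -/
lemma exists_contField_deriv {d : ℕ} {u : H d} (hu : wienerNorm u ≠ ∞) (l : Fin d) :
    ∃ f : C(UnitAddTorus (Fin d), EuclideanSpace ℝ (Fin d)),
      ‖f‖ₑ ≤ wienerNorm u ∧ IsPartialDeriv l (u : L2Field d) (contToL2 d f) := by
  have hle : ∑' k : Fin d → ℤ, ∑ i, ‖2 * Real.pi * Complex.I * (k l : ℂ) *
      coeff (u : L2Field d) i k‖ₑ ≤ wienerNorm u := by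
    refine ENNReal.tsum_le_tsum fun k => ?_
    rw [Finset.mul_sum]
    refine Finset.sum_le_sum fun i _ => ?_
    rw [enorm_mul, ← ofReal_norm]
    refine mul_le_mul_left (ENNReal.ofReal_le_ofReal ?_) _
    have h1 : |(k l : ℝ)| ≤ ∑ j, |(k j : ℝ)| :=
      Finset.single_le_sum (f := fun j => |(k j : ℝ)|) (fun j _ => abs_nonneg _)
        (Finset.mem_univ l)
    have h2 : ‖(2 * Real.pi * Complex.I * (k l : ℂ) : ℂ)‖ = 2 * Real.pi * |(k l : ℝ)| := by
      simp [abs_of_pos Real.pi_pos]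
    rw [h2, freqWeight]
    have := mul_le_mul_of_nonneg_left h1 Real.two_pi_pos.le
    linarith
  obtain ⟨f, hf, hf'⟩ := exists_contField
    (fun k i => 2 * Real.pi * Complex.I * (k l : ℂ) * coeff (u : L2Field d) i k)
    (ne_top_of_le_ne_top hu hle) fun k i => by
      simp [coeff_neg_freq, Complex.conj_ofReal, map_ofNat]
  exact ⟨f, hf.trans hle, fun i k => hf' i k⟩

/-- Both the field and its derivatives have continuous representatives bounded by the Wiener norm,
so the product is estimated in the sup norm. The factor `d` counts the terms of `∑_j u_j ∂_j v`. -/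
lemma exists_isAdvection {d : ℕ} {u v : H d} (hu : wienerNorm u ≠ ∞) (hv : wienerNorm v ≠ ∞) :
    ∃ F, IsAdvection u v F ∧ ‖F‖ₑ ≤ d * (wienerNorm u * wienerNorm v) := by
  obtain ⟨f, hf, hfu⟩ := exists_contField_self hu
  choose g hg hgv using exists_contField_deriv hv
  let G : C(UnitAddTorus (Fin d), EuclideanSpace ℝ (Fin d)) :=
    ⟨fun x => ∑ j, f x j • g j x, by fun_prop⟩
  have hG : ‖G‖ ≤ ∑ j, ‖f‖ * ‖g j‖ := by
    refine (ContinuousMap.norm_le _ (by positivity)).2 fun x => ?_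
    change ‖∑ j, f x j • g j x‖ ≤ _
    refine (norm_sum_le _ _).trans (Finset.sum_le_sum fun j _ => ?_)
    rw [norm_smul]
    exact mul_le_mul ((PiLp.norm_apply_le (f x) j).trans (f.norm_coe_le_norm x))
      ((g j).norm_coe_le_norm x) (norm_nonneg _) (norm_nonneg _)
  refine ⟨contToL2 d G, ⟨fun j => contToL2 d (g j), hgv, ?_⟩, ?_⟩
  · have h1 : ∀ᵐ x ∂(torusMeasure d), ∀ j, contToL2 d (g j) x = g j x :=
      ae_all_iff.2 fun j => coeFn_contToL2 (g j)
    have h2 := coeFn_contToL2 f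
    rw [hfu] at h2
    filter_upwards [coeFn_contToL2 G, h2, h1] with x hx hx2 hx1
    rw [hx]
    simp [hx1, hx2, G]
  · have h3 : ‖contToL2 d G‖ₑ ≤ ‖G‖ₑ := by
      rw [← ofReal_norm, ← ofReal_norm]
      exact ENNReal.ofReal_le_ofReal (norm_contToL2_le G)
    refine h3.trans ?_
    have h4 : ‖G‖ₑ ≤ ∑ j, ‖f‖ₑ * ‖g j‖ₑ := by
      have : ∀ j, ‖f‖ₑ * ‖g j‖ₑ = ENNReal.ofReal (‖f‖ * ‖g j‖) := fun j => by
        rw [ENNReal.ofReal_mul (norm_nonneg _), ofReal_norm, ofReal_norm]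
      simp_rw [this]
      rw [← ENNReal.ofReal_sum_of_nonneg fun j _ => by positivity, ← ofReal_norm]
      exact ENNReal.ofReal_le_ofReal hG
    refine h4.trans ((Finset.sum_le_sum fun j _ => mul_le_mul' hf (hg j)).trans ?_)
    simp

lemma enorm_nsB_le {d : ℕ} {u v : H d} (hu : wienerNorm u ≠ ∞) (hv : wienerNorm v ≠ ∞) :
    ‖nsB u v‖ₑ ≤ d * (wienerNorm u * wienerNorm v) := by
  obtain ⟨F, hF, hF'⟩ := exists_isAdvection hu hv
  rw [nsB_eq hF]
  refine le_trans ?_ hF'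
  rw [← ofReal_norm, ← ofReal_norm]
  exact ENNReal.ofReal_le_ofReal (Submodule.norm_orthogonalProjectionOnto_apply_le _ _)

lemma IsPartialDeriv.add {d : ℕ} {j : Fin d} {v v' g g' : L2Field d} (h : IsPartialDeriv j v g)
    (h' : IsPartialDeriv j v' g') : IsPartialDeriv j (v + v') (g + g') := fun i k => by
  rw [coeff_add, coeff_add, h, h', mul_add]

lemma IsPartialDeriv.smul {d : ℕ} {j : Fin d} {v g : L2Field d} (c : ℝ)
    (h : IsPartialDeriv j v g) : IsPartialDeriv j (c • v) (c • g) := fun i k => by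
  rw [coeff_smul, coeff_smul, h, mul_left_comm]

lemma IsAdvection.add_right {d : ℕ} {u v v' : H d} {F F' : L2Field d} (h : IsAdvection u v F)
    (h' : IsAdvection u v' F') : IsAdvection u (v + v') (F + F') := by
  obtain ⟨g, hg, hF⟩ := h
  obtain ⟨g', hg', hF'⟩ := h'
  refine ⟨fun j => g j + g' j, fun j => (hg j).add (hg' j), ?_⟩
  have h1 : ∀ᵐ x ∂(torusMeasure d), ∀ j, (g j + g' j : L2Field d) x = g j x + g' j x :=
    ae_all_iff.2 fun j => Lp.coeFn_add _ _
  filter_upwards [hF, hF', h1, Lp.coeFn_add F F'] with x a b c e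
  rw [e, Pi.add_apply, a, b, ← Finset.sum_add_distrib]
  exact Finset.sum_congr rfl fun j _ => by rw [c j, smul_add]

lemma IsAdvection.smul_right {d : ℕ} {u v : H d} {F : L2Field d} (c : ℝ)
    (h : IsAdvection u v F) : IsAdvection u (c • v) (c • F) := by
  obtain ⟨g, hg, hF⟩ := h
  refine ⟨fun j => c • g j, fun j => (hg j).smul c, ?_⟩
  have h1 : ∀ᵐ x ∂(torusMeasure d), ∀ j, (c • g j : L2Field d) x = c • g j x :=
    ae_all_iff.2 fun j => Lp.coeFn_smul _ _
  filter_upwards [hF, h1, Lp.coeFn_smul c F] with x a b e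
  rw [e, Pi.smul_apply, a, Finset.smul_sum]
  exact Finset.sum_congr rfl fun j _ => by rw [b j, smul_comm]

lemma IsAdvection.add_left {d : ℕ} {u u' v : H d} {F F' : L2Field d} (h : IsAdvection u v F)
    (h' : IsAdvection u' v F') : IsAdvection (u + u') v (F + F') := by
  obtain ⟨g, hg, hF⟩ := h
  obtain ⟨g', hg', hF'⟩ := h'
  -- Weak derivatives are determined by their Fourier coefficients, so both advections use the same
  -- gradient of `v`.
  have : g' = g := funext fun j => ext_coeff fun i k => (hg' j i k).trans (hg j i k).symm
  subst this
  refine ⟨g', hg, ?_⟩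
  filter_upwards [hF, hF', Lp.coeFn_add (u : L2Field d) u', Lp.coeFn_add F F'] with x a b c e
  rw [e, Pi.add_apply, a, b, ← Finset.sum_add_distrib]
  refine Finset.sum_congr rfl fun j _ => ?_
  rw [← add_smul]
  congr 1
  rw [Submodule.coe_add, c]
  rfl

lemma IsAdvection.smul_left {d : ℕ} {u v : H d} {F : L2Field d} (c : ℝ)
    (h : IsAdvection u v F) : IsAdvection (c • u) v (c • F) := by
  obtain ⟨g, hg, hF⟩ := h
  refine ⟨g, hg, ?_⟩
  filter_upwards [hF, Lp.coeFn_smul c (u : L2Field d), Lp.coeFn_smul c F] with x a b e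
  rw [e, Pi.smul_apply, a, Finset.smul_sum]
  refine Finset.sum_congr rfl fun j _ => ?_
  rw [Submodule.coe_smul, b, smul_smul]
  rfl

lemma wienerNorm_add_le {d : ℕ} (u v : H d) :
    wienerNorm (u + v) ≤ wienerNorm u + wienerNorm v := by
  unfold wienerNorm
  rw [← ENNReal.tsum_add]
  refine ENNReal.tsum_le_tsum fun k => ?_
  rw [← mul_add, ← Finset.sum_add_distrib]
  refine mul_le_mul_right (Finset.sum_le_sum fun j _ => ?_) _
  rw [Submodule.coe_add, coeff_add]
  exact enorm_add_le _ _

lemma wienerNorm_smul {d : ℕ} (c : ℝ) (u : H d) : wienerNorm (c • u) = ‖c‖ₑ * wienerNorm u := by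
  unfold wienerNorm
  rw [← ENNReal.tsum_mul_left]
  refine tsum_congr fun k => ?_
  rw [mul_left_comm ‖c‖ₑ]
  refine congrArg _ ?_
  rw [Finset.mul_sum]
  refine Finset.sum_congr rfl fun j _ => ?_
  rw [Submodule.coe_smul, coeff_smul, enorm_mul]
  refine congrArg (· * _) ?_
  simp [← ofReal_norm]

/-- The subspace of the fields with finite `wienerNorm`. -/
def wienerSpace (d : ℕ) : Submodule ℝ (H d) where
  carrier := {u | wienerNorm u ≠ ∞}
  zero_mem' := by
    have := wienerNorm_smul (0 : ℝ) (0 : H d)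
    simp at this
    simp [this]
  add_mem' {u v} hu hv := ne_top_of_le_ne_top (ENNReal.add_ne_top.2 ⟨hu, hv⟩)
    (wienerNorm_add_le u v)
  smul_mem' c u hu := by
    change wienerNorm (c • u) ≠ ∞
    rw [wienerNorm_smul]
    exact ENNReal.mul_ne_top enorm_ne_top hu

/-- The nonlinearity as a bilinear map on `wienerSpace`. -/
def nsBilin (d : ℕ) : wienerSpace d →ₗ[ℝ] wienerSpace d →ₗ[ℝ] H d :=
  LinearMap.mk₂ ℝ (fun u v => nsB (u : H d) (v : H d))
    (fun u u' v => by
      obtain ⟨F, hF, -⟩ := exists_isAdvection u.2 v.2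
      obtain ⟨F', hF', -⟩ := exists_isAdvection u'.2 v.2
      rw [nsB_eq hF, nsB_eq hF', Submodule.coe_add, nsB_eq (hF.add_left hF'), map_add])
    (fun c u v => by
      obtain ⟨F, hF, -⟩ := exists_isAdvection u.2 v.2
      rw [nsB_eq hF, Submodule.coe_smul, nsB_eq (hF.smul_left c), map_smul])
    (fun u v v' => by
      obtain ⟨F, hF, -⟩ := exists_isAdvection u.2 v.2
      obtain ⟨F', hF', -⟩ := exists_isAdvection u.2 v'.2
      rw [nsB_eq hF, nsB_eq hF', Submodule.coe_add, nsB_eq (hF.add_right hF'), map_add])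
    (fun c u v => by
      obtain ⟨F, hF, -⟩ := exists_isAdvection u.2 v.2
      rw [nsB_eq hF, Submodule.coe_smul, nsB_eq (hF.smul_right c), map_smul])

/-! ### Sobolev norms -/

lemma int_vec_mem {d : ℕ} (k : Fin d → ℤ) :
    (fun j => (k j : ℝ)) ∈ Submodule.span ℤ (Set.range (Pi.basisFun ℝ (Fin d))) := by
  refine ((Pi.basisFun ℝ (Fin d)).mem_span_iff_repr_mem ℤ _).2 fun j => ⟨k j, ?_⟩
  simp

lemma summable_lattice {d : ℕ} {r : ℝ} (hr : r < -d) :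
    Summable fun z : Submodule.span ℤ (Set.range (Pi.basisFun ℝ (Fin d))) => ‖z‖ ^ r := by
  refine ZLattice.summable_norm_rpow (Submodule.span ℤ (Set.range (Pi.basisFun ℝ (Fin d)))) r ?_
  have hrank : Module.finrank ℤ (Submodule.span ℤ (Set.range (Pi.basisFun ℝ (Fin d)))) = d := by
    rw [ZLattice.rank ℝ]; simp
  rw [hrank]
  exact hr

/-- Integer vectors embed in the rank `d` lattice spanned by the standard basis, where negative
powers below `-d` are summable. -/
lemma summable_norm_int_rpow {d : ℕ} {r : ℝ} (hr : r < -d) :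
    Summable fun k : Fin d → ℤ => ‖fun j => (k j : ℝ)‖ ^ r := by
  have hinj : Function.Injective fun k : Fin d → ℤ =>
      (⟨fun j => (k j : ℝ), int_vec_mem k⟩ :
        Submodule.span ℤ (Set.range (Pi.basisFun ℝ (Fin d)))) := by
    intro k k' hkk
    ext j
    have h1 := congrFun (Subtype.ext_iff.1 hkk) j
    exact Int.cast_injective h1
  have h := (summable_lattice hr).comp_injective hinj
  refine h.congr fun k => ?_
  rw [Function.comp_apply, Submodule.coe_norm]

lemma tsum_mul_sq_le {ι : Type*} (f g : ι → ℝ≥0∞) :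
    (∑' i, f i * g i) ^ 2 ≤ (∑' i, f i ^ 2) * ∑' i, g i ^ 2 := by
  let _ : MeasurableSpace ι := ⊤
  have h := ENNReal.lintegral_mul_le_Lp_mul_Lq (Measure.count : Measure ι)
    Real.HolderConjugate.two_two (f := f) (g := g) measurable_from_top.aemeasurable
    measurable_from_top.aemeasurable
  simp only [lintegral_count, Pi.mul_apply, ENNReal.rpow_two] at h
  refine (pow_le_pow_left₀ zero_le h 2).trans (le_of_eq ?_)
  rw [mul_pow, ← ENNReal.rpow_two, ← ENNReal.rpow_two, ← ENNReal.rpow_mul, ← ENNReal.rpow_mul]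
  norm_num

lemma lintegral_mul_sq_le {α : Type*} [MeasurableSpace α] {μ : Measure α} {f g : α → ℝ≥0∞}
    (hf : AEMeasurable f μ) (hg : AEMeasurable g μ) :
    (∫⁻ a, f a * g a ∂μ) ^ 2 ≤ (∫⁻ a, f a ^ 2 ∂μ) * ∫⁻ a, g a ^ 2 ∂μ := by
  have h := ENNReal.lintegral_mul_le_Lp_mul_Lq μ Real.HolderConjugate.two_two hf hg
  simp only [Pi.mul_apply, ENNReal.rpow_two] at h
  refine (pow_le_pow_left₀ zero_le h 2).trans (le_of_eq ?_)
  rw [mul_pow, ← ENNReal.rpow_two, ← ENNReal.rpow_two, ← ENNReal.rpow_mul, ← ENNReal.rpow_mul]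
  norm_num

/-- The eigenvalue `4π²|k|²` of `-A`. -/
def freqSq {d : ℕ} (k : Fin d → ℤ) : ℝ := 4 * Real.pi ^ 2 * ∑ j, (k j : ℝ) ^ 2

lemma one_le_norm_int {d : ℕ} {k : Fin d → ℤ} (hk : k ≠ 0) : 1 ≤ ‖fun j => (k j : ℝ)‖ := by
  obtain ⟨j, hj⟩ := Function.ne_iff.1 hk
  refine le_trans ?_ (norm_le_pi_norm (fun j => (k j : ℝ)) j)
  rw [Real.norm_eq_abs, ← Int.cast_abs]
  exact_mod_cast Int.one_le_abs hj

lemma sq_norm_int_le_freqSq {d : ℕ} (k : Fin d → ℤ) : ‖fun j => (k j : ℝ)‖ ^ 2 ≤ freqSq k := by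
  have h1 : ‖fun j => (k j : ℝ)‖ ^ 2 ≤ ∑ j, (k j : ℝ) ^ 2 := by
    have : ‖fun j => (k j : ℝ)‖ ≤ Real.sqrt (∑ j, (k j : ℝ) ^ 2) := by
      refine (pi_norm_le_iff_of_nonneg (Real.sqrt_nonneg _)).2 fun j => ?_
      refine Real.le_sqrt_of_sq_le ?_
      rw [Real.norm_eq_abs, sq_abs]
      exact Finset.single_le_sum (f := fun j => (k j : ℝ) ^ 2) (fun _ _ => sq_nonneg _)
        (Finset.mem_univ j)
    calc _ ≤ Real.sqrt (∑ j, (k j : ℝ) ^ 2) ^ 2 := by gcongr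
      _ = _ := Real.sq_sqrt (Finset.sum_nonneg fun _ _ => sq_nonneg _)
  have h2 : 1 ≤ 4 * Real.pi ^ 2 := by nlinarith [Real.pi_gt_three]
  have h3 : 0 ≤ ∑ j, (k j : ℝ) ^ 2 := Finset.sum_nonneg fun _ _ => sq_nonneg _
  unfold freqSq
  nlinarith

lemma one_le_freqSq {d : ℕ} {k : Fin d → ℤ} (hk : k ≠ 0) : 1 ≤ freqSq k :=
  (one_le_pow₀ (one_le_norm_int hk)).trans (sq_norm_int_le_freqSq k)

lemma freqWeight_le {d : ℕ} {k : Fin d → ℤ} (hk : k ≠ 0) :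
    freqWeight k ≤ (1 + 2 * Real.pi * d) * ‖fun j => (k j : ℝ)‖ := by
  have h1 : ∑ j, |(k j : ℝ)| ≤ d * ‖fun j => (k j : ℝ)‖ := by
    calc _ ≤ ∑ _j : Fin d, ‖fun j => (k j : ℝ)‖ :=
          Finset.sum_le_sum fun j _ => norm_le_pi_norm (fun j => (k j : ℝ)) j
      _ = _ := by simp
  have h2 := one_le_norm_int hk
  have h3 := mul_le_mul_of_nonneg_left h1 Real.two_pi_pos.le
  unfold freqWeight
  nlinarith

lemma coeff_zero_freq {d : ℕ} (u : H d) (j : Fin d) : coeff (u : L2Field d) j 0 = 0 := u.2.1 j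

/-- Cauchy–Schwarz after splitting each weight as `a k * freqSq k ^ (ξ / 2)`. The squares of `a` are
of order `|k|^(2 - 2ξ)`, summable since `2ξ - 2 > d`. The zero frequency is dropped from `a`, which
is harmless because fields in `H` have zero mean. -/
lemma exists_wienerNorm_sq_le (d : ℕ) {ξ : ℝ} (hξ : (d : ℝ) / 2 + 1 < ξ) :
    ∃ K : ℝ≥0, ∀ u : H d, wienerNorm u ^ 2 ≤ K * sobolevNormSq ξ u := by
  have hξ0 : 0 < ξ := by have : (0 : ℝ) ≤ d := Nat.cast_nonneg d; linarith
  let a : (Fin d → ℤ) → ℝ≥0∞ := fun k =>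
    if k = 0 then 0 else ENNReal.ofReal (freqWeight k * (freqSq k) ^ (-(ξ / 2)))
  have ha : ∑' k, a k ^ 2 ≠ ∞ := by
    have hs := (summable_norm_int_rpow (d := d) (r := 2 - 2 * ξ) (by linarith)).mul_left
      ((1 + 2 * Real.pi * d) ^ 2)
    refine ne_top_of_le_ne_top hs.tsum_ofReal_ne_top (ENNReal.tsum_le_tsum fun k => ?_)
    by_cases hk : k = 0
    · simp [a, hk]
    have h0 := one_le_norm_int hk
    have hq := one_le_freqSq hk
    simp only [a, hk, if_false]
    rw [← ENNReal.ofReal_pow (by have := one_le_freqWeight k; positivity)]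
    refine ENNReal.ofReal_le_ofReal ?_
    rw [mul_pow, ← Real.rpow_natCast (freqSq k ^ _), ← Real.rpow_mul (by linarith)]
    have e1 : freqSq k ^ (-(ξ / 2) * (2 : ℕ)) ≤ ‖fun j => (k j : ℝ)‖ ^ (-(2 * ξ)) := by
      have : ‖fun j => (k j : ℝ)‖ ^ (-(2 * ξ)) = (‖fun j => (k j : ℝ)‖ ^ 2) ^ (-ξ) := by
        rw [← Real.rpow_natCast, ← Real.rpow_mul (by linarith)]
        congr 1; push_cast; ring
      rw [this]
      have e2 : -(ξ / 2) * (2 : ℕ) = -ξ := by push_cast; ring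
      rw [e2]
      exact Real.rpow_le_rpow_of_nonpos (by positivity) (sq_norm_int_le_freqSq k) (by linarith)
    have e3 : freqWeight k ^ 2 ≤ ((1 + 2 * Real.pi * d) * ‖fun j => (k j : ℝ)‖) ^ 2 :=
      pow_le_pow_left₀ (by linarith [one_le_freqWeight k]) (freqWeight_le hk) 2
    calc _ ≤ ((1 + 2 * Real.pi * d) * ‖fun j => (k j : ℝ)‖) ^ 2 *
          ‖fun j => (k j : ℝ)‖ ^ (-(2 * ξ)) := by gcongr
      _ = _ := by
        rw [mul_pow, mul_assoc, sub_eq_add_neg, Real.rpow_add (by linarith)]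
        norm_num
  refine ⟨((∑' k, a k ^ 2) * d).toNNReal, fun u => ?_⟩
  rw [ENNReal.coe_toNNReal (ENNReal.mul_ne_top ha (by simp))]
  let b : (Fin d → ℤ) → ℝ≥0∞ := fun k =>
    ENNReal.ofReal (freqSq k ^ (ξ / 2)) * ∑ j, ‖coeff (u : L2Field d) j k‖ₑ
  have h1 : wienerNorm u = ∑' k, a k * b k := by
    refine tsum_congr fun k => ?_
    by_cases hk : k = 0
    · simp [a, hk, coeff_zero_freq]
    have hq := one_le_freqSq hk
    simp only [a, b, hk, if_false]
    rw [← mul_assoc, ← ENNReal.ofReal_mul (by have := one_le_freqWeight k; positivity),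
      mul_assoc, ← Real.rpow_add (by linarith)]
    simp
  rw [h1]
  refine (tsum_mul_sq_le a b).trans ?_
  rw [mul_assoc]
  refine mul_le_mul_right ?_ _
  unfold sobolevNormSq
  rw [← ENNReal.tsum_mul_left]
  refine ENNReal.tsum_le_tsum fun k => ?_
  have hq : 0 ≤ freqSq k := (sq_nonneg _).trans (sq_norm_int_le_freqSq k)
  have h2 : ∑ j, ‖coeff (u : L2Field d) j k‖ₑ =
      ENNReal.ofReal (∑ j, ‖coeff (u : L2Field d) j k‖) := by
    rw [ENNReal.ofReal_sum_of_nonneg fun _ _ => norm_nonneg _]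
    simp
  simp only [b]
  rw [h2, ← ENNReal.ofReal_mul (by positivity), ← ENNReal.ofReal_pow (by positivity),
    ← ENNReal.ofReal_natCast d, ← ENNReal.ofReal_mul (by positivity)]
  refine ENNReal.ofReal_le_ofReal ?_
  -- Passing from the sum over components to the sum of squares costs the factor `d` in the
  -- constant.
  have h3 := sq_sum_le_card_mul_sum_sq (s := Finset.univ)
    (f := fun j => ‖coeff (u : L2Field d) j k‖)
  rw [Finset.card_univ, Fintype.card_fin] at h3
  rw [mul_pow, ← Real.rpow_natCast (freqSq k ^ _), ← Real.rpow_mul hq]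
  have e : ξ / 2 * (2 : ℕ) = ξ := by push_cast; ring
  rw [e, mul_left_comm]
  exact mul_le_mul_of_nonneg_left h3 (by positivity)

lemma hasSum_coeff_sq {d : ℕ} (u : L2Field d) (j : Fin d) :
    HasSum (fun k => ‖coeff u j k‖ ^ 2) (∫ x, (u x j) ^ 2 ∂(torusMeasure d)) := by
  have h := UnitAddTorus.hasSum_sq_mFourierCoeff (component j u)
  have h2 : (component j u : UnitAddTorus (Fin d) → ℂ) =ᵐ[torusMeasure d]
      fun x => ((u x j : ℝ) : ℂ) := ContinuousLinearMap.coeFn_compLpL _ u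
  have e1 : ∫ t, ‖component j u t‖ ^ 2 ∂(torusMeasure d) =
      ∫ x, (u x j) ^ 2 ∂(torusMeasure d) := by
    refine integral_congr_ae ?_
    filter_upwards [h2] with x hx
    rw [hx]; simp
  have e2 : ∀ k, UnitAddTorus.mFourierCoeff (component j u) k = coeff u j k := fun k => by
    refine integral_congr_ae ?_
    filter_upwards [h2] with x hx
    rw [hx]
  simp_rw [e2] at h
  rw [← e1]
  exact h

lemma norm_sq_eq_sum_integral {d : ℕ} (u : L2Field d) :
    ‖u‖ ^ 2 = ∑ j, ∫ x, (u x j) ^ 2 ∂(torusMeasure d) := by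
  rw [← integral_finsetSum, ← real_inner_self_eq_norm_sq, L2.inner_def]
  · refine integral_congr_ae (.of_forall fun x => ?_)
    simp only [real_inner_self_eq_norm_sq, EuclideanSpace.norm_sq_eq, Real.norm_eq_abs, sq_abs]
  · intro j _
    have h : MemLp (fun x => u x j) 2 (torusMeasure d) :=
      (EuclideanSpace.proj j : EuclideanSpace ℝ (Fin d) →L[ℝ] ℝ).comp_memLp' (Lp.memLp u)
    exact h.integrable_sq

/-- Parseval, together with the zero mean: every frequency that survives has `4π²|k|² ≥ 1`. -/
lemma enorm_sq_le_sobolevNormSq {d : ℕ} {s : ℝ} (hs : 0 ≤ s) (u : H d) :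
    ‖u‖ₑ ^ 2 ≤ sobolevNormSq s u := by
  have h1 : HasSum (fun k => ∑ j, ‖coeff (u : L2Field d) j k‖ ^ 2) (‖(u : L2Field d)‖ ^ 2) := by
    rw [norm_sq_eq_sum_integral]
    exact hasSum_sum fun j _ => hasSum_coeff_sq _ j
  have h2 : ‖u‖ₑ ^ 2 = ENNReal.ofReal (‖(u : L2Field d)‖ ^ 2) := by
    rw [ENNReal.ofReal_pow (norm_nonneg _), ofReal_norm]; rfl
  rw [h2, ← h1.tsum_eq, ENNReal.ofReal_tsum_of_nonneg (fun _ => by positivity) h1.summable]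
  refine ENNReal.tsum_le_tsum fun k => ENNReal.ofReal_le_ofReal ?_
  by_cases hk : k = 0
  · simp [hk, coeff_zero_freq]
  · exact le_mul_of_one_le_left (by positivity) (Real.one_le_rpow (one_le_freqSq hk) hs)

/-- The real (`b = true`) or imaginary part of a Fourier coefficient. -/
def coeffPart {d : ℕ} (p : (Fin d → ℤ) × Fin d × Bool) : H d →L[ℝ] ℝ :=
  (bif p.2.2 then Complex.reCLM else Complex.imCLM) ∘L coeffL p.2.1 p.1 ∘L (divFree d).subtypeL

/-- A countable sum of squares of real continuous functionals is the form to which `GaussBound`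
applies. -/
lemma sobolevNormSq_eq_tsum_coeffPart {d : ℕ} (s : ℝ) (u : H d) :
    sobolevNormSq s u = ∑' p : (Fin d → ℤ) × Fin d × Bool,
      ENNReal.ofReal (freqSq p.1 ^ s) * ‖coeffPart p u‖ₑ ^ 2 := by
  rw [ENNReal.tsum_prod']
  refine tsum_congr fun k => ?_
  have hq : 0 ≤ freqSq k := (sq_nonneg _).trans (sq_norm_int_le_freqSq k)
  change ENNReal.ofReal (freqSq k ^ s * _) =
    ∑' q : Fin d × Bool, ENNReal.ofReal (freqSq k ^ s) * ‖coeffPart (k, q) u‖ₑ ^ 2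
  rw [ENNReal.tsum_mul_left, ENNReal.ofReal_mul (by positivity), ENNReal.tsum_prod', tsum_fintype,
    ENNReal.ofReal_sum_of_nonneg fun _ _ => by positivity]
  refine congrArg _ (Finset.sum_congr rfl fun j _ => ?_)
  have e1 : ∀ x : ℝ, ‖x‖ₑ ^ 2 = ENNReal.ofReal (x ^ 2) := fun x => by
    rw [← ofReal_norm, ← ENNReal.ofReal_pow (norm_nonneg _), Real.norm_eq_abs, sq_abs]
  rw [tsum_fintype, Fintype.sum_bool, e1, e1, ← ENNReal.ofReal_add (sq_nonneg _) (sq_nonneg _)]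
  congr 1
  rw [Complex.sq_norm, Complex.normSq_apply, ← sq, ← sq]
  rfl

/-! ### Fourth moments -/

/-- All continuous linear functionals of `X` satisfy the fourth moment bound of a centered Gaussian
variable whose variance is that of `∑_i √v_i g_i e_i` with independent standard normal `g_i`. -/
def GaussBound {d : ℕ} {Ω : Type*} [MeasurableSpace Ω] (P : Measure Ω) (e : ℕ → H d)
    (v : ℕ → ℝ≥0∞) (X : Ω → H d) : Prop :=
  ∀ ℓ : H d →L[ℝ] ℝ, ∫⁻ ω, ‖ℓ (X ω)‖ₑ ^ 4 ∂P ≤ 3 * (∑' i, v i * ‖ℓ (e i)‖ₑ ^ 2) ^ 2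

/-- Expand the square into a double series and apply Cauchy–Schwarz to each product. With `f i` the
square of a functional, this turns fourth moments of single functionals into the fourth moment of a
Hilbert norm. -/
lemma lintegral_tsum_sq_le {α ι : Type*} [Countable ι] [MeasurableSpace α] {μ : Measure α}
    {f : ι → α → ℝ≥0∞} (hf : ∀ i, AEMeasurable (f i) μ) {c : ℝ≥0∞} {b : ι → ℝ≥0∞}
    (h : ∀ i, ∫⁻ a, f i a ^ 2 ∂μ ≤ c * b i ^ 2) :
    ∫⁻ a, (∑' i, f i a) ^ 2 ∂μ ≤ c * (∑' i, b i) ^ 2 := by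
  have h1 : ∀ i j, ∫⁻ a, f i a * f j a ∂μ ≤ c * (b i * b j) := fun i j => by
    have := (lintegral_mul_sq_le (hf i) (hf j)).trans (mul_le_mul' (h i) (h j))
    have e : c * b i ^ 2 * (c * b j ^ 2) = (c * (b i * b j)) ^ 2 := by ring
    rw [e] at this
    exact (ENNReal.pow_le_pow_left_iff two_ne_zero).1 this
  have e2 : ∀ g : ι → ℝ≥0∞, (∑' i, g i) ^ 2 = ∑' i, ∑' j, g i * g j := fun g => by
    simp_rw [sq, ENNReal.tsum_mul_left, ENNReal.tsum_mul_right]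
  simp_rw [e2]
  have hm : ∀ i j, AEMeasurable (fun a => f i a * f j a) μ := fun i j => (hf i).mul (hf j)
  rw [lintegral_tsum fun i => AEMeasurable.tsum fun j => hm i j, ← ENNReal.tsum_mul_left]
  refine ENNReal.tsum_le_tsum fun i => ?_
  rw [lintegral_tsum fun j => hm i j, ← ENNReal.tsum_mul_left]
  exact ENNReal.tsum_le_tsum fun j => h1 i j

lemma aemeasurable_wienerNorm {d : ℕ} {Ω : Type*} [MeasurableSpace Ω] {P : Measure Ω}
    {X : Ω → H d} (hX : AEStronglyMeasurable X P) :
    AEMeasurable (fun ω => wienerNorm (X ω)) P := by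
  refine AEMeasurable.tsum fun k => AEMeasurable.const_mul ?_ _
  refine Finset.aemeasurable_fun_sum _ fun j _ => ?_
  exact ((continuous_coeff j k).comp_aestronglyMeasurable
    (continuous_subtype_val.comp_aestronglyMeasurable hX)).enorm

/-- The bound of `GaussBound` for each Fourier functional is summed by `lintegral_tsum_sq_le`.
Exchanging the sums over frequencies and over modes reassembles the Sobolev norms of the `e i`. -/
lemma GaussBound.lintegral_sobolevNormSq_sq_le {d : ℕ} {Ω : Type*} [MeasurableSpace Ω]
    {P : Measure Ω} {e : ℕ → H d} {v : ℕ → ℝ≥0∞} {X : Ω → H d} (h : GaussBound P e v X)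
    (hX : AEStronglyMeasurable X P) (s : ℝ) :
    ∫⁻ ω, sobolevNormSq s (X ω) ^ 2 ∂P ≤ 3 * (∑' i, v i * sobolevNormSq s (e i)) ^ 2 := by
  simp_rw [sobolevNormSq_eq_tsum_coeffPart]
  have hm : ∀ p, AEMeasurable (fun ω => ENNReal.ofReal (freqSq p.1 ^ s) *
      ‖coeffPart (d := d) p (X ω)‖ₑ ^ 2) P := fun p =>
    ((((coeffPart p).continuous.comp_aestronglyMeasurable hX).enorm).pow_const 2).const_mul _
  refine (lintegral_tsum_sq_le hm (c := 3) (b := fun p => ENNReal.ofReal (freqSq p.1 ^ s) *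
    ∑' i, v i * ‖coeffPart p (e i)‖ₑ ^ 2) fun p => ?_).trans (le_of_eq ?_)
  · simp_rw [mul_pow, ← pow_mul]
    rw [lintegral_const_mul' _ _ (by simp), mul_left_comm]
    exact mul_le_mul_right (h _) _
  · simp_rw [← ENNReal.tsum_mul_left]
    rw [ENNReal.tsum_comm]
    congr 3
    ext i
    refine tsum_congr fun p => ?_
    ring

/-! ### Pathwise analysis of the linear equation -/

/-- The stochastic equation holds almost surely at each fixed time. Rational times give a single
null set, and continuity extends identities to all times. -/
lemma eqOn_Ici_of_rat {E : Type*} [TopologicalSpace E] [T2Space E] {f g : ℝ → E}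
    (hf : ContinuousOn f (Set.Ici 0)) (hg : ContinuousOn g (Set.Ici 0))
    (h : ∀ q : ℚ, 0 ≤ q → f q = g q) : Set.EqOn f g (Set.Ici 0) := by
  have hc : ∀ {k : ℝ → E}, ContinuousOn k (Set.Ici 0) → Continuous fun t => k (max t 0) :=
    fun hk => hk.comp_continuous (by fun_prop) fun t => Set.mem_Ici.2 (le_max_right _ _)
  have key := Rat.denseRange_cast.equalizer (hc hf) (hc hg) (funext fun q : ℚ => by
    have := h (max q 0) (le_max_right _ _)
    simpa using this)
  intro t ht
  have := congrFun key t
  simpa [max_eq_left (Set.mem_Ici.1 ht)] using this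

/-- Continuous primitives of functions that are continuous on `[0, ∞)`. -/
lemma continuousOn_primitive_Ici {E : Type*} [NormedAddCommGroup E] [NormedSpace ℝ E] {f : ℝ → E}
    (hf : ContinuousOn f (Set.Ici 0)) :
    ContinuousOn (fun t => ∫ s in (0 : ℝ)..t, f s) (Set.Ici 0) := by
  have hc : Continuous fun t => f (max t 0) :=
    hf.comp_continuous (by fun_prop) fun t => Set.mem_Ici.2 (le_max_right _ _)
  refine (intervalIntegral.continuous_primitive
    (fun a b => hc.intervalIntegrable (μ := volume) a b) 0).continuousOn.congr fun t ht => ?_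
  refine intervalIntegral.integral_congr fun s hs => ?_
  rw [Set.uIcc_of_le (Set.mem_Ici.1 ht)] at hs
  simp [max_eq_left hs.1]

/-- Integrating factor: `e^{-at} ∫₀ᵗ x` has derivative `c e^{-at} g(t)`. Working with the primitive
of `x` avoids differentiating the rough driver `g`. -/
lemma solve_scalar_linear {x g : ℝ → ℝ} (hx : ContinuousOn x (Set.Ici 0))
    (hg : ContinuousOn g (Set.Ici 0)) {a c : ℝ}
    (h : ∀ t, 0 ≤ t → x t = a * (∫ s in (0 : ℝ)..t, x s) + c * g t) {t : ℝ} (ht : 0 ≤ t) :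
    x t = c * (g t + a * ∫ s in (0 : ℝ)..t, Real.exp (a * (t - s)) * g s) := by
  have hxc : Continuous fun t => x (max t 0) :=
    hx.comp_continuous (by fun_prop) fun t => Set.mem_Ici.2 (le_max_right _ _)
  have hgc : Continuous fun t => g (max t 0) :=
    hg.comp_continuous (by fun_prop) fun t => Set.mem_Ici.2 (le_max_right _ _)
  have hy : ∀ s, 0 ≤ s → ∫ r in (0 : ℝ)..s, x (max r 0) = ∫ r in (0 : ℝ)..s, x r := fun s hs => by
    refine intervalIntegral.integral_congr fun r hr => ?_
    rw [Set.uIcc_of_le hs] at hr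
    simp [max_eq_left hr.1]
  have hderiv : ∀ s ∈ Set.uIcc 0 t, HasDerivAt
      (fun s => Real.exp (-a * s) * ∫ r in (0 : ℝ)..s, x (max r 0))
      (c * (Real.exp (-a * s) * g (max s 0))) s := fun s hs => by
    rw [Set.uIcc_of_le ht] at hs
    have h1 : HasDerivAt (fun s => ∫ r in (0 : ℝ)..s, x (max r 0)) (x (max s 0)) s :=
      intervalIntegral.integral_hasDerivAt_right (hxc.intervalIntegrable _ _)
        (hxc.stronglyMeasurableAtFilter _ _) hxc.continuousAt
    have h2 : HasDerivAt (fun s => Real.exp (-a * s)) (Real.exp (-a * s) * (-a)) s := by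
      simpa using ((hasDerivAt_id s).const_mul (-a)).exp
    refine (h2.mul h1).congr_deriv ?_
    rw [max_eq_left hs.1, h s hs.1, hy s hs.1]
    ring
  have hint := intervalIntegral.integral_eq_sub_of_hasDerivAt hderiv
    (Continuous.intervalIntegrable
    (continuous_const.mul ((by fun_prop : Continuous fun s => Real.exp (-a * s)).mul hgc)) _ _)
  simp only [intervalIntegral.integral_same, mul_zero, sub_zero] at hint
  rw [intervalIntegral.integral_const_mul, hy t ht] at hint
  have h3 : ∫ s in (0 : ℝ)..t, Real.exp (a * (t - s)) * g s =
      Real.exp (a * t) * ∫ s in (0 : ℝ)..t, Real.exp (-a * s) * g (max s 0) := by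
    rw [← intervalIntegral.integral_const_mul]
    refine intervalIntegral.integral_congr fun r hr => ?_
    rw [Set.uIcc_of_le ht] at hr
    simp only [max_eq_left hr.1, ← mul_assoc, ← Real.exp_add]
    congr 2
    ring
  have h4 : Real.exp (a * t) * Real.exp (-a * t) = 1 := by
    rw [← Real.exp_add]; simp
  rw [h t ht, h3]
  linear_combination (-a * Real.exp (a * t)) * hint - (a * ∫ s in (0 : ℝ)..t, x s) * h4

/-! ### Hilbert space tools: dissipative evolution, orthonormal expansions, invariant complements.
-/

section Hilbert

variable {E : Type*} [NormedAddCommGroup E] [InnerProductSpace ℝ E]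

/-- The energy `‖Y‖²` of the primitive has derivative `2⟨Y, Y'⟩ ≤ 0` and starts from zero. -/
lemma primitive_eq_zero_of_inner_nonpos [CompleteSpace E] {z : ℝ → E}
    (hz : ContinuousOn z (Set.Ici 0))
    (h : ∀ t, 0 ≤ t → inner ℝ (∫ s in (0 : ℝ)..t, z s) (z t) ≤ 0) {t : ℝ} (ht : 0 ≤ t) :
    ∫ s in (0 : ℝ)..t, z s = 0 := by
  have hc : Continuous fun t => z (max t 0) :=
    hz.comp_continuous (by fun_prop) fun t => Set.mem_Ici.2 (le_max_right _ _)
  let Y : ℝ → E := fun t => ∫ r in (0 : ℝ)..t, z (max r 0)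
  have hY : ∀ s, 0 ≤ s → Y s = ∫ r in (0 : ℝ)..s, z r := fun s hs => by
    refine intervalIntegral.integral_congr fun r hr => ?_
    rw [Set.uIcc_of_le hs] at hr
    simp [max_eq_left hr.1]
  have hd : ∀ s, HasDerivAt (fun s => ‖Y s‖ ^ 2) (2 * inner ℝ (Y s) (z (max s 0))) s := fun s => by
    have h1 : HasDerivAt Y (z (max s 0)) s :=
      intervalIntegral.integral_hasDerivAt_right (hc.intervalIntegrable _ _)
        (hc.stronglyMeasurableAtFilter _ _) hc.continuousAt
    exact h1.norm_sq
  have hanti : AntitoneOn (fun s => ‖Y s‖ ^ 2) (Set.Ici 0) := by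
    refine antitoneOn_of_deriv_nonpos (convex_Ici 0)
      (fun s _ => (hd s).continuousAt.continuousWithinAt)
      (fun s _ => (hd s).differentiableAt.differentiableWithinAt) fun s hs => ?_
    rw [interior_Ici, Set.mem_Ioi] at hs
    rw [(hd s).deriv, max_eq_left hs.le, hY s hs.le]
    linarith [h s hs.le]
  have h1 := hanti (Set.mem_Ici.2 le_rfl) (Set.mem_Ici.2 ht) ht
  have h2 : Y 0 = 0 := intervalIntegral.integral_same
  simp only [h2, norm_zero] at h1
  have h3 : ‖Y t‖ ^ 2 = 0 := le_antisymm (by simpa using h1) (sq_nonneg _)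
  rw [← hY t ht]
  simpa using h3

lemma summable_orthonormal_smul [CompleteSpace E] {e : ℕ → E} (he : Orthonormal ℝ e) {q : ℕ → ℝ}
    (hq : Summable q) (x : E) : Summable fun i => (q i * inner ℝ (e i) x) • e i := by
  refine Summable.of_norm_bounded (hq.abs.mul_right ‖x‖) fun i => ?_
  rw [norm_smul, he.1 i, mul_one, norm_mul, Real.norm_eq_abs]
  gcongr
  simpa [he.1 i] using norm_inner_le_norm (𝕜 := ℝ) (e i) x

lemma hasSum_inner_tsum [CompleteSpace E] {e : ℕ → E} (he : Orthonormal ℝ e) {q : ℕ → ℝ}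
    (hq : Summable q) (x y : E) : HasSum (fun i => q i * (inner ℝ (e i) x * inner ℝ (e i) y))
      (inner ℝ (∑' i, (q i * inner ℝ (e i) x) • e i) y) := by
  have h := (summable_orthonormal_smul he hq x).hasSum.mapL (innerSL ℝ y)
  rw [innerSL_apply_apply, real_inner_comm] at h
  refine h.congr_fun fun i => ?_
  rw [innerSL_apply_apply, real_inner_smul_right, real_inner_comm y]
  ring

lemma inner_eq_zero_of_mem_closure_span {s : Set E} {x z : E}
    (hx : x ∈ (Submodule.span ℝ s).topologicalClosure) (h : ∀ y ∈ s, inner ℝ y z = 0) :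
    inner ℝ x z = 0 := by
  have h1 : (Submodule.span ℝ s).topologicalClosure ≤ LinearMap.ker (innerSL ℝ z).toLinearMap := by
    refine Submodule.topologicalClosure_minimal _ (Submodule.span_le.2 fun y hy => ?_)
      (innerSL ℝ z).isClosed_ker
    simpa [real_inner_comm] using h y hy
  have h2 := h1 hx
  rw [real_inner_comm]
  simpa using h2

lemma eq_zero_of_mem_closure_span {s : Set E} {x : E}
    (hx : x ∈ (Submodule.span ℝ s).topologicalClosure) (h : ∀ y ∈ s, inner ℝ y x = 0) : x = 0 :=
  inner_self_eq_zero.1 (inner_eq_zero_of_mem_closure_span hx h)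

/-- A vector of the closed span of an orthonormal family is the sum of its expansion. -/
lemma hasSum_inner_smul_of_mem_closure [CompleteSpace E] {e : ℕ → E} (he : Orthonormal ℝ e)
    {x : E} (hx : x ∈ (Submodule.span ℝ (Set.range e)).topologicalClosure) :
    HasSum (fun i => inner ℝ (e i) x • e i) x := by
  have hs : Summable fun i => inner ℝ (e i) x • e i :=
    (he.orthogonalFamily.summable_iff_norm_sq_summable fun i => inner ℝ (e i) x).2
      (he.inner_products_summable (x := x))
  have hmem : ∑' i, inner ℝ (e i) x • e i ∈ (Submodule.span ℝ (Set.range e)).topologicalClosure :=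
    (Submodule.isClosed_topologicalClosure _).mem_of_tendsto hs.hasSum (.of_forall fun s =>
      Submodule.sum_mem _ fun i _ => Submodule.smul_mem _ _ (Submodule.le_topologicalClosure _
        (Submodule.subset_span ⟨i, rfl⟩)))
  have h0 : x - ∑' i, inner ℝ (e i) x • e i = 0 := by
    refine eq_zero_of_mem_closure_span (Submodule.sub_mem _ hx hmem) ?_
    rintro _ ⟨j, rfl⟩
    have h1 : HasSum (fun i => inner ℝ (e j) (inner ℝ (e i) x • e i)) (inner ℝ (e j) x) := by
      refine (hasSum_ite_eq j (inner ℝ (e j) x)).congr_fun fun i => ?_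
      rw [real_inner_smul_right, orthonormal_iff_ite.1 he]
      by_cases hij : i = j
      · simp [hij]
      · simp [hij, Ne.symm hij]
    have h2 := (hs.hasSum.mapL (innerSL ℝ (e j))).unique h1
    rw [innerSL_apply_apply] at h2
    rw [inner_sub_right, h2, sub_self]
  have h := hs.hasSum
  rwa [← sub_eq_zero.1 h0] at h

/-- An operator that acts diagonally on some `e i`, in the strong and the weak sense, commutes with
the projection onto their orthogonal complement. -/
lemma exists_projection_comm [CompleteSpace E] {e : ℕ → E} {S : Set ℕ} {r : ℕ → ℝ}
    {R : E →L[ℝ] E} (h1 : ∀ i ∈ S, R (e i) = r i • e i)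
    (h2 : ∀ i ∈ S, ∀ y, inner ℝ (e i) (R y) = r i * inner ℝ (e i) y) :
    ∃ p : E →L[ℝ] E, (∀ y, R (p y) = p (R y)) ∧ (∀ i ∈ S, p (e i) = 0) ∧
      ∀ y, p y = 0 → y ∈ (Submodule.span ℝ (e '' S)).topologicalClosure := by
  set M := (Submodule.span ℝ (e '' S)).topologicalClosure with hM
  have : CompleteSpace M := (Submodule.isClosed_topologicalClosure _).completeSpace_coe
  have hR : ∀ x ∈ M, R x ∈ M := by
    have : M ≤ M.comap R.toLinearMap := by
      refine Submodule.topologicalClosure_minimal _ (Submodule.span_le.2 ?_)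
        ((Submodule.isClosed_topologicalClosure _).preimage R.continuous)
      rintro _ ⟨i, hi, rfl⟩
      change R (e i) ∈ M
      rw [h1 i hi]
      exact Submodule.smul_mem _ _ (Submodule.le_topologicalClosure _
        (Submodule.subset_span ⟨i, hi, rfl⟩))
    exact fun x hx => this hx
  have hperp : ∀ x ∈ Mᗮ, R x ∈ Mᗮ := fun x hx => by
    rw [hM, Submodule.orthogonal_closure, Submodule.mem_orthogonal] at hx ⊢
    intro u hu
    induction hu using Submodule.span_induction with
    | mem u hu =>
      obtain ⟨i, hi, rfl⟩ := hu
      rw [h2 i hi, hx _ (Submodule.subset_span ⟨i, hi, rfl⟩), mul_zero]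
    | zero => simp
    | add u v _ _ hu hv => rw [inner_add_left, hu, hv, add_zero]
    | smul c u _ hu => rw [real_inner_smul_left, hu, mul_zero]
  refine ⟨ContinuousLinearMap.id ℝ E - M.starProjection, fun y => ?_, fun i hi => ?_, fun y hy => ?_⟩
  · have : M.starProjection (R y) = R (M.starProjection y) := by
      refine Submodule.eq_starProjection_of_mem_orthogonal (hR _ (Submodule.coe_mem _)) ?_
      rw [← map_sub]
      exact hperp _ (Submodule.sub_starProjection_mem_orthogonal y)
    simp [this]
  · have : e i ∈ M := Submodule.le_topologicalClosure _ (Submodule.subset_span ⟨i, hi, rfl⟩)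
    simp [Submodule.starProjection_eq_self_iff.2 this]
  · refine Submodule.starProjection_eq_self_iff.1 ?_
    have h : y - M.starProjection y = 0 := hy
    exact (sub_eq_zero.1 h).symm

end Hilbert

/-! ### The resolvent `R = (-C)⁻¹` and the decomposition of solutions into modes. -/

section Operator

variable {d : ℕ} {ξ : ℝ} {e : ℕ → H d} {σ lam : ℕ → ℝ} {C : H d →ₗ.[ℝ] H d} {R : H d →L[ℝ] H d}

lemma summable_diagOp (he : Orthonormal ℝ e) {q : ℕ → ℝ} (hq : Summable q) (x : H d) :
    Summable fun i => (q i * inner ℝ (e i) x) • e i :=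
  summable_orthonormal_smul he hq x

lemma inner_diagOp (he : Orthonormal ℝ e) {q : ℕ → ℝ} (hq : Summable q) (x y : H d) :
    HasSum (fun i => q i * (inner ℝ (e i) x * inner ℝ (e i) y)) (inner ℝ (diagOp q e x) y) :=
  hasSum_inner_tsum he hq x y

lemma inner_diagOp_self (he : Orthonormal ℝ e) {q : ℕ → ℝ} (hq : Summable q) (i : ℕ) (x : H d) :
    inner ℝ (e i) (diagOp q e x) = q i * inner ℝ (e i) x := by
  rw [real_inner_comm]
  refine (inner_diagOp he hq x (e i)).unique ?_
  refine (hasSum_ite_eq i (q i * inner ℝ (e i) x)).congr_fun fun j => ?_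
  rw [orthonormal_iff_ite.1 he]
  split_ifs with h
  · simp [h]
  · simp

namespace SmallScale

lemma xi_pos (hC : SmallScale d ξ e σ lam C R) : 0 < ξ := by
  have := hC.xi_gt
  have : (0 : ℝ) ≤ d := Nat.cast_nonneg d
  linarith

/-- Unit vectors have Sobolev norm at least `1`, so the weighted trace dominates `∑ σ_i²`. -/
lemma summable_sq (hC : SmallScale d ξ e σ lam C R) : Summable fun i => σ i ^ 2 := by
  have h : ∑' i, ENNReal.ofReal (σ i ^ 2) ≠ ∞ := by
    refine ne_top_of_le_ne_top hC.summable.ne (ENNReal.tsum_le_tsum fun i => ?_)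
    have h1 := enorm_sq_le_sobolevNormSq hC.xi_pos.le (e i)
    have h2 : ‖e i‖ₑ = 1 := by rw [← ofReal_norm, hC.orthonormal.1 i, ENNReal.ofReal_one]
    rw [h2, one_pow] at h1
    exact le_mul_of_one_le_right' h1
  have h3 := ENNReal.summable_toReal h
  simpa [ENNReal.toReal_ofReal (sq_nonneg _)] using h3

lemma lam_le (hC : SmallScale d ξ e σ lam C R) (i : ℕ) : lam i ≤ lam 0 := hC.sup_eigen.1 ⟨i, rfl⟩

lemma lam_neg (hC : SmallScale d ξ e σ lam C R) (i : ℕ) : lam i < 0 := (hC.lam_le i).trans_lt hC.sup_neg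

lemma R_e (hC : SmallScale d ξ e σ lam C R) (i : ℕ) : R (e i) = (-(lam i)⁻¹) • e i := by
  obtain ⟨h, hi⟩ := hC.eigen i
  have h1 := hC.neg_left_inv ⟨e i, h⟩
  rw [hi, map_neg, map_smul] at h1
  have h2 := congrArg (fun x => (-(lam i)⁻¹) • x) h1
  simp only [smul_neg, neg_smul, smul_smul] at h2
  rw [neg_smul, ← h2]
  simp [inv_mul_cancel₀ (hC.lam_neg i).ne]

/-- Commutation of `Q` with `C` passes to the bounded inverse, where no domain conditions remain. -/
lemma R_diagOp (hC : SmallScale d ξ e σ lam C R) (y : H d) :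
    diagOp (fun i => σ i ^ 2) e (R y) = R (diagOp (fun i => σ i ^ 2) e y) := by
  obtain ⟨h, hy⟩ := hC.neg_right_inv y
  obtain ⟨h', hQ⟩ := hC.comm ⟨R y, h⟩
  have h1 := hC.neg_left_inv ⟨_, h'⟩
  rw [hQ] at h1
  refine h1.symm.trans (congrArg R ?_)
  have h2 : C ⟨R y, h⟩ = -y := neg_eq_iff_eq_neg.1 hy
  rw [h2]
  simp only [diagOp, inner_neg_right, mul_neg, neg_smul, tsum_neg, neg_neg]

/-- Since `R` is not assumed self-adjoint, `R_e` does not give this weak eigenrelation. It comes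
from comparing the `e i` coefficients of `Q R y = R Q y` and dividing by `σ_i²`, hence the
restriction to active modes. -/
lemma inner_e_R (hC : SmallScale d ξ e σ lam C R) {i : ℕ} (hi : σ i ≠ 0) (y : H d) :
    inner ℝ (e i) (R y) = -(lam i)⁻¹ * inner ℝ (e i) y := by
  have h1 := inner_diagOp_self hC.orthonormal hC.summable_sq i (R y)
  rw [hC.R_diagOp] at h1
  have h2 : inner ℝ (e i) (R (diagOp (fun i => σ i ^ 2) e y)) =
      σ i ^ 2 * (-(lam i)⁻¹ * inner ℝ (e i) y) := by
    have h := (summable_diagOp hC.orthonormal hC.summable_sq y).hasSum.mapL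
      ((innerSL ℝ (e i)).comp R)
    refine h.unique ?_
    refine (hasSum_ite_eq i (σ i ^ 2 * (-(lam i)⁻¹ * inner ℝ (e i) y))).congr_fun fun j => ?_
    rw [ContinuousLinearMap.comp_apply, map_smul, hC.R_e, map_smul, map_smul,
      innerSL_apply_apply, orthonormal_iff_ite.1 hC.orthonormal]
    by_cases hij : i = j
    · subst hij
      simp [mul_comm, mul_left_comm]
    · simp [hij, Ne.symm hij]
  rw [h2] at h1
  exact (mul_left_cancel₀ (pow_ne_zero 2 hi) h1).symm

lemma inner_C_nonpos (hC : SmallScale d ξ e σ lam C R) (x : C.domain) : inner ℝ (x : H d) (C x) ≤ 0 := by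
  obtain ⟨γ, hγ, c, hc, h⟩ := hC.coercive
  by_contra! hpos
  have h1 := h x
  -- If `⟨x, C x⟩` were positive, `ENNReal.ofReal` would truncate the right side of coercivity to
  -- zero, forcing `x = 0` and a contradiction.
  rw [ENNReal.ofReal_of_nonpos (p := -inner ℝ (x : H d) (C x)) (by linarith)] at h1
  have h2 : sobolevNormSq γ (x : H d) = 0 := by
    rcases mul_eq_zero.1 (nonpos_iff_eq_zero.1 h1) with h3 | h3
    · exact absurd h3 (by simpa using hc)
    · exact h3
  have h3 := enorm_sq_le_sobolevNormSq hγ (x : H d)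
  rw [h2, nonpos_iff_eq_zero, pow_eq_zero_iff two_ne_zero, ← ofReal_norm, ENNReal.ofReal_eq_zero,
    norm_le_zero_iff] at h3
  rw [h3, inner_zero_left] at hpos
  exact lt_irrefl _ hpos

lemma R_injective (hC : SmallScale d ξ e σ lam C R) {y : H d} (h : R y = 0) : y = 0 := by
  obtain ⟨h', hy⟩ := hC.neg_right_inv y
  have : (⟨R y, h'⟩ : C.domain) = 0 := Subtype.ext h
  rw [this, LinearPMap.map_zero, neg_zero] at hy
  exact hy.symm

/-- The equation `z' = C z`, `z(0) = 0` has only the solution `0`. -/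
lemma eq_zero_of_R_eq (hC : SmallScale d ξ e σ lam C R) {z : ℝ → H d} (hz : ContinuousOn z (Set.Ici 0))
    (h : ∀ t, 0 ≤ t → R (z t) = -∫ s in (0 : ℝ)..t, z s) {t : ℝ} (ht : 0 ≤ t) : z t = 0 := by
  refine hC.R_injective ?_
  rw [h t ht, primitive_eq_zero_of_inner_nonpos hz (fun s hs => ?_) ht, neg_zero]
  -- The primitive equals `R (-z s)`, so it lies in the domain and `C` maps it to `z s`;
  -- dissipativity then applies.
  obtain ⟨hdom, hs'⟩ := hC.neg_right_inv (-z s)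
  have e1 : R (-z s) = ∫ r in (0 : ℝ)..s, z r := by rw [map_neg, h s hs, neg_neg]
  have e2 := hC.inner_C_nonpos ⟨R (-z s), hdom⟩
  rw [neg_injective hs'] at e2
  simp only [e1] at e2
  exact e2

/-- A solution with continuous driving noise is the sum of its modes, which solve scalar linear
equations. -/
lemma hasSum_modes (hC : SmallScale d ξ e σ lam C R) {w : ℝ → H d} {W : ℕ → ℝ → ℝ}
    (hw : ContinuousOn w (Set.Ici 0)) (hW : ∀ i, ContinuousOn (W i) (Set.Ici 0))
    (heq : ∀ q : ℚ, 0 ≤ q → Summable (fun i => (σ i * W i q) • e i) ∧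
      ∃ h : (∫ s in (0 : ℝ)..q, w s) ∈ C.domain,
        w q = C ⟨∫ s in (0 : ℝ)..q, w s, h⟩ + ∑' i, (σ i * W i q) • e i) {t : ℝ} (ht : 0 ≤ t) :
    HasSum (fun i => inner ℝ (e i) (w t) • e i) (w t) ∧ ∀ i, inner ℝ (e i) (w t) =
      σ i * (W i t + lam i * ∫ s in (0 : ℝ)..t, Real.exp (lam i * (t - s)) * W i s) := by
  have hR : ∀ q : ℚ, 0 ≤ q → R (w q) =
      -(∫ s in (0 : ℝ)..q, w s) + R (∑' i, (σ i * W i q) • e i) := fun q hq => by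
    obtain ⟨-, h, h'⟩ := heq q hq
    have h2 := hC.neg_left_inv ⟨_, h⟩
    rw [map_neg] at h2
    rw [congrArg R h', map_add, neg_eq_iff_eq_neg.1 h2]
  have hwi : ∀ s, 0 ≤ s → IntervalIntegrable w volume 0 s := fun s hs =>
    (hw.mono (by rw [Set.uIcc_of_le hs]; exact Set.Icc_subset_Ici_self)).intervalIntegrable
  -- `p` is the projection off the active modes; for these alone both the strong and the weak
  -- eigenrelation of `R` are available.
  obtain ⟨p, hcom, hpe, hpM⟩ := exists_projection_comm (S := {i | σ i ≠ 0})
    (fun i _ => hC.R_e i) fun i hi y => hC.inner_e_R hi y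
  -- The noise has only active modes, so `p` removes it from the equation and leaves the homogeneous
  -- one with zero initial value.
  have hpw : p (w t) = 0 := by
    refine hC.eq_zero_of_R_eq (z := fun s => p (w s)) (p.continuous.comp_continuousOn hw) ?_ ht
    refine eqOn_Ici_of_rat (R.continuous.comp_continuousOn (p.continuous.comp_continuousOn hw))
      (continuousOn_primitive_Ici (p.continuous.comp_continuousOn hw)).neg fun q hq => ?_
    have hq' : (0 : ℝ) ≤ q := by exact_mod_cast hq
    have hN : p (∑' i, (σ i * W i q) • e i) = 0 := by
      refine ((heq q hq).1.hasSum.mapL p).unique ?_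
      refine hasSum_zero.congr_fun fun i => ?_
      by_cases hi : σ i = 0
      · simp [hi]
      · rw [map_smul, hpe i hi, smul_zero]
    have hint : ∫ s in (0 : ℝ)..q, p (w s) = p (∫ s in (0 : ℝ)..q, w s) :=
      p.intervalIntegral_comp_comm (hwi q hq')
    rw [hcom, hR q hq, map_add, map_neg, ← hcom (∑' i, (σ i * W i q) • e i), hN, map_zero,
      add_zero, hint]
  have hmem := hpM _ hpw
  refine ⟨hasSum_inner_smul_of_mem_closure hC.orthonormal
    (Submodule.topologicalClosure_mono (Submodule.span_mono (Set.image_subset_range _ _)) hmem),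
    fun i => ?_⟩
  -- An inactive `e i` is orthogonal to the closed span of the active modes, which contains `w t`.
  by_cases hi : σ i = 0
  · rw [hi, zero_mul, real_inner_comm]
    refine inner_eq_zero_of_mem_closure_span hmem ?_
    rintro _ ⟨j, hj, rfl⟩
    refine hC.orthonormal.2 ?_
    rintro rfl
    exact hj hi
  have hx : ContinuousOn (fun s => inner ℝ (e i) (w s)) (Set.Ici 0) :=
    (innerSL ℝ (e i)).continuous.comp_continuousOn hw
  refine solve_scalar_linear hx (hW i) ?_ ht
  refine eqOn_Ici_of_rat hx ((continuousOn_const.mul (continuousOn_primitive_Ici hx)).add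
    (continuousOn_const.mul (hW i))) fun q hq => ?_
  have hq' : (0 : ℝ) ≤ q := by exact_mod_cast hq
  have hint : ∫ s in (0 : ℝ)..q, inner ℝ (e i) (w s) = inner ℝ (e i) (∫ s in (0 : ℝ)..q, w s) :=
    (innerSL ℝ (e i)).intervalIntegral_comp_comm (hwi q hq')
  have hN : inner ℝ (e i) (∑' j, (σ j * W j q) • e j) = σ i * W i q := by
    refine ((heq q hq).1.hasSum.mapL (innerSL ℝ (e i))).unique ?_
    refine (hasSum_ite_eq i (σ i * W i q)).congr_fun fun j => ?_
    rw [map_smul, innerSL_apply_apply, orthonormal_iff_ite.1 hC.orthonormal]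
    by_cases hij : j = i
    · simp [hij]
    · simp [hij, Ne.symm hij]
  -- Pairing the equation, after application of `R`, with `e i` gives `-λ⁻¹ x = -∫ x - λ⁻¹ σ W`.
  -- Multiplication by `-λ` yields the scalar equation.
  have h1 := congrArg (inner ℝ (e i)) (hR q hq)
  rw [hC.inner_e_R hi, inner_add_right, inner_neg_right, ← hint, hC.inner_e_R hi, hN] at h1
  have hl := (hC.lam_neg i).ne
  field_simp at h1
  linarith

end SmallScale

end Operator

/-! ### Moments of Gaussian variables -/

/-- The fourth moment is the fourth derivative at `0` of the moment generating function `exp (V t² /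
2)`. -/
lemma integral_pow_four_gaussianReal (v : ℝ≥0) : ∫ x, x ^ 4 ∂(gaussianReal 0 v) = 3 * (v : ℝ) ^ 2 := by
  have h0 : (0 : ℝ) ∈ interior (integrableExpSet id (gaussianReal 0 v)) := by
    simp [integrableExpSet_id_gaussianReal]
  have h := iteratedDeriv_mgf_zero h0 4
  have h1 : ∫ x, (id ^ 4 : ℝ → ℝ) x ∂(gaussianReal 0 v) = ∫ x, x ^ 4 ∂(gaussianReal 0 v) := rfl
  rw [← h1, ← h, mgf_id_gaussianReal]
  simp only [zero_mul, zero_add]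
  generalize (v : ℝ) = V
  -- One product rule for a quartic polynomial times the exponential serves all four
  -- differentiations.
  have d1 : ∀ (a b c d e : ℝ) (t : ℝ), HasDerivAt
      (fun t => (a + b * t + c * t ^ 2 + d * t ^ 3 + e * t ^ 4) * Real.exp (V * t ^ 2 / 2))
      (((b + 2 * c * t + 3 * d * t ^ 2 + 4 * e * t ^ 3) +
        (a + b * t + c * t ^ 2 + d * t ^ 3 + e * t ^ 4) * (V * t)) * Real.exp (V * t ^ 2 / 2)) t := by
    intro a b c d e t
    have e1 : HasDerivAt (fun t : ℝ => Real.exp (V * t ^ 2 / 2))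
        (Real.exp (V * t ^ 2 / 2) * (V * t)) t := by
      have : HasDerivAt (fun t : ℝ => V * t ^ 2 / 2) (V * t) t := by
        refine (((hasDerivAt_pow 2 t).const_mul V).div_const 2).congr_deriv ?_
        norm_num; ring
      exact this.exp
    have e2 : HasDerivAt (fun t : ℝ => a + b * t + c * t ^ 2 + d * t ^ 3 + e * t ^ 4)
        (b + 2 * c * t + 3 * d * t ^ 2 + 4 * e * t ^ 3) t := by
      refine (((((hasDerivAt_id t).const_mul b).const_add a).add
        ((hasDerivAt_pow 2 t).const_mul c)).add ((hasDerivAt_pow 3 t).const_mul d)).add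
        ((hasDerivAt_pow 4 t).const_mul e) |>.congr_deriv ?_
      norm_num; ring
    refine (e2.mul e1).congr_deriv ?_
    ring
  have g0 : (fun t : ℝ => Real.exp (V * t ^ 2 / 2)) =
      fun t => (1 + 0 * t + 0 * t ^ 2 + 0 * t ^ 3 + 0 * t ^ 4) * Real.exp (V * t ^ 2 / 2) := by
    ext t; ring
  have g1 : deriv (fun t : ℝ => Real.exp (V * t ^ 2 / 2)) =
      fun t => (0 + V * t + 0 * t ^ 2 + 0 * t ^ 3 + 0 * t ^ 4) * Real.exp (V * t ^ 2 / 2) := by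
    rw [g0]; ext t; rw [(d1 1 0 0 0 0 t).deriv]; ring
  have g2 : deriv (fun t : ℝ => (0 + V * t + 0 * t ^ 2 + 0 * t ^ 3 + 0 * t ^ 4) *
      Real.exp (V * t ^ 2 / 2)) = fun t => (V + 0 * t + V ^ 2 * t ^ 2 + 0 * t ^ 3 + 0 * t ^ 4) *
      Real.exp (V * t ^ 2 / 2) := by
    ext t; rw [(d1 0 V 0 0 0 t).deriv]; ring
  have g3 : deriv (fun t : ℝ => (V + 0 * t + V ^ 2 * t ^ 2 + 0 * t ^ 3 + 0 * t ^ 4) *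
      Real.exp (V * t ^ 2 / 2)) =
      fun t => (0 + 3 * V ^ 2 * t + 0 * t ^ 2 + V ^ 3 * t ^ 3 + 0 * t ^ 4) *
      Real.exp (V * t ^ 2 / 2) := by
    ext t; rw [(d1 V 0 (V ^ 2) 0 0 t).deriv]; ring
  rw [iteratedDeriv_succ, iteratedDeriv_succ, iteratedDeriv_succ, iteratedDeriv_one, g1, g2, g3,
    (d1 0 (3 * V ^ 2) 0 (V ^ 3) 0 0).deriv]
  simp

section Probability

variable {Ω : Type*} [MeasurableSpace Ω] {P : Measure Ω}

lemma integral_pow_four_of_map_eq {X : Ω → ℝ} {v : ℝ≥0} (hX : AEMeasurable X P)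
    (h : P.map X = gaussianReal 0 v) : ∫ ω, X ω ^ 4 ∂P = 3 * (v : ℝ) ^ 2 := by
  rw [← integral_pow_four_gaussianReal, ← h,
    integral_map hX (by fun_prop : AEStronglyMeasurable (fun x : ℝ => x ^ 4) _)]

lemma memLp_of_map_eq {X : Ω → ℝ} {v : ℝ≥0} (hX : AEMeasurable X P)
    (h : P.map X = gaussianReal 0 v) (p : ℝ≥0) : MemLp X p P := by
  have h1 : MemLp id p (P.map X) := by rw [h]; exact memLp_id_gaussianReal p
  exact (memLp_map_measure_iff aestronglyMeasurable_id hX).1 h1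

/-! ### Integrals of square integrable processes -/

lemma sq_lintegral_le {α : Type*} [MeasurableSpace α] {ν : Measure α} [IsProbabilityMeasure ν]
    {f : α → ℝ≥0∞} (hf : AEMeasurable f ν) : (∫⁻ a, f a ∂ν) ^ 2 ≤ ∫⁻ a, f a ^ 2 ∂ν := by
  simpa using lintegral_mul_sq_le hf (aemeasurable_const (b := (1 : ℝ≥0∞)))

variable {U : Type*} [MeasurableSpace U] {ν : Measure U} [IsProbabilityMeasure ν]
  [IsProbabilityMeasure P] {E : Type*} [NormedAddCommGroup E] [NormedSpace ℝ E]

/-- Jensen for the probability measure `ν`, then Tonelli. -/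
lemma lintegral_enorm_integral_sq_le {f : U × Ω → E} (hf : AEStronglyMeasurable f (ν.prod P)) :
    ∫⁻ ω, ‖∫ u, f (u, ω) ∂ν‖ₑ ^ 2 ∂P ≤ ∫⁻ u, ∫⁻ ω, ‖f (u, ω)‖ₑ ^ 2 ∂P ∂ν := by
  rw [lintegral_lintegral_swap (f := fun u ω => ‖f (u, ω)‖ₑ ^ 2) (hf.enorm.pow_const 2)]
  refine lintegral_mono_ae ?_
  filter_upwards [hf.prod_swap.prodMk_left] with ω hω
  refine le_trans ?_ (sq_lintegral_le hω.enorm)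
  exact pow_le_pow_left₀ zero_le (enorm_integral_le_lintegral_enorm _) 2

lemma eLpNorm_two_sq {α : Type*} [MeasurableSpace α] {m : Measure α} (g : α → E) :
    eLpNorm g 2 m ^ 2 = ∫⁻ a, ‖g a‖ₑ ^ 2 ∂m := by
  rw [eLpNorm_eq_lintegral_rpow_enorm_toReal two_ne_zero ENNReal.ofNat_ne_top,
    ← ENNReal.rpow_two, ← ENNReal.rpow_mul]
  simp

lemma eLpNorm_two_lt_top_iff {α : Type*} [MeasurableSpace α] {m : Measure α} (g : α → E) :
    eLpNorm g 2 m < ∞ ↔ ∫⁻ a, ‖g a‖ₑ ^ 2 ∂m < ∞ := by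
  rw [← eLpNorm_two_sq, ENNReal.pow_lt_top_iff]
  simp

lemma memLp_integral {f : U × Ω → E} (hf : MemLp f 2 (ν.prod P)) :
    MemLp (fun ω => ∫ u, f (u, ω) ∂ν) 2 P := by
  refine ⟨hf.1.prod_swap.integral_prod_right', ?_⟩
  rw [eLpNorm_two_lt_top_iff]
  refine (lintegral_enorm_integral_sq_le hf.1).trans_lt ?_
  have h := hf.2
  rw [eLpNorm_two_lt_top_iff, lintegral_prod _ (hf.1.enorm.pow_const 2)] at h
  exact h

/-- Fubini: on a product of probability spaces a product of two square integrable functions is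
jointly integrable. -/
lemma integral_mul_integral {f : U × Ω → ℝ} (hf : MemLp f 2 (ν.prod P)) {Y : Ω → ℝ}
    (hY : MemLp Y 2 P) : ∫ ω, Y ω * ∫ u, f (u, ω) ∂ν ∂P = ∫ u, ∫ ω, Y ω * f (u, ω) ∂P ∂ν := by
  have h1 : MemLp (fun z : U × Ω => Y z.2) 2 (ν.prod P) :=
    hY.comp_measurePreserving measurePreserving_snd
  have h2 : Integrable (fun z : U × Ω => Y z.2 * f z) (ν.prod P) := h1.integrable_mul hf
  rw [integral_integral_swap h2]
  exact integral_congr_ae (.of_forall fun ω => (integral_const_mul _ _).symm)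

/-- Processes with continuous paths are jointly measurable. -/
lemma aestronglyMeasurable_uncurry_of_continuous {X : ℝ → Ω → E}
    (hX : ∀ s, AEStronglyMeasurable (X s) P) (hc : ∀ᵐ ω ∂P, Continuous fun s => X s ω)
    (m : Measure ℝ) [SFinite m] : AEStronglyMeasurable (fun z : ℝ × Ω => X z.1 z.2) (m.prod P) := by
  classical
  have hY : ∀ᵐ ω ∂P, (∀ q : ℚ, X q ω = (hX q).mk _ ω) ∧ Continuous fun s => X s ω :=
    (ae_all_iff.2 fun q : ℚ => (hX q).ae_eq_mk).and hc
  -- Setting the process to zero on a measurable null set `N` makes every path continuous.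
  -- Measurability then passes from rational times to all times by limits.
  obtain ⟨N, hN, hNm, hN0⟩ := exists_measurable_superset_of_null (ae_iff.1 hY)
  have hout : ∀ ω, ω ∉ N → (∀ q : ℚ, X q ω = (hX q).mk _ ω) ∧ Continuous fun s => X s ω :=
    fun ω hω => by
      by_contra h
      exact hω (hN h)
  let X' : ℝ → Ω → E := fun s => Nᶜ.indicator (X s)
  have hcont : ∀ ω, Continuous fun s => X' s ω := fun ω => by
    by_cases hω : ω ∈ N
    · simpa [X', hω] using continuous_const
    · simpa [X', hω] using (hout ω hω).2
  have hrat : ∀ q : ℚ, StronglyMeasurable (X' q) := fun q => by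
    have h : X' q = Nᶜ.indicator ((hX q).mk _) := Set.indicator_congr fun ω hω => (hout ω hω).1 q
    rw [h]
    exact (hX q).stronglyMeasurable_mk.indicator hNm.compl
  have hmeas : ∀ s, StronglyMeasurable (X' s) := fun s => by
    obtain ⟨u, -, hu⟩ := Real.exists_seq_rat_strictMono_tendsto s
    refine stronglyMeasurable_of_tendsto atTop (fun n => hrat (u n)) (tendsto_pi_nhds.2 fun ω => ?_)
    exact ((hcont ω).tendsto s).comp hu.2
  have h1 := stronglyMeasurable_uncurry_of_continuous_of_stronglyMeasurable hcont hmeas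
  refine ⟨_, h1, ?_⟩
  have h2 : ∀ᵐ ω ∂P, ω ∉ N := measure_eq_zero_iff_ae_notMem.1 hN0
  filter_upwards [Measure.quasiMeasurePreserving_snd.ae h2] with z hz
  simp [X', Function.uncurry, hz]

/-! ### The Gaussian space spanned by a family -/

/-- `Y` is in the closed linear span of the family `V` in `L²(P)`. -/
def GaussSpan {A : Type*} (V : A → Ω → ℝ) (P : Measure Ω) (Y : Ω → ℝ) : Prop :=
  MemLp Y 2 P ∧ ∀ g, MemLp g 2 P → (∀ a, ∫ ω, g ω * V a ω ∂P = 0) → ∫ ω, g ω * Y ω ∂P = 0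

namespace GaussSpan

variable {A : Type*} {V : A → Ω → ℝ} {Y Z : Ω → ℝ}

lemma self (a : A) (h : MemLp (V a) 2 P) : GaussSpan V P (V a) := ⟨h, fun _ _ hg' => hg' a⟩

lemma add (hY : GaussSpan V P Y) (hZ : GaussSpan V P Z) :
    GaussSpan V P (fun ω => Y ω + Z ω) := by
  refine ⟨hY.1.add hZ.1, fun g hg hg' => ?_⟩
  have h := integral_add (hg.integrable_mul hY.1) (hg.integrable_mul hZ.1)
  simp only [Pi.mul_apply, hY.2 g hg hg', hZ.2 g hg hg', add_zero] at h
  simpa only [mul_add] using h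

lemma const_mul (c : ℝ) (hY : GaussSpan V P Y) : GaussSpan V P (fun ω => c * Y ω) := by
  refine ⟨hY.1.const_mul c, fun g hg hg' => ?_⟩
  simp_rw [mul_left_comm _ c]
  rw [integral_const_mul, hY.2 g hg hg', mul_zero]

lemma sub (hY : GaussSpan V P Y) (hZ : GaussSpan V P Z) :
    GaussSpan V P (fun ω => Y ω - Z ω) := by
  simpa [sub_eq_add_neg] using hY.add (hZ.const_mul (-1))

lemma zero : GaussSpan V P (fun _ => 0) := ⟨MemLp.zero', fun g _ _ => by simp⟩

lemma sum {ι : Type*} (s : Finset ι) {Y : ι → Ω → ℝ} (h : ∀ i ∈ s, GaussSpan V P (Y i)) :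
    GaussSpan V P (fun ω => ∑ i ∈ s, Y i ω) := by
  classical
  induction s using Finset.induction_on with
  | empty => simpa using zero
  | insert i s hi ih =>
    simp_rw [Finset.sum_insert hi]
    exact (h i (Finset.mem_insert_self i s)).add
      (ih fun j hj => h j (Finset.mem_insert_of_mem hj))

lemma congr (hY : GaussSpan V P Y) (h : Y =ᵐ[P] Z) : GaussSpan V P Z := by
  refine ⟨(memLp_congr_ae h).1 hY.1, fun g hg hg' => ?_⟩
  rw [← hY.2 g hg hg']
  refine integral_congr_ae ?_
  filter_upwards [h] with ω hω
  rw [hω]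

/-- Describing the closed span by orthogonality to test functions makes this a direct use of Fubini,
with no approximation by Riemann sums. -/
lemma integral {f : U × Ω → ℝ} (hf : MemLp f 2 (ν.prod P))
    (h : ∀ u, GaussSpan V P fun ω => f (u, ω)) : GaussSpan V P fun ω => ∫ u, f (u, ω) ∂ν := by
  refine ⟨memLp_integral hf, fun g hg hg' => ?_⟩
  rw [integral_mul_integral hf hg]
  simp [fun u => (h u).2 g hg hg']

end GaussSpan

/-! ### Laws and fourth moments in the closed Gaussian span. -/

section GaussianLaw

variable {A : Type*} {V : A → Ω → ℝ}

/-- The function `x ↦ e^{iθx}` is `|θ|`-Lipschitz, and on a probability space the `L¹` distance is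
at most the `L²` distance. -/
lemma continuous_charFun_Lp (θ : ℝ) : Continuous fun f : Lp ℝ 2 P => charFun (P.map f) θ := by
  have h1 : ∀ f : Lp ℝ 2 P, charFun (P.map f) θ = ∫ ω, Complex.exp (θ * f ω * Complex.I) ∂P :=
    fun f => by
      rw [charFun_apply_real, integral_map (Lp.aestronglyMeasurable f).aemeasurable
        (by fun_prop)]
  have hi : ∀ f : Lp ℝ 2 P, Integrable (fun ω => Complex.exp (θ * f ω * Complex.I)) P := fun f => by
    refine Integrable.of_bound (C := 1) ?_ (.of_forall fun ω => ?_)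
    · have := Lp.aestronglyMeasurable f
      exact (by fun_prop : Continuous fun x : ℝ =>
        Complex.exp (θ * x * Complex.I)).comp_aestronglyMeasurable this
    · rw [← Complex.ofReal_mul, Complex.norm_exp_ofReal_mul_I]
  refine LipschitzWith.continuous (K := ⟨|θ|, abs_nonneg θ⟩) (LipschitzWith.of_dist_le_mul ?_)
  intro f g
  rw [dist_eq_norm, dist_eq_norm, h1, h1, ← integral_sub (hi f) (hi g)]
  have h2 : ∀ a b : ℝ, ‖Complex.exp (θ * a * Complex.I) - Complex.exp (θ * b * Complex.I)‖ ≤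
      |θ| * |a - b| := fun a b => by
    have e1 : Complex.exp (θ * a * Complex.I) - Complex.exp (θ * b * Complex.I) =
        Complex.exp ((θ * b : ℝ) * Complex.I) *
          (Complex.exp (Complex.I * (θ * (a - b) : ℝ)) - 1) := by
      rw [mul_sub, ← Complex.exp_add, mul_one]
      push_cast
      ring_nf
    rw [e1, norm_mul, Complex.norm_exp_ofReal_mul_I, one_mul, ← abs_mul]
    exact Real.norm_exp_I_mul_ofReal_sub_one_le
  have hfg : MemLp (fun ω => f ω - g ω) 2 P := (Lp.memLp f).sub (Lp.memLp g)
  have hfg1 : Integrable (fun ω => f ω - g ω) P := hfg.integrable one_le_two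
  calc _ ≤ ∫ ω, |θ| * |f ω - g ω| ∂P :=
        norm_integral_le_of_norm_le (hfg1.abs.const_mul _) (.of_forall fun ω => h2 _ _)
    _ = |θ| * ∫ ω, ‖f ω - g ω‖ ∂P := integral_const_mul _ _
    _ ≤ |θ| * ‖f - g‖ := by
        refine mul_le_mul_of_nonneg_left ?_ (abs_nonneg θ)
        rw [integral_norm_eq_lintegral_enorm hfg.1, ← eLpNorm_one_eq_lintegral_enorm, Lp.norm_def,
          eLpNorm_congr_ae (Lp.coeFn_sub f g)]
        exact ENNReal.toReal_mono hfg.2.ne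
          (eLpNorm_le_eLpNorm_of_exponent_le one_le_two hfg.1)

lemma norm_toLp_sq {Y : Ω → ℝ} (hY : MemLp Y 2 P) : ‖hY.toLp Y‖ ^ 2 = ∫ ω, Y ω ^ 2 ∂P := by
  rw [← real_inner_self_eq_norm_sq, L2.inner_def]
  refine integral_congr_ae ?_
  filter_upwards [hY.coeFn_toLp] with ω hω
  rw [hω, real_inner_self_eq_norm_sq, Real.norm_eq_abs, sq_abs]

lemma map_eq_of_hasGaussianLaw {X : Ω → ℝ} (h : HasGaussianLaw X P) (h0 : ∫ ω, X ω ∂P = 0) :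
    P.map X = gaussianReal 0 (∫ ω, X ω ^ 2 ∂P).toNNReal := by
  rw [h.map_eq_gaussianReal, h0, variance_of_integral_eq_zero h.aemeasurable h0]

lemma coeFn_sum_toLp (hV : ∀ a, MemLp (V a) 2 P) (s : Finset A) (c : A → ℝ) :
    (∑ a ∈ s, c a • (hV a).toLp (V a) : Lp ℝ 2 P) =ᵐ[P] fun ω => ∑ a ∈ s, c a * V a ω := by
  classical
  induction s using Finset.induction_on with
  | empty =>
    simp only [Finset.sum_empty]
    exact Lp.coeFn_zero ℝ 2 P
  | insert a s ha ih =>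
    simp_rw [Finset.sum_insert ha]
    filter_upwards [ih, Lp.coeFn_add (c a • (hV a).toLp (V a)) (∑ a ∈ s, c a • (hV a).toLp (V a)),
      Lp.coeFn_smul (c a) ((hV a).toLp (V a)), (hV a).coeFn_toLp] with ω h1 h2 h3 h4
    rw [h2, Pi.add_apply, h1, h3, Pi.smul_apply, h4, smul_eq_mul]

/-- The elements of the closed span of a centered Gaussian family are centered Gaussian. -/
lemma GaussSpan.map_eq (hV : ∀ (s : Finset A) (c : A → ℝ),
      HasGaussianLaw (fun ω => ∑ a ∈ s, c a * V a ω) P) (h0 : ∀ a, ∫ ω, V a ω ∂P = 0)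
    {Y : Ω → ℝ} (hY : GaussSpan V P Y) :
    P.map Y = gaussianReal 0 (∫ ω, Y ω ^ 2 ∂P).toNNReal := by
  have hV2 : ∀ a, MemLp (V a) 2 P := fun a => by
    have := (hV {a} 1).memLp_two
    simpa using this
  -- `G` collects the elements whose characteristic function is that of a centered Gaussian with
  -- variance `‖f‖²`. It is closed in `L²` and contains the linear span, hence the closed span.
  let G : Set (Lp ℝ 2 P) := {f | ∀ θ, charFun (P.map f) θ = Complex.exp (-(‖f‖ ^ 2 * θ ^ 2 / 2 : ℝ))}
  have hG : IsClosed G := by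
    have : G = ⋂ θ, {f : Lp ℝ 2 P |
        charFun (P.map f) θ = Complex.exp (-(‖f‖ ^ 2 * θ ^ 2 / 2 : ℝ))} := by
      ext f; simp [G]
    rw [this]
    exact isClosed_iInter fun θ => isClosed_eq (continuous_charFun_Lp θ) (by fun_prop)
  have key : ∀ {X : Ω → ℝ} (hX : MemLp X 2 P), P.map X = gaussianReal 0 (∫ ω, X ω ^ 2 ∂P).toNNReal →
      hX.toLp X ∈ G := fun {X} hX h θ => by
    rw [Measure.map_congr hX.coeFn_toLp, h, charFun_gaussianReal, norm_toLp_sq,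
      Real.coe_toNNReal _ (integral_nonneg fun ω => sq_nonneg _)]
    push_cast
    ring_nf
  have hspan : (Submodule.span ℝ (Set.range fun a => (hV2 a).toLp (V a)) : Set (Lp ℝ 2 P)) ⊆ G := by
    intro f hf
    obtain ⟨c, rfl⟩ := (Finsupp.mem_span_range_iff_exists_finsupp).1 hf
    have hm : MemLp (fun ω => ∑ a ∈ c.support, c a * V a ω) 2 P := (hV c.support c).memLp_two
    have e : (c.sum fun a r => r • (hV2 a).toLp (V a)) = hm.toLp _ := by
      exact Lp.ext ((coeFn_sum_toLp hV2 c.support c).trans hm.coeFn_toLp.symm)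
    rw [e]
    refine key hm (map_eq_of_hasGaussianLaw (hV c.support c) ?_)
    rw [integral_finsetSum _ fun a _ => ((hV2 a).integrable one_le_two).const_mul _]
    simp [integral_const_mul, h0]
  have hmem : hY.1.toLp Y ∈ G := by
    have h1 : hY.1.toLp Y ∈
        (Submodule.span ℝ (Set.range fun a => (hV2 a).toLp (V a))).topologicalClosure := by
      -- The orthogonality in `GaussSpan` says exactly that `Y` lies in the double orthogonal
      -- complement of the family.
      rw [← Submodule.orthogonal_orthogonal_eq_closure, Submodule.mem_orthogonal]
      intro g hg
      have h2 := hY.2 g (Lp.memLp g) fun a => by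
        have h3 := (Submodule.mem_orthogonal _ _).1 hg _ (Submodule.subset_span ⟨a, rfl⟩)
        rw [L2.inner_def] at h3
        rw [← h3]
        refine integral_congr_ae ?_
        filter_upwards [(hV2 a).coeFn_toLp] with ω hω
        simp [hω]
      rw [L2.inner_def]
      refine Eq.trans (integral_congr_ae ?_) h2
      filter_upwards [hY.1.coeFn_toLp] with ω hω
      simp [hω, mul_comm]
    exact closure_minimal hspan hG h1
  have : IsProbabilityMeasure (P.map Y) := Measure.isProbabilityMeasure_map hY.1.1.aemeasurable
  refine Measure.ext_of_charFun (funext fun θ => ?_)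
  have h1 := hmem θ
  rw [Measure.map_congr hY.1.coeFn_toLp] at h1
  rw [h1, charFun_gaussianReal, norm_toLp_sq,
      Real.coe_toNNReal _ (integral_nonneg fun ω => sq_nonneg _)]
  push_cast
  ring_nf

/-- All finite linear combinations of the family `V` are centered Gaussian. -/
def IsCenteredGaussFamily (V : A → Ω → ℝ) (P : Measure Ω) : Prop :=
  (∀ (s : Finset A) (c : A → ℝ), HasGaussianLaw (fun ω => ∑ a ∈ s, c a * V a ω) P) ∧
    ∀ a, ∫ ω, V a ω ∂P = 0

namespace GaussSpan

variable {X Y Z : Ω → ℝ}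

lemma memLp (hV : IsCenteredGaussFamily V P) (hY : GaussSpan V P Y) (p : ℝ≥0) : MemLp Y p P :=
  memLp_of_map_eq hY.1.1.aemeasurable (hY.map_eq hV.1 hV.2) p

lemma integral_pow_four (hV : IsCenteredGaussFamily V P) (hY : GaussSpan V P Y) :
    ∫ ω, Y ω ^ 4 ∂P = 3 * (∫ ω, Y ω ^ 2 ∂P) ^ 2 := by
  rw [integral_pow_four_of_map_eq hY.1.1.aemeasurable (hY.map_eq hV.1 hV.2),
    Real.coe_toNNReal _ (integral_nonneg fun ω => sq_nonneg _)]

lemma integrable_pow_four (hV : IsCenteredGaussFamily V P) (hY : GaussSpan V P Y) :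
    Integrable (fun ω => Y ω ^ 4) P := by
  have h := (hY.memLp hV 4).integrable_norm_pow (by norm_num)
  refine h.congr (.of_forall fun ω => ?_)
  simp only [Real.norm_eq_abs]
  exact (by decide : Even 4).pow_abs _

lemma memLp_mul (hV : IsCenteredGaussFamily V P) (hY : GaussSpan V P Y) (hZ : GaussSpan V P Z) :
    MemLp (fun ω => Y ω * Z ω) 2 P := by
  have : ENNReal.HolderTriple (4 : ℝ≥0) (4 : ℝ≥0) 2 := ⟨by
    rw [← ENNReal.coe_inv (by norm_num), ← ENNReal.coe_add,
      show (2 : ℝ≥0∞) = ((2 : ℝ≥0) : ℝ≥0∞) from rfl, ← ENNReal.coe_inv two_ne_zero]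
    congr 1
    norm_num⟩
  exact (hZ.memLp hV 4).mul' (hY.memLp hV 4)

lemma integrable_mul (hY : GaussSpan V P Y) (hZ : GaussSpan V P Z) :
    Integrable (fun ω => Y ω * Z ω) P := hY.1.integrable_mul hZ.1

lemma integral_add_sq (hY : GaussSpan V P Y) (hZ : GaussSpan V P Z) :
    ∫ ω, (Y ω + Z ω) ^ 2 ∂P =
      ∫ ω, Y ω ^ 2 ∂P + 2 * ∫ ω, Y ω * Z ω ∂P + ∫ ω, Z ω ^ 2 ∂P := by
  have h1 := hY.1.integrable_sq
  have h2 := hZ.1.integrable_sq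
  have h3 := (hY.integrable_mul hZ).const_mul 2
  rw [← integral_const_mul, ← integral_add' h1 h3, ← integral_add' (h1.add h3) h2]
  refine integral_congr_ae (.of_forall fun ω => ?_)
  simp only [Pi.add_apply]
  ring

lemma integral_sub_sq (hY : GaussSpan V P Y) (hZ : GaussSpan V P Z) :
    ∫ ω, (Y ω - Z ω) ^ 2 ∂P =
      ∫ ω, Y ω ^ 2 ∂P - 2 * ∫ ω, Y ω * Z ω ∂P + ∫ ω, Z ω ^ 2 ∂P := by
  have h := hY.integral_add_sq (hZ.const_mul (-1))
  have e1 : ∀ ω, Y ω + -1 * Z ω = Y ω - Z ω := fun ω => by ring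
  have e2 : ∫ ω, Y ω * (-1 * Z ω) ∂P = -∫ ω, Y ω * Z ω ∂P := by
    rw [← integral_neg]
    exact integral_congr_ae (.of_forall fun ω => by ring)
  have e3 : ∫ ω, (-1 * Z ω) ^ 2 ∂P = ∫ ω, Z ω ^ 2 ∂P :=
    integral_congr_ae (.of_forall fun ω => by ring)
  simp only [e1, e2, e3] at h
  rw [h]; ring

lemma integral_add_mul (hX : GaussSpan V P X) (hY : GaussSpan V P Y) (hZ : GaussSpan V P Z) :
    ∫ ω, (X ω + Y ω) * Z ω ∂P = ∫ ω, X ω * Z ω ∂P + ∫ ω, Y ω * Z ω ∂P := by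
  rw [← integral_add (hX.integrable_mul hZ) (hY.integrable_mul hZ)]
  exact integral_congr_ae (.of_forall fun ω => by ring)

lemma integral_sub_mul (hX : GaussSpan V P X) (hY : GaussSpan V P Y) (hZ : GaussSpan V P Z) :
    ∫ ω, (X ω - Y ω) * Z ω ∂P = ∫ ω, X ω * Z ω ∂P - ∫ ω, Y ω * Z ω ∂P := by
  rw [← integral_sub (hX.integrable_mul hZ) (hY.integrable_mul hZ)]
  exact integral_congr_ae (.of_forall fun ω => by ring)

/-- Isserlis' formula. -/
lemma integral_mul_mul_mul (hV : IsCenteredGaussFamily V P) {X₁ X₂ X₃ X₄ : Ω → ℝ}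
    (h₁ : GaussSpan V P X₁) (h₂ : GaussSpan V P X₂) (h₃ : GaussSpan V P X₃)
    (h₄ : GaussSpan V P X₄) : ∫ ω, (X₁ ω * X₂ ω) * (X₃ ω * X₄ ω) ∂P =
      (∫ ω, X₁ ω * X₂ ω ∂P) * (∫ ω, X₃ ω * X₄ ω ∂P) +
      (∫ ω, X₁ ω * X₃ ω ∂P) * (∫ ω, X₂ ω * X₄ ω ∂P) +
      (∫ ω, X₁ ω * X₄ ω ∂P) * (∫ ω, X₂ ω * X₃ ω ∂P) := by
  have hpp := (h₁.add h₂)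
  have hpm := (h₁.sub h₂)
  have I : ∀ {Y : Ω → ℝ}, GaussSpan V P Y → Integrable (fun ω => Y ω ^ 4) P :=
    fun h => h.integrable_pow_four hV
  have hp := h₃.add h₄
  have hm := h₃.sub h₄
  -- Polarization of the fourth power: eight sign patterns up to a global sign, each weighted by the
  -- product of its signs. The normalization is `192 = 8 · 4!`.
  have key : ∫ ω, (X₁ ω * X₂ ω) * (X₃ ω * X₄ ω) ∂P =
      (∫ ω, ((X₁ ω + X₂ ω) + (X₃ ω + X₄ ω)) ^ 4 ∂P + ∫ ω, ((X₁ ω + X₂ ω) - (X₃ ω + X₄ ω)) ^ 4 ∂P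
      - ∫ ω, ((X₁ ω + X₂ ω) + (X₃ ω - X₄ ω)) ^ 4 ∂P - ∫ ω, ((X₁ ω + X₂ ω) - (X₃ ω - X₄ ω)) ^ 4 ∂P
      - ∫ ω, ((X₁ ω - X₂ ω) + (X₃ ω + X₄ ω)) ^ 4 ∂P - ∫ ω, ((X₁ ω - X₂ ω) - (X₃ ω + X₄ ω)) ^ 4 ∂P
      + ∫ ω, ((X₁ ω - X₂ ω) + (X₃ ω - X₄ ω)) ^ 4 ∂P
      + ∫ ω, ((X₁ ω - X₂ ω) - (X₃ ω - X₄ ω)) ^ 4 ∂P) / 192 := by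
    have i1 := I (hpp.add hp)
    have i2 := I (hpp.sub hp)
    have i3 := I (hpp.add hm)
    have i4 := I (hpp.sub hm)
    have i5 := I (hpm.add hp)
    have i6 := I (hpm.sub hp)
    have i7 := I (hpm.add hm)
    have i8 := I (hpm.sub hm)
    rw [← integral_add' i1 i2, ← integral_sub' (i1.add i2) i3, ← integral_sub' ((i1.add i2).sub i3) i4,
      ← integral_sub' (((i1.add i2).sub i3).sub i4) i5,
      ← integral_sub' ((((i1.add i2).sub i3).sub i4).sub i5) i6,
      ← integral_add' (((((i1.add i2).sub i3).sub i4).sub i5).sub i6) i7,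
      ← integral_add' ((((((i1.add i2).sub i3).sub i4).sub i5).sub i6).add i7) i8,
      ← integral_div]
    refine integral_congr_ae (.of_forall fun ω => ?_)
    simp only [Pi.add_apply, Pi.sub_apply]
    ring
  -- Each combination stays in the Gaussian span, so its fourth moment is three times its squared
  -- variance; expanding the variances leaves an algebraic identity between covariances.
  rw [key, (hpp.add hp).integral_pow_four hV, (hpp.sub hp).integral_pow_four hV,
    (hpp.add hm).integral_pow_four hV, (hpp.sub hm).integral_pow_four hV,
    (hpm.add hp).integral_pow_four hV, (hpm.sub hp).integral_pow_four hV,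
    (hpm.add hm).integral_pow_four hV, (hpm.sub hm).integral_pow_four hV,
    hpp.integral_add_sq hp, hpp.integral_sub_sq hp, hpp.integral_add_sq hm, hpp.integral_sub_sq hm,
    hpm.integral_add_sq hp, hpm.integral_sub_sq hp, hpm.integral_add_sq hm, hpm.integral_sub_sq hm,
    h₁.integral_add_sq h₂, h₁.integral_sub_sq h₂, h₃.integral_add_sq h₄, h₃.integral_sub_sq h₄]
  have c : ∀ (F G : Ω → ℝ), ∫ ω, F ω * G ω ∂P = ∫ ω, G ω * F ω ∂P := fun F G =>
    integral_congr_ae (.of_forall fun ω => mul_comm _ _)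
  rw [h₁.integral_add_mul h₂ hp, h₁.integral_add_mul h₂ hm, h₁.integral_sub_mul h₂ hp,
    h₁.integral_sub_mul h₂ hm, c X₁ (fun ω => X₃ ω + X₄ ω), c X₂ (fun ω => X₃ ω + X₄ ω),
    c X₁ (fun ω => X₃ ω - X₄ ω), c X₂ (fun ω => X₃ ω - X₄ ω), h₃.integral_add_mul h₄ h₁,
    h₃.integral_add_mul h₄ h₂, h₃.integral_sub_mul h₄ h₁, h₃.integral_sub_mul h₄ h₂,
    c X₃ X₁, c X₃ X₂, c X₄ X₁, c X₄ X₂]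
  ring

end GaussSpan

end GaussianLaw

end Probability

/-! ### The exponential law -/

/-- The exponential distribution with parameter `1`. -/
def expLaw : Measure ℝ :=
  (volume.restrict (Set.Ioi 0)).withDensity fun u => ENNReal.ofReal (Real.exp (-u))

lemma measurable_exp_density : Measurable fun u : ℝ => ENNReal.ofReal (Real.exp (-u)) := by fun_prop

instance : IsProbabilityMeasure expLaw := ⟨by
  rw [expLaw, withDensity_apply _ MeasurableSet.univ, Measure.restrict_univ,
    ← ofReal_integral_eq_lintegral_ofReal (integrableOn_exp_neg_Ioi 0)
      (.of_forall fun u => (Real.exp_pos _).le), integral_exp_neg_Ioi_zero, ENNReal.ofReal_one]⟩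

lemma integral_expLaw {E : Type*} [NormedAddCommGroup E] [NormedSpace ℝ E] (f : ℝ → E) :
    ∫ u, f u ∂expLaw = ∫ u in Set.Ioi (0 : ℝ), Real.exp (-u) • f u := by
  rw [expLaw, integral_withDensity_eq_integral_toReal_smul measurable_exp_density
    (.of_forall fun u => ENNReal.ofReal_lt_top)]
  simp [ENNReal.toReal_ofReal (Real.exp_pos _).le]

lemma integrable_expLaw_iff {E : Type*} [NormedAddCommGroup E] [NormedSpace ℝ E] (f : ℝ → E) :
    Integrable f expLaw ↔ IntegrableOn (fun u => Real.exp (-u) • f u) (Set.Ioi 0) := by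
  rw [expLaw, integrable_withDensity_iff_integrable_smul' measurable_exp_density
    (.of_forall fun u => ENNReal.ofReal_lt_top)]
  simp [ENNReal.toReal_ofReal (Real.exp_pos _).le, IntegrableOn]

lemma ae_expLaw_pos : ∀ᵐ u ∂expLaw, 0 < u :=
  (withDensity_absolutelyContinuous _ _).ae_le (ae_restrict_mem measurableSet_Ioi)

/-- The moment `∫₀^∞ e^{-s} s^p ds`. -/
def expMoment (p : ℝ) : ℝ := ∫ s in Set.Ioi (0 : ℝ), Real.exp (-s) * s ^ p

lemma integrableOn_exp_mul_rpow {p : ℝ} (hp : 0 < p) :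
    IntegrableOn (fun s : ℝ => Real.exp (-s) * s ^ p) (Set.Ioi 0) := by
  have h := Real.GammaIntegral_convergent (s := p + 1) (by linarith)
  simpa using h

lemma integrable_rpow_expLaw {p : ℝ} (hp : 0 < p) : Integrable (fun u : ℝ => u ^ p) expLaw :=
  (integrable_expLaw_iff _).2 (integrableOn_exp_mul_rpow hp)

lemma integral_rpow_expLaw (p : ℝ) : ∫ u, u ^ p ∂expLaw = expMoment p := integral_expLaw _

lemma expMoment_nonneg (p : ℝ) : 0 ≤ expMoment p :=
  setIntegral_nonneg measurableSet_Ioi fun _ hs =>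
    mul_nonneg (Real.exp_pos _).le (Real.rpow_nonneg (Set.mem_Ioi.1 hs).le p)

/-- Subadditivity of `r ↦ r ^ p` for `p ≤ 1`. With `p = 2 * hurst`, this is how the condition `hurst
≤ 1 / 2` enters. -/
lemma abs_rpow_sub_le {p : ℝ} (hp : 0 < p) (hp1 : p ≤ 1) (a b : ℝ) :
    |(|a| ^ p - |b| ^ p)| ≤ |a - b| ^ p := by
  have key : ∀ x y : ℝ, |x| ^ p ≤ |y| ^ p + |x - y| ^ p := fun x y => by
    have h1 : |x| ≤ |y| + |x - y| := by
      have := abs_add_le y (x - y)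
      rwa [add_sub_cancel] at this
    exact (Real.rpow_le_rpow (abs_nonneg _) h1 hp.le).trans
      (Real.rpow_add_le_add_rpow (abs_nonneg _) (abs_nonneg _) hp.le hp1)
  rw [abs_le]
  have h1 := key a b
  have h2 := key b a
  rw [abs_sub_comm b a] at h2
  constructor <;> linarith

lemma integrable_abs_sub_rpow {p : ℝ} (hp : 0 < p) (hp1 : p ≤ 1) :
    Integrable (fun z : ℝ × ℝ => |z.1 - z.2| ^ p) (expLaw.prod expLaw) := by
  have h1 : Integrable (fun z : ℝ × ℝ => z.1 ^ p + z.2 ^ p) (expLaw.prod expLaw) :=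
    ((integrable_rpow_expLaw hp).comp_fst _).add ((integrable_rpow_expLaw hp).comp_snd _)
  refine h1.mono' (by fun_prop : Measurable fun z : ℝ × ℝ =>
    |z.1 - z.2| ^ p).aestronglyMeasurable ?_
  have h2 : ∀ᵐ z ∂(expLaw.prod expLaw), 0 < z.1 ∧ 0 < z.2 :=
    (Measure.quasiMeasurePreserving_fst.ae ae_expLaw_pos).and
      (Measure.quasiMeasurePreserving_snd.ae ae_expLaw_pos)
  filter_upwards [h2] with z hz
  rw [Real.norm_of_nonneg (Real.rpow_nonneg (abs_nonneg _) _)]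
  have h3 : |z.1 - z.2| ≤ z.1 + z.2 := abs_le.2 ⟨by linarith [hz.1], by linarith [hz.2]⟩
  exact (Real.rpow_le_rpow (abs_nonneg _) h3 hp.le).trans
    (Real.rpow_add_le_add_rpow hz.1.le hz.2.le hp.le hp1)

/-- The difference of two independent exponential variables has the law of one, up to sign. -/
lemma integral_abs_sub_rpow {p : ℝ} (hp : 0 < p) (hp1 : p ≤ 1) :
    ∫ z, |z.1 - z.2| ^ p ∂(expLaw.prod expLaw) = expMoment p := by
  -- `g` is the contribution of `z.2 < z.1`; by symmetry the integral is twice that of `g`.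
  set g : ℝ × ℝ → ℝ := fun z => if z.2 < z.1 then (z.1 - z.2) ^ p else 0 with hg
  have hgm : Measurable g :=
    Measurable.ite (measurableSet_lt measurable_snd measurable_fst) (by fun_prop) measurable_const
  have hgs : ∀ z : ℝ × ℝ, |z.1 - z.2| ^ p = g z + g z.swap := fun z => by
    rcases lt_trichotomy z.1 z.2 with h | h | h
    · simp [hg, h, h.not_gt, abs_of_neg (sub_neg.2 h)]
    · simp [hg, h, Real.zero_rpow hp.ne']
    · simp [hg, h, h.not_gt, abs_of_pos (sub_pos.2 h)]
  have hg0 : ∀ z, 0 ≤ g z := fun z => by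
    simp only [hg]
    split_ifs with h
    · exact Real.rpow_nonneg (by linarith) _
    · rfl
  have hgi : Integrable g (expLaw.prod expLaw) := by
    refine (integrable_abs_sub_rpow hp hp1).mono' hgm.aestronglyMeasurable (.of_forall fun z => ?_)
    rw [Real.norm_of_nonneg (hg0 z), hgs z]
    linarith [hg0 z.swap]
  have hswap : ∫ z, g z.swap ∂(expLaw.prod expLaw) = ∫ z, g z ∂(expLaw.prod expLaw) :=
    integral_prod_swap g
  simp only [hgs]
  have hgi' : Integrable (fun z => g z.swap) (expLaw.prod expLaw) := hgi.swap
  rw [integral_add hgi hgi', hswap, integral_prod_symm g hgi]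
  -- Memorylessness: shifting by `v` costs the factor `e^{-v}`. The remaining integral of `e^{-2v}`
  -- is `1 / 2`, which cancels the doubling.
  have hinner : ∀ v : ℝ, 0 < v → ∫ u, g (u, v) ∂expLaw = Real.exp (-v) * expMoment p := by
    intro v hv
    rw [integral_expLaw, expMoment, ← integral_const_mul, ← integral_indicator measurableSet_Ioi,
      ← integral_indicator measurableSet_Ioi]
    refine Eq.trans ?_ (integral_sub_right_eq_self _ v)
    congr 1
    ext u
    simp only [Set.indicator_apply, Set.mem_Ioi, hg, smul_eq_mul, sub_pos]
    by_cases h : v < u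
    · rw [if_pos (hv.trans h), if_pos h, if_pos h, ← mul_assoc, ← Real.exp_add]
      congr 2
      ring
    · simp [h]
  rw [integral_congr_ae (ae_expLaw_pos.mono hinner), integral_mul_const, integral_expLaw]
  have h2 : ∫ u in Set.Ioi (0 : ℝ), Real.exp (-u) • Real.exp (-u) = 1 / 2 := by
    have h := integral_exp_mul_Ioi (a := -2) (by norm_num) 0
    calc _ = ∫ u in Set.Ioi (0 : ℝ), Real.exp (-2 * u) := by
          refine integral_congr_ae (.of_forall fun u => ?_)
          simp only [smul_eq_mul, ← Real.exp_add]
          congr 1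
          ring
      _ = 1 / 2 := by rw [h]; norm_num
  rw [h2]
  ring

/-! ### Fractional Ornstein–Uhlenbeck modes -/

/-- The covariance of the increments `B_s - B_{s'}` and `B_t - B_{t'}` of a fractional Brownian
motion with Hurst parameter `p / 2`. -/
def incCov (p s s' t t' : ℝ) : ℝ :=
  (|s - t'| ^ p + |s' - t| ^ p - |s - t| ^ p - |s' - t'| ^ p) / 2

/-- The four terms pair into two differences of `p`-th powers whose arguments differ by `t - t'`.
The bound does not involve `s` and `s'`, which makes the later domination uniform in time. -/
lemma abs_incCov_le {p : ℝ} (hp : 0 < p) (hp1 : p ≤ 1) (s s' t t' : ℝ) :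
    |incCov p s s' t t'| ≤ |t - t'| ^ p := by
  have h1 := abs_rpow_sub_le hp hp1 (s - t') (s - t)
  have h2 := abs_rpow_sub_le hp hp1 (s' - t) (s' - t')
  have e1 : s - t' - (s - t) = t - t' := by ring
  have e2 : |s' - t - (s' - t')| = |t - t'| := by rw [abs_sub_comm t t']; congr 1; ring
  rw [e1] at h1
  rw [e2] at h2
  rw [abs_le] at h1 h2 ⊢
  unfold incCov
  constructor <;> linarith [h1.1, h1.2, h2.1, h2.2]

/-- The covariance of the fractional Ornstein–Uhlenbeck process `dx = -α x dt + dB`, `x(0) = 0`. -/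
def ouCov (p α s t : ℝ) : ℝ :=
  ∫ z : ℝ × ℝ, incCov p s (max (s - z.1 / α) 0) t (max (t - z.2 / α) 0) ∂(expLaw.prod expLaw)

lemma sub_max_sub_mem {t r : ℝ} (ht : 0 ≤ t) (hr : 0 ≤ r) :
    0 ≤ t - max (t - r) 0 ∧ t - max (t - r) 0 ≤ r := by
  rcases le_total (t - r) 0 with h | h
  · rw [max_eq_right h]; constructor <;> linarith
  · rw [max_eq_left h]; constructor <;> linarith

lemma ouCov_integrand_le {p α s t : ℝ} (hp : 0 < p) (hp1 : p ≤ 1) (hα : 0 < α) (ht : 0 ≤ t) :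
    ∀ᵐ z : ℝ × ℝ ∂(expLaw.prod expLaw),
      ‖incCov p s (max (s - z.1 / α) 0) t (max (t - z.2 / α) 0)‖ ≤ α ^ (-p) * z.2 ^ p := by
  filter_upwards [Measure.quasiMeasurePreserving_snd.ae ae_expLaw_pos] with z hz
  refine (abs_incCov_le hp hp1 _ _ _ _).trans ?_
  have h := sub_max_sub_mem ht (r := z.2 / α) (by positivity)
  rw [abs_of_nonneg h.1]
  calc _ ≤ (z.2 / α) ^ p := Real.rpow_le_rpow h.1 h.2 hp.le
    _ = _ := by rw [Real.div_rpow hz.le hα.le, Real.rpow_neg hα.le, div_eq_inv_mul]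

lemma integrable_ouCov_bound {p : ℝ} (hp : 0 < p) (α : ℝ) :
    Integrable (fun z : ℝ × ℝ => α ^ (-p) * z.2 ^ p) (expLaw.prod expLaw) :=
  ((integrable_rpow_expLaw hp).comp_snd _).const_mul _

lemma measurable_ouCov_integrand (p α s t : ℝ) : Measurable fun z : ℝ × ℝ =>
    incCov p s (max (s - z.1 / α) 0) t (max (t - z.2 / α) 0) := by
  unfold incCov; fun_prop

lemma abs_ouCov_le {p α s t : ℝ} (hp : 0 < p) (hp1 : p ≤ 1) (hα : 0 < α) (ht : 0 ≤ t) :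
    |ouCov p α s t| ≤ α ^ (-p) * expMoment p := by
  refine (norm_integral_le_of_norm_le (integrable_ouCov_bound hp α)
    (ouCov_integrand_le hp hp1 hα ht)).trans (le_of_eq ?_)
  rw [integral_const_mul, integral_fun_snd (fun u : ℝ => u ^ p), integral_rpow_expLaw]
  simp

/-- For large `t` the cutoff at time zero is inactive and the integrand is the constant `α^(-p)
(z₁^p + z₂^p - |z₁ - z₂|^p) / 2`. All three moments equal `expMoment p`, so one half of it survives.
-/
lemma tendsto_ouCov_self {p α : ℝ} (hp : 0 < p) (hp1 : p ≤ 1) (hα : 0 < α) :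
    Tendsto (fun t => ouCov p α t t) atTop (𝓝 (α ^ (-p) * expMoment p / 2)) := by
  have hlim : ∫ z : ℝ × ℝ, α ^ (-p) * (z.1 ^ p + z.2 ^ p - |z.1 - z.2| ^ p) / 2
      ∂(expLaw.prod expLaw) = α ^ (-p) * expMoment p / 2 := by
    have i1 : Integrable (fun z : ℝ × ℝ => z.1 ^ p) (expLaw.prod expLaw) :=
      (integrable_rpow_expLaw hp).comp_fst _
    have i2 : Integrable (fun z : ℝ × ℝ => z.2 ^ p) (expLaw.prod expLaw) :=
      (integrable_rpow_expLaw hp).comp_snd _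
    have i12 : Integrable (fun z : ℝ × ℝ => z.1 ^ p + z.2 ^ p) (expLaw.prod expLaw) := i1.add i2
    rw [integral_div, integral_const_mul, integral_sub
      i12 (integrable_abs_sub_rpow hp hp1),
      integral_add i1 i2, integral_abs_sub_rpow hp hp1, integral_fun_fst (fun u : ℝ => u ^ p),
      integral_fun_snd (fun u : ℝ => u ^ p), integral_rpow_expLaw]
    simp
  rw [← hlim]
  refine tendsto_integral_filter_of_dominated_convergence _
    (.of_forall fun t => (measurable_ouCov_integrand p α t t).aestronglyMeasurable)
    ((eventually_ge_atTop 0).mono fun t ht => ouCov_integrand_le hp hp1 hα ht)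
    (integrable_ouCov_bound hp α) ?_
  have h2 : ∀ᵐ z ∂(expLaw.prod expLaw), 0 < z.1 ∧ 0 < z.2 :=
    (Measure.quasiMeasurePreserving_fst.ae ae_expLaw_pos).and
      (Measure.quasiMeasurePreserving_snd.ae ae_expLaw_pos)
  filter_upwards [h2] with z hz
  refine tendsto_const_nhds.congr' ?_
  filter_upwards [eventually_ge_atTop (z.1 / α), eventually_ge_atTop (z.2 / α)] with t h1 h2
  rw [max_eq_left (by linarith), max_eq_left (by linarith), incCov]
  have e1 : |t - (t - z.2 / α)| ^ p = α ^ (-p) * z.2 ^ p := by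
    rw [sub_sub_cancel, abs_of_pos (div_pos hz.2 hα), Real.div_rpow hz.2.le hα.le,
      Real.rpow_neg hα.le, div_eq_inv_mul]
  have e2 : |t - z.1 / α - t| ^ p = α ^ (-p) * z.1 ^ p := by
    rw [sub_sub_cancel_left, abs_neg, abs_of_pos (div_pos hz.1 hα), Real.div_rpow hz.1.le hα.le,
      Real.rpow_neg hα.le, div_eq_inv_mul]
  have e3 : |t - z.1 / α - (t - z.2 / α)| ^ p = α ^ (-p) * |z.1 - z.2| ^ p := by
    have : t - z.1 / α - (t - z.2 / α) = (z.2 - z.1) / α := by ring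
    rw [this, abs_div, abs_of_pos hα, abs_sub_comm, Real.div_rpow (abs_nonneg _) hα.le,
      Real.rpow_neg hα.le, div_eq_inv_mul]
  rw [e1, e2, e3, sub_self, abs_zero, Real.zero_rpow hp.ne']
  ring

lemma incCov_comm (p s s' t t' : ℝ) : incCov p s s' t t' = incCov p t t' s s' := by
  unfold incCov
  rw [abs_sub_comm s t', abs_sub_comm s' t, abs_sub_comm s t, abs_sub_comm s' t']
  ring

lemma ouCov_comm (p α s t : ℝ) : ouCov p α s t = ouCov p α t s := by
  unfold ouCov
  rw [← integral_prod_swap]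
  refine integral_congr_ae (.of_forall fun z => ?_)
  exact incCov_comm _ _ _ _ _

/-- The covariance of distant increments of a fractional Brownian motion vanishes. -/
lemma tendsto_incCov {p : ℝ} (hp : 0 < p) (hp1 : p ≤ 1) (a b : ℝ) :
    Tendsto (fun τ : ℝ => (|τ + b| ^ p + |τ - a| ^ p - |τ| ^ p - |τ - a + b| ^ p) / 2)
      atTop (𝓝 0) := by
  -- For `p = 1` the single differences `|τ + c| - |τ|` do not decay; the full expression vanishes
  -- exactly once the increments are disjoint.
  rcases hp1.eq_or_lt with rfl | hp1
  · refine tendsto_const_nhds.congr' ?_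
    filter_upwards [eventually_ge_atTop (|a| + |b|)] with τ hτ
    have ha := neg_abs_le a
    have ha' := le_abs_self a
    have hb := neg_abs_le b
    have ha0 := abs_nonneg a
    have hb0 := abs_nonneg b
    simp only [Real.rpow_one]
    rw [abs_of_nonneg (by linarith), abs_of_nonneg (by linarith),
      abs_of_nonneg (by linarith), abs_of_nonneg (by linarith)]
    ring
  · have key : ∀ c : ℝ, 0 ≤ c → Tendsto (fun τ : ℝ => |τ + c| ^ p - |τ| ^ p) atTop (𝓝 0) := by
      intro c hc
      have hup : Tendsto (fun τ : ℝ => p * c * τ ^ (-(1 - p))) atTop (𝓝 0) := by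
        simpa using (tendsto_rpow_neg_atTop (y := 1 - p) (by linarith)).const_mul (p * c)
      refine tendsto_of_tendsto_of_tendsto_of_le_of_le' tendsto_const_nhds hup ?_ ?_
      · filter_upwards [eventually_gt_atTop 0] with τ hτ
        rw [abs_of_pos hτ, abs_of_nonneg (by linarith)]
        have := Real.rpow_le_rpow hτ.le (by linarith : τ ≤ τ + c) hp.le
        linarith
      · filter_upwards [eventually_gt_atTop 0] with τ hτ
        rw [abs_of_pos hτ, abs_of_nonneg (by linarith)]
        have e1 : τ + c = τ * (1 + c / τ) := by field_simp
        have hcτ : 0 ≤ c / τ := by positivity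
        -- Bernoulli's inequality for exponents `p ≤ 1` bounds the difference by `p c τ^(p - 1)`,
        -- which tends to zero since `p < 1`.
        have h1 := rpow_one_add_le_one_add_mul_self (s := c / τ) (p := p) (by linarith)
          hp.le hp1.le
        rw [e1, Real.mul_rpow hτ.le (by linarith)]
        have h2 := mul_le_mul_of_nonneg_left h1 (Real.rpow_nonneg hτ.le p)
        have e2 : τ ^ (-(1 - p)) = τ ^ p / τ := by
          rw [neg_sub, Real.rpow_sub hτ, Real.rpow_one]
        rw [e2]
        have e3 : τ ^ p * (1 + p * (c / τ)) = τ ^ p + p * c * (τ ^ p / τ) := by ring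
        linarith
    have key2 : ∀ c : ℝ, Tendsto (fun τ : ℝ => |τ + c| ^ p - |τ| ^ p) atTop (𝓝 0) := by
      intro c
      rcases le_total 0 c with hc | hc
      · exact key c hc
      · have h := ((key (-c) (by linarith)).comp (tendsto_atTop_add_const_right _ c tendsto_id)).neg
        rw [neg_zero] at h
        refine h.congr fun τ => ?_
        simp
    have h := ((key2 b).add ((key2 (-a)).sub (key2 (b - a)))).div_const 2
    simp only [sub_zero, add_zero, zero_div] at h
    refine h.congr fun τ => ?_
    have : τ + (b - a) = τ - a + b := by ring
    rw [this, ← sub_eq_add_neg]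
    ring

/-- The rescaled times separate at the linear rate `T * (b - a)`, while the look-back lengths `z.1 /
α` and `z.2 / α` stay fixed. Pointwise decay is `tendsto_incCov`, and the domination is uniform in
`T`. -/
lemma tendsto_ouCov_of_lt {p α : ℝ} (hp : 0 < p) (hp1 : p ≤ 1) (hα : 0 < α) {a b : ℝ} (ha : 0 < a)
    (hab : a < b) : Tendsto (fun T => ouCov p α (T * b) (T * a)) atTop (𝓝 0) := by
  have h0 : ∫ z : ℝ × ℝ, (0 : ℝ) ∂(expLaw.prod expLaw) = 0 := integral_zero _ _
  rw [← h0]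
  refine tendsto_integral_filter_of_dominated_convergence _
    (.of_forall fun t => (measurable_ouCov_integrand p α _ _).aestronglyMeasurable)
    ((eventually_ge_atTop 0).mono fun t ht => ouCov_integrand_le hp hp1 hα (by positivity))
    (integrable_ouCov_bound hp α) (.of_forall fun z => ?_)
  have hτ : Tendsto (fun T : ℝ => T * (b - a)) atTop atTop :=
    tendsto_id.atTop_mul_const (by linarith)
  refine ((tendsto_incCov hp hp1 (z.1 / α) (z.2 / α)).comp hτ).congr' ?_
  have e1 : ∀ r : ℝ, ∀ c : ℝ, 0 < c → ∀ᶠ T in atTop, r ≤ T * c := fun r c hc =>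
    (tendsto_id.atTop_mul_const hc).eventually_ge_atTop r
  filter_upwards [e1 (z.2 / α) a ha, e1 (z.1 / α) b (by linarith)] with T h1 h2
  rw [max_eq_left (by linarith), max_eq_left (by linarith), incCov, Function.comp_apply]
  ring_nf

lemma tendsto_ouCov_of_ne {p α : ℝ} (hp : 0 < p) (hp1 : p ≤ 1) (hα : 0 < α) {a b : ℝ} (ha : 0 < a)
    (hb : 0 < b) (hab : a ≠ b) : Tendsto (fun T => ouCov p α (T * a) (T * b)) atTop (𝓝 0) := by
  rcases hab.lt_or_gt with h | h
  · simpa only [ouCov_comm p α (_ * a)] using tendsto_ouCov_of_lt hp hp1 hα ha h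
  · exact tendsto_ouCov_of_lt hp hp1 hα hb h

/-! ### Scalar Ornstein–Uhlenbeck integrals of fractional Brownian motions. -/

section Noise

variable {Ω : Type*} [MeasurableSpace Ω] {P : Measure Ω} [IsProbabilityMeasure P] {hurst : ℝ}
  {B : ℝ → Ω → ℝ} {s s' t t' α : ℝ}

/-- The integral `∫₀^∞ e^{-u} (B_t - B_{(t - u/α)⁺}) du`. -/
def ouInt (α : ℝ) (B : ℝ → Ω → ℝ) (t : ℝ) (ω : Ω) : ℝ :=
  ∫ u, (B t ω - B (max (t - u / α) 0) ω) ∂expLaw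

/-- The pathwise solution of `dx = -α x dt + db`, `x(0) = 0`. -/
lemma ouInt_eq {ω : Ω} (hB : ContinuousOn (fun t => B t ω) (Set.Ici 0)) (h0 : B 0 ω = 0)
    (hα : 0 < α) (ht : 0 ≤ t) :
    ouInt α B t ω = B t ω + -α * ∫ s in (0 : ℝ)..t, Real.exp (-α * (t - s)) * B s ω := by
  set b : ℝ → ℝ := fun s => B (max s 0) ω with hb
  have hbc : Continuous b := hB.comp_continuous (by fun_prop) fun s => Set.mem_Ici.2 (le_max_right _ _)
  have hb0 : ∀ s, s ≤ 0 → b s = 0 := fun s hs => by simp [hb, max_eq_right hs, h0]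
  obtain ⟨M, hM⟩ := (isCompact_Icc (a := 0) (b := t)).exists_bound_of_continuousOn hbc.continuousOn
  have hM0 : 0 ≤ M := (norm_nonneg _).trans (hM 0 ⟨le_rfl, ht⟩)
  have hi : Integrable (fun u => b (t - u / α)) expLaw := by
    refine Integrable.of_bound (C := M) (hbc.comp (by fun_prop)).aestronglyMeasurable ?_
    filter_upwards [ae_expLaw_pos] with u hu
    rcases le_total (t - u / α) 0 with h | h
    · rw [hb0 _ h]; simpa using hM0
    · exact hM _ ⟨h, by have := div_pos hu hα; linarith⟩
  -- The extended path vanishes at nonpositive times, so the exponential average stops at `u = α *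
  -- t`; the substitution `s = t - u / α` follows.
  have e1 : ∫ u, b (t - u / α) ∂expLaw =
      ∫ u in (0 : ℝ)..(α * t), Real.exp (-u) * b (t - u / α) := by
    rw [integral_expLaw, intervalIntegral.integral_of_le (by positivity)]
    refine (setIntegral_eq_of_subset_of_forall_sdiff_eq_zero measurableSet_Ioi
      Set.Ioc_subset_Ioi_self fun u hu => ?_)
    have hu2 : α * t < u := by
      by_contra h
      exact hu.2 ⟨hu.1, not_lt.1 h⟩
    rw [hb0, smul_zero]
    have : t < u / α := by rwa [lt_div_iff₀ hα, mul_comm]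
    linarith
  have e2 : ∫ u in (0 : ℝ)..(α * t), Real.exp (-u) * b (t - u / α) =
      α * ∫ s in (0 : ℝ)..t, Real.exp (-α * (t - s)) * b s := by
    have h := intervalIntegral.integral_comp_sub_div
      (fun s => Real.exp (-α * (t - s)) * b s) hα.ne' t (a := 0) (b := α * t)
    rw [mul_div_cancel_left₀ _ hα.ne', sub_self, zero_div, sub_zero, smul_eq_mul] at h
    rw [← h]
    refine intervalIntegral.integral_congr fun u _ => ?_
    have : -α * (t - (t - u / α)) = -u := by field_simp; ring
    simp only [this]
  have e3 : ∫ s in (0 : ℝ)..t, Real.exp (-α * (t - s)) * b s =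
      ∫ s in (0 : ℝ)..t, Real.exp (-α * (t - s)) * B s ω := by
    refine intervalIntegral.integral_congr fun u hu => ?_
    rw [Set.uIcc_of_le ht] at hu
    simp only [hb, max_eq_left hu.1]
  rw [ouInt, integral_sub (integrable_const _) hi, e1, e2, e3]
  simp [sub_eq_add_neg]

namespace IsFBM

lemma memLp_two (hB : IsFBM hurst P B) (ht : 0 ≤ t) : MemLp (B t) 2 P :=
  (hB.gaussian.hasGaussianLaw_eval ⟨t, ht⟩).memLp_two

lemma ae_zero (hB : IsFBM hurst P B) (hh : 0 < hurst) : ∀ᵐ ω ∂P, B 0 ω = 0 := by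
  have h := hB.cov 0 0 le_rfl le_rfl
  rw [sub_self, abs_zero, Real.zero_rpow (by positivity)] at h
  have hi : Integrable (fun ω => B 0 ω * B 0 ω) P :=
    (hB.memLp_two le_rfl).integrable_mul (hB.memLp_two le_rfl)
  have h2 := (integral_eq_zero_iff_of_nonneg (fun ω => mul_self_nonneg (B 0 ω)) hi).1
    (by rw [h]; norm_num)
  filter_upwards [h2] with ω hω
  exact mul_self_eq_zero.1 hω

lemma integral_inc_mul_inc (hB : IsFBM hurst P B) (hs : 0 ≤ s) (hs' : 0 ≤ s') (ht : 0 ≤ t)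
    (ht' : 0 ≤ t') : ∫ ω, (B s ω - B s' ω) * (B t ω - B t' ω) ∂P =
      incCov (2 * hurst) s s' t t' := by
  have I : ∀ {a b : ℝ}, 0 ≤ a → 0 ≤ b → Integrable (fun ω => B a ω * B b ω) P := fun ha hb =>
    (hB.memLp_two ha).integrable_mul (hB.memLp_two hb)
  have e : ∀ ω, (B s ω - B s' ω) * (B t ω - B t' ω) =
      (B s ω * B t ω - B s' ω * B t ω) - (B s ω * B t' ω - B s' ω * B t' ω) := fun ω => by ring
  simp_rw [e]
  have i1 : Integrable (fun ω => B s ω * B t ω - B s' ω * B t ω) P := (I hs ht).sub (I hs' ht)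
  have i2 : Integrable (fun ω => B s ω * B t' ω - B s' ω * B t' ω) P := (I hs ht').sub (I hs' ht')
  rw [integral_sub i1 i2, integral_sub (I hs ht) (I hs' ht), integral_sub (I hs ht') (I hs' ht'),
    hB.cov s t hs ht, hB.cov s' t hs' ht, hB.cov s t' hs ht', hB.cov s' t' hs' ht', incCov,
    abs_sub_comm t s, abs_sub_comm t s', abs_sub_comm t' s, abs_sub_comm t' s']
  ring

/-- The increment over a look-back of length at most `u / α` has second moment at most `(u / α)^(2 *
hurst)`, integrable against the exponential law. Joint measurability comes from path continuity. -/
lemma memLp_inc (hB : IsFBM hurst P B) (hh : 0 < hurst) (hh1 : hurst ≤ 1 / 2) (hα : 0 < α)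
    (ht : 0 ≤ t) :
    MemLp (fun z : ℝ × Ω => B t z.2 - B (max (t - z.1 / α) 0) z.2) 2 (expLaw.prod P) := by
  have hm : AEStronglyMeasurable (fun z : ℝ × Ω => B t z.2 - B (max (t - z.1 / α) 0) z.2)
      (expLaw.prod P) := by
    refine aestronglyMeasurable_uncurry_of_continuous
      (X := fun u ω => B t ω - B (max (t - u / α) 0) ω) (fun u => ?_) ?_ expLaw
    · exact ((hB.measurable t ht).sub (hB.measurable _ (le_max_right _ _))).aestronglyMeasurable
    · filter_upwards [hB.continuous] with ω hω
      exact continuous_const.sub (hω.comp_continuous (f := fun u => max (t - u / α) 0)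
        (by fun_prop) fun u => Set.mem_Ici.2 (le_max_right _ _))
  refine ⟨hm, (eLpNorm_two_lt_top_iff _).2 ?_⟩
  rw [lintegral_prod _ (hm.enorm.pow_const 2)]
  have hp : (0 : ℝ) < 2 * hurst := by linarith
  have h1 : ∀ u, ∫⁻ ω, ‖B t ω - B (max (t - u / α) 0) ω‖ₑ ^ 2 ∂P =
      ENNReal.ofReal (incCov (2 * hurst) t (max (t - u / α) 0) t (max (t - u / α) 0)) := fun u => by
    have hY : MemLp (fun ω => B t ω - B (max (t - u / α) 0) ω) 2 P :=
      (hB.memLp_two ht).sub (hB.memLp_two (le_max_right _ _))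
    have hYY : Integrable (fun ω => (B t ω - B (max (t - u / α) 0) ω) *
      (B t ω - B (max (t - u / α) 0) ω)) P := hY.integrable_mul hY
    rw [← hB.integral_inc_mul_inc ht (le_max_right _ _) ht (le_max_right _ _),
      ofReal_integral_eq_lintegral_ofReal hYY (.of_forall fun ω => mul_self_nonneg _)]
    refine lintegral_congr fun ω => ?_
    rw [Real.enorm_eq_ofReal_abs, ← ENNReal.ofReal_pow (abs_nonneg _), sq_abs, sq]
  calc _ ≤ ∫⁻ u, ENNReal.ofReal (α ^ (-(2 * hurst)) * u ^ (2 * hurst)) ∂expLaw := by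
        refine lintegral_mono_ae ?_
        filter_upwards [ae_expLaw_pos] with u hu
        rw [h1]
        refine ENNReal.ofReal_le_ofReal ((le_abs_self _).trans
          ((abs_incCov_le hp (by linarith) _ _ _ _).trans ?_))
        have h := sub_max_sub_mem ht (r := u / α) (by positivity)
        rw [abs_of_nonneg h.1]
        calc _ ≤ (u / α) ^ (2 * hurst) := Real.rpow_le_rpow h.1 h.2 hp.le
          _ = _ := by rw [Real.div_rpow hu.le hα.le, Real.rpow_neg hα.le, div_eq_inv_mul]
    _ < ∞ := ((integrable_rpow_expLaw hp).const_mul _).lintegral_lt_top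

lemma memLp_ouInt (hB : IsFBM hurst P B) (hh : 0 < hurst) (hh1 : hurst ≤ 1 / 2) (hα : 0 < α)
    (ht : 0 ≤ t) : MemLp (ouInt α B t) 2 P :=
  memLp_integral (hB.memLp_inc hh hh1 hα ht)

/-- Two applications of Fubini, one for each exponential variable, reduce to covariances of
increments. -/
lemma integral_ouInt_mul_ouInt (hB : IsFBM hurst P B) (hh : 0 < hurst) (hh1 : hurst ≤ 1 / 2)
    (hα : 0 < α) (hs : 0 ≤ s) (ht : 0 ≤ t) :
    ∫ ω, ouInt α B s ω * ouInt α B t ω ∂P = ouCov (2 * hurst) α s t := by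
  have hp : (0 : ℝ) < 2 * hurst := by linarith
  have hfs := hB.memLp_inc hh hh1 hα hs
  have hft := hB.memLp_inc hh hh1 hα ht
  simp_rw [mul_comm (ouInt α B s _)]
  have h1 := integral_mul_integral hfs (hB.memLp_ouInt hh hh1 hα ht)
  refine h1.trans ?_
  rw [ouCov, integral_prod _ ((integrable_ouCov_bound hp α).mono'
    (measurable_ouCov_integrand _ α s t).aestronglyMeasurable
    (ouCov_integrand_le hp (by linarith) hα ht))]
  refine integral_congr_ae (.of_forall fun u => ?_)
  simp only
  simp_rw [mul_comm (ouInt α B t _)]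
  have h2 := integral_mul_integral hft (Y := fun ω => B s ω - B (max (s - u / α) 0) ω)
    ((hB.memLp_two hs).sub (hB.memLp_two (le_max_right _ _)))
  refine h2.trans (integral_congr_ae (.of_forall fun v => ?_))
  exact hB.integral_inc_mul_inc hs (le_max_right (s - u / α) _) ht (le_max_right (t - v / α) _)

end IsFBM

variable {W : ℕ → ℝ → Ω → ℝ}

/-- Group a finite combination by the index of the Brownian motion: each group is Gaussian because
its motion is a Gaussian process, and the groups are independent. -/
lemma isCenteredGaussFamily_noise (hW : ∀ i, IsFBM hurst P (W i))
    (hindep : iIndepFun (fun i ω => fun t : ℝ≥0 => W i t ω) P) :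
    IsCenteredGaussFamily (fun (a : ℕ × ℝ≥0) ω => W a.1 a.2 ω) P := by
  classical
  refine ⟨fun s c => ?_, fun a => (hW a.1).mean a.2 a.2.2⟩
  set F : ℕ → Finset (ℕ × ℝ≥0) := fun i => s.filter fun a => a.1 = i with hF
  set Y : ℕ → Ω → ℝ := fun i ω => ∑ a ∈ F i, c a * W i a.2 ω with hY
  have e : (fun ω => ∑ a ∈ s, c a * W a.1 a.2 ω) =
      fun ω => ∑ i : {i // i ∈ s.image Prod.fst}, Y i ω := by
    ext ω
    rw [Finset.sum_coe_sort (s.image Prod.fst) (fun i => Y i ω),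
      ← Finset.sum_fiberwise_of_maps_to (g := Prod.fst) (t := s.image Prod.fst)
        fun a ha => Finset.mem_image_of_mem _ ha]
    refine Finset.sum_congr rfl fun i _ => Finset.sum_congr rfl fun a ha => ?_
    rw [(Finset.mem_filter.1 ha).2]
  rw [e]
  have hind : iIndepFun Y P := by
    have := hindep.comp (fun i (x : ℝ≥0 → ℝ) => ∑ a ∈ F i, c a * x a.2) fun i => by fun_prop
    exact this
  refine iIndepFun.hasGaussianLaw_fun_sum (X := fun (i : {i // i ∈ s.image Prod.fst}) => Y i)
    (fun i => ?_) (hind.precomp Subtype.val_injective)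
  have hg := ((hW i).gaussian.comp_right (fun a : ℕ × ℝ≥0 => a.2)).smul c
  have h := hg.hasGaussianLaw_fun_sum (I := F i)
  exact h

lemma integral_inc_mul_inc_of_ne (hW : ∀ i, IsFBM hurst P (W i))
    (hindep : iIndepFun (fun i ω => fun t : ℝ≥0 => W i t ω) P) {i j : ℕ} (hij : i ≠ j)
    (hs : 0 ≤ s) (hs' : 0 ≤ s') (ht : 0 ≤ t) (ht' : 0 ≤ t') :
    ∫ ω, (W i s ω - W i s' ω) * (W j t ω - W j t' ω) ∂P = 0 := by
  have h := (hindep.indepFun hij).comp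
    (φ := fun x : ℝ≥0 → ℝ => x ⟨s, hs⟩ - x ⟨s', hs'⟩)
    (ψ := fun x : ℝ≥0 → ℝ => x ⟨t, ht⟩ - x ⟨t', ht'⟩) (by fun_prop) (by fun_prop)
  have h2 := h.integral_fun_mul_eq_mul_integral
    (((hW i).measurable s hs).sub ((hW i).measurable s' hs')).aestronglyMeasurable
    (((hW j).measurable t ht).sub ((hW j).measurable t' ht')).aestronglyMeasurable
  refine h2.trans ?_
  have h3 : ∫ ω, (W i s ω - W i s' ω) ∂P = 0 := by
    rw [integral_sub (((hW i).memLp_two hs).integrable one_le_two)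
      (((hW i).memLp_two hs').integrable one_le_two), (hW i).mean s hs, (hW i).mean s' hs', sub_zero]
  exact mul_eq_zero_of_left h3 _

lemma integral_ouInt_mul_ouInt_of_ne (hW : ∀ i, IsFBM hurst P (W i))
    (hindep : iIndepFun (fun i ω => fun t : ℝ≥0 => W i t ω) P) (hh : 0 < hurst)
    (hh1 : hurst ≤ 1 / 2) {i j : ℕ} (hij : i ≠ j) {α β : ℝ} (hα : 0 < α) (hβ : 0 < β)
    (hs : 0 ≤ s) (ht : 0 ≤ t) :
    ∫ ω, ouInt α (W i) s ω * ouInt β (W j) t ω ∂P = 0 := by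
  have hft := (hW j).memLp_inc hh hh1 hβ ht
  have hfs := (hW i).memLp_inc hh hh1 hα hs
  refine (integral_mul_integral hft ((hW i).memLp_ouInt hh hh1 hα hs)).trans ?_
  refine integral_eq_zero_of_ae (.of_forall fun v => ?_)
  simp only [Pi.zero_apply]
  simp_rw [mul_comm (ouInt α (W i) s _)]
  refine (integral_mul_integral hfs (((hW j).memLp_two ht).sub
    ((hW j).memLp_two (le_max_right _ _)))).trans ?_
  refine integral_eq_zero_of_ae (.of_forall fun u => ?_)
  exact integral_inc_mul_inc_of_ne hW hindep hij.symm ht (le_max_right (t - v / β) _) hs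
    (le_max_right (s - u / α) _)

lemma gaussSpan_ouInt (hW : ∀ i, IsFBM hurst P (W i)) (hh : 0 < hurst) (hh1 : hurst ≤ 1 / 2)
    (hα : 0 < α) (ht : 0 ≤ t) (i : ℕ) :
    GaussSpan (fun (a : ℕ × ℝ≥0) ω => W a.1 a.2 ω) P (ouInt α (W i) t) := by
  have hself : ∀ r : ℝ, 0 ≤ r →
      GaussSpan (fun (a : ℕ × ℝ≥0) ω => W a.1 a.2 ω) P (W i r) := fun r hr =>
    GaussSpan.self (V := fun (a : ℕ × ℝ≥0) ω => W a.1 a.2 ω) (i, ⟨r, hr⟩) ((hW i).memLp_two hr)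
  exact GaussSpan.integral ((hW i).memLp_inc hh hh1 hα ht) fun u =>
    (hself t ht).sub (hself (max (t - u / α) 0) (le_max_right _ _))

end Noise

lemma summable_smul_of_orthonormal {E : Type*} [NormedAddCommGroup E] [InnerProductSpace ℝ E]
    [CompleteSpace E] {e : ℕ → E} (he : Orthonormal ℝ e) {a : ℕ → ℝ}
    (ha : Summable fun i => a i ^ 2) : Summable fun i => a i • e i := by
  have h := he.orthogonalFamily.summable_iff_norm_sq_summable (fun i => a i)
  have h2 := h.2 (by simpa using ha)
  simpa using h2

/-! ### The `H`-valued process: modes, covariances and fourth moments. -/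

section OrnsteinUhlenbeck

variable {d : ℕ} {ξ hurst : ℝ} {e : ℕ → H d} {σ lam : ℕ → ℝ} {C : H d →ₗ.[ℝ] H d}
  {R : H d →L[ℝ] H d} {Ω : Type*} [MeasurableSpace Ω] {P : Measure Ω} [IsProbabilityMeasure P]
  {W : ℕ → ℝ → Ω → ℝ} {w : ℝ → Ω → H d} {s t : ℝ}

lemma IsFBM.lintegral_sq {B : ℝ → Ω → ℝ} (hB : IsFBM hurst P B) (hh : 0 < hurst) (ht : 0 ≤ t) :
    ∫⁻ ω, ENNReal.ofReal (B t ω ^ 2) ∂P = ENNReal.ofReal (t ^ (2 * hurst)) := by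
  rw [← ofReal_integral_eq_lintegral_ofReal (hB.memLp_two ht).integrable_sq
    (.of_forall fun ω => sq_nonneg _)]
  congr 1
  have h := hB.cov t t ht ht
  rw [sub_self, abs_zero, Real.zero_rpow (by positivity)] at h
  simp_rw [sq]
  rw [h]; ring

/-- The expectation of `∑ σ_i² W_i(t)²` is `t^(2 * hurst) ∑ σ_i²`, so the coefficients are almost
surely square summable. -/
lemma ae_summable_noise (he : Orthonormal ℝ e) (hσ : Summable fun i => σ i ^ 2)
    (hW : ∀ i, IsFBM hurst P (W i)) (hh : 0 < hurst) (ht : 0 ≤ t) :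
    ∀ᵐ ω ∂P, Summable fun i => (σ i * W i t ω) • e i := by
  have hm : ∀ i, AEMeasurable (fun ω => ENNReal.ofReal (σ i ^ 2) *
      ENNReal.ofReal (W i t ω ^ 2)) P := fun i =>
    ((((hW i).measurable t ht).pow_const 2).ennreal_ofReal.const_mul _).aemeasurable
  have h1 : ∫⁻ ω, ∑' i, ENNReal.ofReal (σ i ^ 2) * ENNReal.ofReal (W i t ω ^ 2) ∂P ≠ ∞ := by
    rw [lintegral_tsum hm]
    have : ∀ i, ∫⁻ ω, ENNReal.ofReal (σ i ^ 2) * ENNReal.ofReal (W i t ω ^ 2) ∂P =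
        ENNReal.ofReal (σ i ^ 2) * ENNReal.ofReal (t ^ (2 * hurst)) := fun i => by
      rw [lintegral_const_mul _ (((hW i).measurable t ht).pow_const 2).ennreal_ofReal,
        (hW i).lintegral_sq hh ht]
    simp_rw [this]
    rw [ENNReal.tsum_mul_right]
    refine ENNReal.mul_ne_top ?_ ENNReal.ofReal_ne_top
    rw [← ENNReal.ofReal_tsum_of_nonneg (fun i => sq_nonneg _) hσ]
    exact ENNReal.ofReal_ne_top
  filter_upwards [ae_lt_top' (AEMeasurable.tsum hm) h1] with ω hω
  refine summable_smul_of_orthonormal he ?_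
  have h3 := ENNReal.summable_toReal hω.ne
  refine h3.congr fun i => ?_
  rw [ENNReal.toReal_mul, ENNReal.toReal_ofReal (sq_nonneg _), ENNReal.toReal_ofReal (sq_nonneg _),
    mul_pow]

/-- The expansion of the fractional Ornstein–Uhlenbeck process in the eigenbasis. -/
lemma ae_modes (hC : SmallScale d ξ e σ lam C R) (hW : ∀ i, IsFBM hurst P (W i))
    (hw : IsFOU e σ C P W w) (hh : 0 < hurst) : ∀ᵐ ω ∂P,
      ContinuousOn (fun t => w t ω) (Set.Ici 0) ∧ ∀ t, 0 ≤ t →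
        HasSum (fun i => inner ℝ (e i) (w t ω) • e i) (w t ω) ∧
        ∀ i, inner ℝ (e i) (w t ω) = σ i * ouInt (-lam i) (W i) t ω := by
  have h1 : ∀ᵐ ω ∂P, ∀ i, ContinuousOn (fun t => W i t ω) (Set.Ici 0) :=
    ae_all_iff.2 fun i => (hW i).continuous
  have h2 : ∀ᵐ ω ∂P, ∀ i, W i 0 ω = 0 := ae_all_iff.2 fun i => (hW i).ae_zero hh
  -- Restricting the equation to rational times keeps the exceptional set null.
  have h3 : ∀ᵐ ω ∂P, ∀ q : ℚ, 0 ≤ q → Summable (fun i => (σ i * W i q ω) • e i) ∧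
      ∃ h : (∫ s in (0 : ℝ)..q, w s ω) ∈ C.domain,
        w q ω = C ⟨∫ s in (0 : ℝ)..q, w s ω, h⟩ + ∑' i, (σ i * W i q ω) • e i := by
    refine ae_all_iff.2 fun q => ?_
    by_cases hq : 0 ≤ q
    · have hq' : (0 : ℝ) ≤ q := by exact_mod_cast hq
      filter_upwards [ae_summable_noise hC.orthonormal hC.summable_sq hW hh hq',
        hw.equation q hq'] with ω h h' _
      exact ⟨h, h'⟩
    · exact .of_forall fun ω h => absurd h hq
  filter_upwards [h1, h2, h3, hw.continuous] with ω h1 h2 h3 h4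
  refine ⟨h4, fun t ht => ?_⟩
  have h := hC.hasSum_modes (W := fun i s => W i s ω) h4 h1 h3 ht
  refine ⟨h.1, fun i => ?_⟩
  rw [h.2 i, ouInt_eq (h1 i) (h2 i) (neg_pos.2 (hC.lam_neg i)) ht, neg_neg]

lemma ae_inner_eq (hC : SmallScale d ξ e σ lam C R) (hW : ∀ i, IsFBM hurst P (W i))
    (hw : IsFOU e σ C P W w) (hh : 0 < hurst) (ht : 0 ≤ t) (i : ℕ) :
    (fun ω => inner ℝ (e i) (w t ω)) =ᵐ[P] fun ω => σ i * ouInt (-lam i) (W i) t ω := by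
  filter_upwards [ae_modes hC hW hw hh] with ω hω
  exact (hω.2 t ht).2 i

lemma gaussSpan_mode (hC : SmallScale d ξ e σ lam C R) (hW : ∀ i, IsFBM hurst P (W i))
    (hw : IsFOU e σ C P W w) (hh : 0 < hurst) (hh1 : hurst ≤ 1 / 2) (ht : 0 ≤ t) (i : ℕ) :
    GaussSpan (fun (a : ℕ × ℝ≥0) ω => W a.1 a.2 ω) P fun ω => inner ℝ (e i) (w t ω) :=
  ((gaussSpan_ouInt hW hh hh1 (neg_pos.2 (hC.lam_neg i)) ht i).const_mul (σ i)).congr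
    (ae_inner_eq hC hW hw hh ht i).symm

lemma integral_mode_mul_mode (hC : SmallScale d ξ e σ lam C R) (hW : ∀ i, IsFBM hurst P (W i))
    (hw : IsFOU e σ C P W w) (hh : 0 < hurst) (hh1 : hurst ≤ 1 / 2) (hs : 0 ≤ s) (ht : 0 ≤ t)
    (i : ℕ) : ∫ ω, inner ℝ (e i) (w s ω) * inner ℝ (e i) (w t ω) ∂P =
      σ i ^ 2 * ouCov (2 * hurst) (-lam i) s t := by
  rw [← (hW i).integral_ouInt_mul_ouInt hh hh1 (neg_pos.2 (hC.lam_neg i)) hs ht,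
    ← integral_const_mul]
  refine integral_congr_ae ?_
  filter_upwards [ae_modes hC hW hw hh] with ω hω
  rw [(hω.2 s hs).2 i, (hω.2 t ht).2 i]
  ring

lemma integral_mode_mul_mode_of_ne (hC : SmallScale d ξ e σ lam C R)
    (hW : ∀ i, IsFBM hurst P (W i))
    (hindep : iIndepFun (fun i ω => fun t : ℝ≥0 => W i t ω) P)
    (hw : IsFOU e σ C P W w) (hh : 0 < hurst) (hh1 : hurst ≤ 1 / 2) (hs : 0 ≤ s) (ht : 0 ≤ t)
    {i j : ℕ} (hij : i ≠ j) :
    ∫ ω, inner ℝ (e i) (w s ω) * inner ℝ (e j) (w t ω) ∂P = 0 := by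
  have h := integral_ouInt_mul_ouInt_of_ne hW hindep hh hh1 hij (neg_pos.2 (hC.lam_neg i))
    (neg_pos.2 (hC.lam_neg j)) hs ht
  rw [← mul_zero (σ i * σ j), ← h, ← integral_const_mul]
  refine integral_congr_ae ?_
  filter_upwards [ae_modes hC hW hw hh] with ω hω
  rw [(hω.2 s hs).2 i, (hω.2 t ht).2 j]
  ring

/-- A uniform bound of the variances of the modes, relative to `σ_i²`. -/
def covConst (hurst : ℝ) (lam : ℕ → ℝ) : ℝ := (-lam 0) ^ (-(2 * hurst)) * expMoment (2 * hurst)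

/-- `lam 0` is the eigenvalue closest to zero, and the negative power is largest there. -/
lemma SmallScale.rpow_lam_le (hC : SmallScale d ξ e σ lam C R) (hh : 0 < hurst) (i : ℕ) :
    (-lam i) ^ (-(2 * hurst)) * expMoment (2 * hurst) ≤ covConst hurst lam := by
  refine mul_le_mul_of_nonneg_right ?_ (expMoment_nonneg _)
  exact Real.rpow_le_rpow_of_nonpos (neg_pos.2 hC.sup_neg) (neg_le_neg (hC.lam_le i)) (by linarith)

lemma SmallScale.abs_cov_le (hC : SmallScale d ξ e σ lam C R) (hh : 0 < hurst)
    (hh1 : hurst ≤ 1 / 2) (ht : 0 ≤ t) (i : ℕ) :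
    |ouCov (2 * hurst) (-lam i) s t| ≤ covConst hurst lam :=
  (abs_ouCov_le (by linarith) (by linarith) (neg_pos.2 (hC.lam_neg i)) ht).trans
    (hC.rpow_lam_le hh i)

lemma covConst_nonneg (hC : SmallScale d ξ e σ lam C R) : 0 ≤ covConst hurst lam :=
  mul_nonneg (Real.rpow_nonneg (neg_pos.2 hC.sup_neg).le _) (expMoment_nonneg _)

/-- The sequence of weights that dominates all the covariances. -/
def gaussWeight (hurst : ℝ) (σ lam : ℕ → ℝ) (i : ℕ) : ℝ≥0∞ :=
  ENNReal.ofReal (covConst hurst lam * σ i ^ 2)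

lemma gaussWeight_summable (hC : SmallScale d ξ e σ lam C R) :
    ∑' i, gaussWeight hurst σ lam i * sobolevNormSq ξ (e i) < ∞ := by
  simp_rw [gaussWeight, ENNReal.ofReal_mul (covConst_nonneg hC), mul_assoc]
  rw [ENNReal.tsum_mul_left]
  exact ENNReal.mul_lt_top ENNReal.ofReal_lt_top hC.summable

lemma ofReal_sum_gaussWeight (hC : SmallScale d ξ e σ lam C R) (c : ℕ → ℝ) (n : ℕ) :
    ENNReal.ofReal (∑ i ∈ Finset.range n, covConst hurst lam * σ i ^ 2 * c i ^ 2) ≤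
      ∑' i, gaussWeight hurst σ lam i * ‖c i‖ₑ ^ 2 := by
  have h0 := covConst_nonneg hC (hurst := hurst)
  rw [ENNReal.ofReal_sum_of_nonneg fun i _ => by positivity]
  refine (Finset.sum_le_sum fun i _ => le_of_eq ?_).trans (ENNReal.sum_le_tsum (Finset.range n))
  rw [ENNReal.ofReal_mul (by positivity), gaussWeight, Real.enorm_eq_ofReal_abs,
    ← ENNReal.ofReal_pow (abs_nonneg _), sq_abs]

lemma enorm_pow_four (x : ℝ) : ‖x‖ₑ ^ 4 = ENNReal.ofReal (x ^ 4) := by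
  rw [Real.enorm_eq_ofReal_abs, ← ENNReal.ofReal_pow (abs_nonneg _), (by decide : Even 4).pow_abs]

/-- Partial sums of the mode expansion are in the Gaussian span, with variance at most the weighted
sum because distinct modes are uncorrelated. Fatou's lemma passes the fourth moment bound to the
limit. -/
lemma gaussBound_process (hC : SmallScale d ξ e σ lam C R)
    (hW : ∀ i, IsFBM hurst P (W i))
    (hindep : iIndepFun (fun i ω => fun t : ℝ≥0 => W i t ω) P)
    (hw : IsFOU e σ C P W w) (hh : 0 < hurst) (hh1 : hurst ≤ 1 / 2) (ht : 0 ≤ t) :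
    GaussBound P e (gaussWeight hurst σ lam) (w t) := by
  intro ℓ
  have hV := isCenteredGaussFamily_noise hW hindep
  set Y : ℕ → Ω → ℝ := fun n ω => ∑ i ∈ Finset.range n, ℓ (e i) * inner ℝ (e i) (w t ω) with hY
  have hspan : ∀ n, GaussSpan (fun (a : ℕ × ℝ≥0) ω => W a.1 a.2 ω) P (Y n) := fun n =>
    GaussSpan.sum _ fun i _ => (gaussSpan_mode hC hW hw hh hh1 ht i).const_mul _
  have hint : ∀ i j, Integrable (fun ω => inner ℝ (e i) (w t ω) * inner ℝ (e j) (w t ω)) P :=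
    fun i j => (gaussSpan_mode hC hW hw hh hh1 ht i).integrable_mul
      (gaussSpan_mode hC hW hw hh hh1 ht j)
  have hvar : ∀ n, ∫ ω, Y n ω ^ 2 ∂P ≤
      ∑ i ∈ Finset.range n, covConst hurst lam * σ i ^ 2 * ℓ (e i) ^ 2 := fun n => by
    have e1 : ∀ ω, Y n ω ^ 2 = ∑ i ∈ Finset.range n, ∑ j ∈ Finset.range n,
        ℓ (e i) * ℓ (e j) * (inner ℝ (e i) (w t ω) * inner ℝ (e j) (w t ω)) := fun ω => by
      rw [sq, hY]
      simp only
      rw [Finset.sum_mul_sum]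
      exact Finset.sum_congr rfl fun i _ => Finset.sum_congr rfl fun j _ => by ring
    simp_rw [e1]
    rw [integral_finsetSum _ fun i _ => integrable_finsetSum _ fun j _ => (hint i j).const_mul _]
    refine Finset.sum_le_sum fun i hi => ?_
    rw [integral_finsetSum _ fun j _ => (hint i j).const_mul _, Finset.sum_eq_single_of_mem i hi]
    · rw [integral_const_mul, integral_mode_mul_mode hC hW hw hh hh1 ht ht]
      have h1 := (le_abs_self _).trans (hC.abs_cov_le hh hh1 (s := t) ht i)
      have h2 : 0 ≤ ℓ (e i) ^ 2 * σ i ^ 2 := by positivity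
      nlinarith [mul_le_mul_of_nonneg_left h1 h2]
    · intro j _ hj
      rw [integral_const_mul, integral_mode_mul_mode_of_ne hC hW hindep hw hh hh1 ht ht hj.symm,
        mul_zero]
  have hbound : ∀ n, ∫⁻ ω, ‖Y n ω‖ₑ ^ 4 ∂P ≤
      3 * (∑' i, gaussWeight hurst σ lam i * ‖ℓ (e i)‖ₑ ^ 2) ^ 2 := fun n => by
    simp_rw [enorm_pow_four]
    rw [← ofReal_integral_eq_lintegral_ofReal ((hspan n).integrable_pow_four hV)
      (.of_forall fun ω => by positivity), (hspan n).integral_pow_four hV,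
      ENNReal.ofReal_mul (by norm_num), ENNReal.ofReal_ofNat,
      ENNReal.ofReal_pow (integral_nonneg fun ω => sq_nonneg _)]
    gcongr
    exact (ENNReal.ofReal_le_ofReal (hvar n)).trans (ofReal_sum_gaussWeight hC _ n)
  have hlim : ∀ᵐ ω ∂P, Tendsto (fun n => Y n ω) atTop (𝓝 (ℓ (w t ω))) := by
    filter_upwards [ae_modes hC hW hw hh] with ω hω
    have h := ((hω.2 t ht).1.mapL ℓ).tendsto_sum_nat
    refine h.congr fun n => Finset.sum_congr rfl fun i _ => ?_
    rw [map_smul, smul_eq_mul, mul_comm]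
  calc ∫⁻ ω, ‖ℓ (w t ω)‖ₑ ^ 4 ∂P = ∫⁻ ω, liminf (fun n => ‖Y n ω‖ₑ ^ 4) atTop ∂P := by
        refine lintegral_congr_ae ?_
        filter_upwards [hlim] with ω hω
        have h := ((ENNReal.continuous_pow 4).tendsto _).comp hω.enorm
        exact h.liminf_eq.symm
    _ ≤ liminf (fun n => ∫⁻ ω, ‖Y n ω‖ₑ ^ 4 ∂P) atTop :=
        lintegral_liminf_le' fun n => ((hspan n).1.1.enorm.pow_const 4)
    _ ≤ _ := liminf_le_of_frequently_le' (.of_forall hbound)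

end OrnsteinUhlenbeck

/-! ### The stationary measure -/

lemma isSeparable_of_countablyGenerated {X : Type*} [MeasurableSpace X]
    [MeasurableSpace.CountablyGenerated X] (μ : Measure X) [SFinite μ] :
    MeasureTheory.IsSeparable μ := inferInstance

/-- Separability makes the identity of `H` strongly measurable, as needed for integrals against `μ`.
-/
instance (d : ℕ) : SecondCountableTopology (L2Field d) := by
  have : Fact ((2 : ℝ≥0∞) ≠ ∞) := ⟨by simp⟩
  have h : MeasurableSpace.CountablyGenerated (Fin d → UnitAddCircle) := inferInstance
  have : MeasureTheory.IsSeparable (torusMeasure d) :=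
    @isSeparable_of_countablyGenerated _ _ h _ inferInstance
  exact Lp.SecondCountableTopology

instance (d : ℕ) : SecondCountableTopology (H d) :=
  TopologicalSpace.Subtype.secondCountableTopology _

section Stationary

variable {d : ℕ} {ξ hurst : ℝ} {e : ℕ → H d} {σ lam : ℕ → ℝ} {C : H d →ₗ.[ℝ] H d}
  {R : H d →L[ℝ] H d} {μ : Measure (H d)}

/-- This is the form in which the limiting variance appears in `tendsto_ouCov_self`. -/
lemma qBar_eq (hC : SmallScale d ξ e σ lam C R) (i : ℕ) :
    qBar hurst σ lam i =
      σ i ^ 2 * ((-lam i) ^ (-(2 * hurst)) * expMoment (2 * hurst) / 2) := by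
  rw [qBar, abs_of_neg (hC.lam_neg i), Real.rpow_neg (neg_pos.2 (hC.lam_neg i)).le, expMoment]
  ring

lemma qBar_nonneg (hC : SmallScale d ξ e σ lam C R) (i : ℕ) : 0 ≤ qBar hurst σ lam i := by
  rw [qBar_eq hC]
  have := expMoment_nonneg (2 * hurst)
  have := Real.rpow_nonneg (neg_pos.2 (hC.lam_neg i)).le (-(2 * hurst))
  positivity

lemma qBar_le (hC : SmallScale d ξ e σ lam C R) (hh : 0 < hurst) (i : ℕ) :
    qBar hurst σ lam i ≤ covConst hurst lam * σ i ^ 2 := by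
  rw [qBar_eq hC, mul_comm]
  refine mul_le_mul_of_nonneg_right ?_ (sq_nonneg _)
  have h1 := hC.rpow_lam_le hh i
  have h2 := covConst_nonneg hC (hurst := hurst)
  linarith

lemma summable_qBar (hC : SmallScale d ξ e σ lam C R) (hh : 0 < hurst) :
    Summable (qBar hurst σ lam) :=
  .of_nonneg_of_le (qBar_nonneg hC) (qBar_le hC hh) (hC.summable_sq.mul_left _)

/-- By Riesz representation the variance of a functional is a quadratic form of `Q̄`, whose
eigenvalues are below the weights used for the process. Sharing the weights lets one truncation
estimate serve both. -/
lemma gaussBound_stationary (hC : SmallScale d ξ e σ lam C R) (hh : 0 < hurst)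
    (hμ : IsCenteredGaussian (diagOp (qBar hurst σ lam) e) μ) :
    GaussBound μ e (gaussWeight hurst σ lam) fun r => r := by
  intro ℓ
  have := hμ.gaussian
  obtain ⟨h, hh'⟩ : ∃ h : H d, ∀ r, ℓ r = inner ℝ h r :=
    ⟨(InnerProductSpace.toDual ℝ (H d)).symm ℓ, fun r =>
      (InnerProductSpace.toDual_symm_apply (𝕜 := ℝ) (x := r) (y := ℓ)).symm⟩
  have hmean : ∫ r, ℓ r ∂μ = 0 := by simp_rw [hh', hμ.mean]
  have hm : AEMeasurable (fun r => ℓ r) μ := ℓ.continuous.measurable.aemeasurable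
  have hmap := IsGaussian.map_eq_gaussianReal (μ := μ) ℓ
  rw [hmean, variance_of_integral_eq_zero hm hmean] at hmap
  have h4 := integral_pow_four_of_map_eq (X := fun r => ℓ r) hm hmap
  have hvar : ∫ r, ℓ r ^ 2 ∂μ = inner ℝ (diagOp (qBar hurst σ lam) e h) h := by
    rw [← hμ.cov]
    exact integral_congr_ae (.of_forall fun r => by simp only [hh']; ring)
  rw [Real.coe_toNNReal _ (integral_nonneg fun r => sq_nonneg _)] at h4
  have hi : Integrable (fun r => ℓ r ^ 4) μ := by
    have h := (memLp_of_map_eq (X := fun r => ℓ r) hm hmap 4).integrable_norm_pow (by norm_num)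
    refine h.congr (.of_forall fun ω => ?_)
    simp only [Real.norm_eq_abs]
    exact (by decide : Even 4).pow_abs _
  simp_rw [enorm_pow_four]
  rw [← ofReal_integral_eq_lintegral_ofReal hi (.of_forall fun ω => by positivity), h4,
    ENNReal.ofReal_mul (by norm_num), ENNReal.ofReal_ofNat,
    ENNReal.ofReal_pow (integral_nonneg fun ω => sq_nonneg _)]
  gcongr
  have hsum := inner_diagOp hC.orthonormal (summable_qBar hC hh) h h
  rw [hvar, ← hsum.tsum_eq, ENNReal.ofReal_tsum_of_nonneg
    (fun i => mul_nonneg (qBar_nonneg hC i) (mul_self_nonneg _)) hsum.summable]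
  refine ENNReal.tsum_le_tsum fun i => ?_
  rw [ENNReal.ofReal_mul (qBar_nonneg hC i), gaussWeight]
  refine mul_le_mul' (ENNReal.ofReal_le_ofReal (qBar_le hC hh i)) (le_of_eq ?_)
  rw [Real.enorm_eq_ofReal_abs, ← ENNReal.ofReal_pow (abs_nonneg _), sq_abs, hh', real_inner_comm, sq]

lemma integral_inner_mul_inner (hC : SmallScale d ξ e σ lam C R) (hh : 0 < hurst)
    (hμ : IsCenteredGaussian (diagOp (qBar hurst σ lam) e) μ) (i j : ℕ) :
    ∫ r, inner ℝ (e i) r * inner ℝ (e j) r ∂μ = if i = j then qBar hurst σ lam i else 0 := by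
  rw [hμ.cov, real_inner_comm, inner_diagOp_self hC.orthonormal (summable_qBar hC hh),
    orthonormal_iff_ite.1 hC.orthonormal]
  split_ifs with h1 h2 h2
  · rw [h1, mul_one]
  · exact absurd h1.symm h2
  · exact absurd h2.symm h1
  · rw [mul_zero]

end Stationary

/-! ### Truncations -/

section Truncation

variable {d : ℕ} {e : ℕ → H d}

/-- The orthogonal projection onto the span of `e 0, …, e (n - 1)`. -/
def trunc (e : ℕ → H d) (n : ℕ) : H d →L[ℝ] H d :=
  ∑ i ∈ Finset.range n, (innerSL ℝ (e i)).smulRight (e i)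

lemma trunc_apply (n : ℕ) (x : H d) :
    trunc e n x = ∑ i ∈ Finset.range n, inner ℝ (e i) x • e i := by
  simp [trunc]

lemma trunc_basis (he : Orthonormal ℝ e) (n i : ℕ) :
    trunc e n (e i) = if i < n then e i else 0 := by
  rw [trunc_apply]
  simp_rw [orthonormal_iff_ite.1 he, ite_smul, one_smul, zero_smul]
  simp

variable {Ω : Type*} [MeasurableSpace Ω] {P : Measure Ω} {v v' : ℕ → ℝ≥0∞} {X : Ω → H d}

namespace GaussBound

lemma trunc (h : GaussBound P e v X) (he : Orthonormal ℝ e) (n : ℕ) :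
    GaussBound P e v fun ω => trunc e n (X ω) := fun ℓ => by
  refine (h (ℓ ∘L ItoStokes.trunc e n)).trans ?_
  gcongr with i
  rw [ContinuousLinearMap.comp_apply, trunc_basis he]
  split_ifs <;> simp

/-- Apply the bound to the functional composed with the complementary projection, which kills the
first `n` modes; only the tail of the weights is left. -/
lemma sub_trunc (h : GaussBound P e v X) (he : Orthonormal ℝ e) (n : ℕ) :
    GaussBound P e (fun i => if i < n then 0 else v i) fun ω => X ω - ItoStokes.trunc e n (X ω) :=
  fun ℓ => by
  refine (h (ℓ ∘L (ContinuousLinearMap.id ℝ (H d) - ItoStokes.trunc e n))).trans ?_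
  refine mul_le_mul_right (pow_le_pow_left₀ zero_le (ENNReal.tsum_le_tsum fun i => ?_) 2) _
  rw [ContinuousLinearMap.comp_apply, sub_apply, trunc_basis he,
    ContinuousLinearMap.id_apply]
  by_cases hi : i < n <;> simp [hi]

variable {ξ : ℝ} {K : ℝ≥0}

lemma lintegral_wienerNorm_pow_four_le (h : GaussBound P e v X) (hX : AEStronglyMeasurable X P)
    (hK : ∀ u : H d, wienerNorm u ^ 2 ≤ K * sobolevNormSq ξ u) :
    ∫⁻ ω, (wienerNorm (X ω) ^ 2) ^ 2 ∂P ≤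
      (3 * K ^ 2) * (∑' i, v i * sobolevNormSq ξ (e i)) ^ 2 := by
  calc _ ≤ ∫⁻ ω, K ^ 2 * sobolevNormSq ξ (X ω) ^ 2 ∂P :=
        lintegral_mono fun ω => by
          rw [← mul_pow]
          exact pow_le_pow_left₀ zero_le (hK _) 2
    _ ≤ K ^ 2 * (3 * (∑' i, v i * sobolevNormSq ξ (e i)) ^ 2) := by
        rw [lintegral_const_mul' _ _ (by simp)]
        exact mul_le_mul_right (h.lintegral_sobolevNormSq_sq_le hX ξ) _
    _ = _ := by ring

/-- Cauchy–Schwarz between two fourth moments. Only one factor has to be small, which suits a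
truncation error paired with a bounded field. -/
lemma lintegral_wienerNorm_mul_le {Y : Ω → H d} (h : GaussBound P e v X)
    (hX : AEStronglyMeasurable X P) (h' : GaussBound P e v' Y) (hY : AEStronglyMeasurable Y P)
    (hK : ∀ u : H d, wienerNorm u ^ 2 ≤ K * sobolevNormSq ξ u) :
    ∫⁻ ω, (wienerNorm (X ω) * wienerNorm (Y ω)) ^ 2 ∂P ≤ (3 * K ^ 2) *
      ((∑' i, v i * sobolevNormSq ξ (e i)) * ∑' i, v' i * sobolevNormSq ξ (e i)) := by
  have h1 := lintegral_mul_sq_le ((aemeasurable_wienerNorm hX).pow_const 2)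
    ((aemeasurable_wienerNorm hY).pow_const 2)
  have h2 := h1.trans (mul_le_mul' (h.lintegral_wienerNorm_pow_four_le hX hK)
    (h'.lintegral_wienerNorm_pow_four_le hY hK))
  have e1 : ∀ a b c : ℝ≥0∞, c * a ^ 2 * (c * b ^ 2) = (c * (a * b)) ^ 2 := fun a b c => by ring
  rw [e1] at h2
  simp_rw [← mul_pow _ _ 2] at h2
  exact (ENNReal.pow_le_pow_left_iff two_ne_zero).1 h2

end GaussBound

lemma tendsto_tsum_tail {f : ℕ → ℝ≥0∞} (hf : ∑' i, f i ≠ ∞) :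
    Tendsto (fun n => ∑' i, if i < n then 0 else f i) atTop (𝓝 0) := by
  refine (ENNReal.tendsto_sum_nat_add f hf).congr fun n => ?_
  have h := Summable.sum_add_tsum_nat_add' (f := fun i => if i < n then 0 else f i) (k := n)
    ENNReal.summable
  rw [← h, Finset.sum_eq_zero fun i hi => if_pos (Finset.mem_range.1 hi), zero_add]
  exact tsum_congr fun i => by simp

lemma trunc_mem (heW : ∀ i, e i ∈ wienerSpace d) (n : ℕ) (x : H d) :
    trunc e n x ∈ wienerSpace d := by
  rw [trunc_apply]
  exact Submodule.sum_mem _ fun i _ => Submodule.smul_mem _ _ (heW i)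

lemma nsB_trunc (heW : ∀ i, e i ∈ wienerSpace d) (n : ℕ) (x : H d) :
    nsB (trunc e n x) (trunc e n x) = ∑ i ∈ Finset.range n, ∑ j ∈ Finset.range n,
      (inner ℝ (e i) x * inner ℝ (e j) x) • nsB (e i) (e j) := by
  have h1 : (⟨trunc e n x, trunc_mem heW n x⟩ : wienerSpace d) =
      ∑ i ∈ Finset.range n, inner ℝ (e i) x • ⟨e i, heW i⟩ := by
    ext1
    simp [trunc_apply]
  change nsBilin d ⟨trunc e n x, trunc_mem heW n x⟩ ⟨trunc e n x, trunc_mem heW n x⟩ = _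
  rw [h1, map_sum, Finset.sum_comm]
  refine Finset.sum_congr rfl fun j _ => ?_
  rw [map_sum, LinearMap.sum_apply]
  refine Finset.sum_congr rfl fun i _ => ?_
  rw [map_smul, map_smul, LinearMap.smul_apply, smul_smul, mul_comm]
  rfl

/-- Bilinearity gives `b(u, u) - b(t, t) = b(u - t, u) + b(t, u - t)`; finite Wiener norms ensure
that no default value of `nsB` enters. -/
lemma enorm_nsB_sub_le {u t : H d} (hu : wienerNorm u ≠ ∞) (ht : wienerNorm t ≠ ∞) :
    ‖nsB u u - nsB t t‖ₑ ≤ d * (wienerNorm (u - t) * wienerNorm u) +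
      d * (wienerNorm t * wienerNorm (u - t)) := by
  have hsub : wienerNorm (u - t) ≠ ∞ := (wienerSpace d).sub_mem hu ht
  have h : nsB u u - nsB t t = nsB (u - t) u + nsB t (u - t) := by
    have h1 : nsBilin d ⟨u, hu⟩ ⟨u, hu⟩ - nsBilin d ⟨t, ht⟩ ⟨t, ht⟩ =
        nsBilin d (⟨u, hu⟩ - ⟨t, ht⟩) ⟨u, hu⟩ + nsBilin d ⟨t, ht⟩ (⟨u, hu⟩ - ⟨t, ht⟩) := by
      rw [map_sub, map_sub, LinearMap.sub_apply]
      abel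
    exact h1
  rw [h]
  exact (enorm_add_le _ _).trans (add_le_add (enorm_nsB_le hsub hu) (enorm_nsB_le ht hsub))

/-- The nonlinear functional `(-C)⁻¹ b(u, u)` evaluated at a truncation of `u`. -/
def truncDrift (R : H d →L[ℝ] H d) (e : ℕ → H d) (n : ℕ) (u : H d) : H d :=
  R (nsB (trunc e n u) (trunc e n u))

lemma truncDrift_eq (R : H d →L[ℝ] H d) (heW : ∀ i, e i ∈ wienerSpace d) (n : ℕ) (x : H d) :
    truncDrift R e n x = ∑ i ∈ Finset.range n, ∑ j ∈ Finset.range n,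
      (inner ℝ (e i) x * inner ℝ (e j) x) • R (nsB (e i) (e j)) := by
  simp only [truncDrift, nsB_trunc heW, map_sum, map_smul]

lemma continuous_truncDrift (R : H d →L[ℝ] H d) (heW : ∀ i, e i ∈ wienerSpace d) (n : ℕ) :
    Continuous (truncDrift R e n) := by
  have : truncDrift R e n = fun x => _ := funext (truncDrift_eq R heW n)
  rw [this]
  fun_prop

end Truncation

/-- The nonlinearity is defined by cases and choice, so its measurability is not evident. Along a
subsequence with errors below `2^(-k)` the squared errors are almost surely summable, which makes it
an almost everywhere limit of the approximants. -/
lemma aestronglyMeasurable_of_enorm_sub_le {Ω E : Type*} [MeasurableSpace Ω] {P : Measure Ω}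
    [NormedAddCommGroup E] {f : Ω → E} {g : ℕ → Ω → E} {D : ℕ → Ω → ℝ≥0∞} {δ : ℕ → ℝ≥0∞}
    (hg : ∀ n, AEStronglyMeasurable (g n) P) (hD : ∀ n, AEMeasurable (D n) P)
    (hfg : ∀ n, ∀ᵐ ω ∂P, ‖f ω - g n ω‖ₑ ≤ D n ω) (hδ : ∀ n, ∫⁻ ω, D n ω ^ 2 ∂P ≤ δ n)
    (hlim : Tendsto δ atTop (𝓝 0)) : AEStronglyMeasurable f P := by
  have h1 : ∀ k : ℕ, ∃ n, δ n ≤ (2⁻¹ : ℝ≥0∞) ^ k := fun k =>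
    ((hlim.eventually_le_const (by simp [pos_iff_ne_zero] : (0 : ℝ≥0∞) < 2⁻¹ ^ k))).exists
  choose φ hφ using h1
  have h2 : ∫⁻ ω, ∑' k, D (φ k) ω ^ 2 ∂P ≠ ∞ := by
    rw [lintegral_tsum fun k => (hD _).pow_const 2]
    refine ne_top_of_le_ne_top ?_ (ENNReal.tsum_le_tsum fun k => (hδ _).trans (hφ k))
    rw [ENNReal.tsum_geometric]
    simp
  refine aestronglyMeasurable_of_tendsto_ae atTop (fun k => hg (φ k)) ?_
  filter_upwards [ae_lt_top' (AEMeasurable.tsum fun k => (hD (φ k)).pow_const 2) h2,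
    ae_all_iff.2 fun k => hfg (φ k)] with ω h3 h4
  have h5 := ENNReal.tendsto_atTop_zero_of_tsum_ne_top h3.ne
  have h6 : Tendsto (fun k => ‖f ω - g (φ k) ω‖ₑ ^ 2) atTop (𝓝 0) :=
    tendsto_of_tendsto_of_tendsto_of_le_of_le tendsto_const_nhds h5 (fun k => zero_le)
      fun k => pow_le_pow_left₀ zero_le (h4 k) 2
  have h7 : Tendsto (fun k => ‖f ω - g (φ k) ω‖ ^ 2) atTop (𝓝 0) := by
    have h := (ENNReal.tendsto_toReal ENNReal.zero_ne_top).comp h6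
    simpa [Function.comp_def] using h
  have h8 : Tendsto (fun k => ‖f ω - g (φ k) ω‖) atTop (𝓝 0) := by
    have h := (Real.continuous_sqrt.tendsto _).comp h7
    simpa [Function.comp_def, Real.sqrt_sq (norm_nonneg _)] using h
  rw [tendsto_iff_norm_sub_tendsto_zero]
  simpa only [norm_sub_rev] using h8

lemma add_sq_le_four_mul (a b : ℝ≥0∞) : (a + b) ^ 2 ≤ 4 * (a ^ 2 + b ^ 2) := by
  rcases le_total a b with h | h
  · calc (a + b) ^ 2 ≤ (b + b) ^ 2 := by gcongr
      _ = 4 * b ^ 2 := by ring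
      _ ≤ _ := by gcongr; exact le_add_self
  · calc (a + b) ^ 2 ≤ (a + a) ^ 2 := by gcongr
      _ = 4 * a ^ 2 := by ring
      _ ≤ _ := by gcongr; exact le_self_add

/-- The error sequence is chosen before `X`, from the weights alone; this gives uniformity in time.
At `n = 0` the truncation vanishes, so the bound also yields square integrability. -/
lemma exists_truncation_error {d : ℕ} {ξ : ℝ} {e : ℕ → H d} {σ lam : ℕ → ℝ}
    {C : H d →ₗ.[ℝ] H d} {R : H d →L[ℝ] H d} (hC : SmallScale d ξ e σ lam C R) {v : ℕ → ℝ≥0∞}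
    (hv : ∑' i, v i * sobolevNormSq ξ (e i) < ∞) {Ω : Type*} [MeasurableSpace Ω] (P : Measure Ω) :
    (∀ i, e i ∈ wienerSpace d) ∧ ∃ δ : ℕ → ℝ≥0∞, (∀ n, δ n < ∞) ∧ Tendsto δ atTop (𝓝 0) ∧
      ∀ {X : Ω → H d}, AEStronglyMeasurable X P → GaussBound P e v X →
        AEStronglyMeasurable (fun ω => R (nsB (X ω) (X ω))) P ∧
        ∀ n, ∫⁻ ω, ‖R (nsB (X ω) (X ω)) - truncDrift R e n (X ω)‖ₑ ^ 2 ∂P ≤ δ n := by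
  obtain ⟨K, hK⟩ := exists_wienerNorm_sq_le d (ξ := ξ) (by linarith [hC.xi_gt])
  have heW : ∀ i, e i ∈ wienerSpace d := fun i => by
    change wienerNorm (e i) ≠ ∞
    have h := (hK (e i)).trans_lt (ENNReal.mul_lt_top ENNReal.coe_lt_top (hC.mem_sobolev i))
    exact fun h' => by simp [h'] at h
  refine ⟨heW, ?_⟩
  set S : ℝ≥0∞ := ∑' i, v i * sobolevNormSq ξ (e i) with hS
  set tail : ℕ → ℝ≥0∞ := fun n => ∑' i, (if i < n then 0 else v i) * sobolevNormSq ξ (e i)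
    with htail
  have htail0 : Tendsto tail atTop (𝓝 0) := by
    refine (tendsto_tsum_tail hv.ne).congr fun n => tsum_congr fun i => ?_
    split_ifs <;> simp
  -- The factor `4` comes from squaring a sum of two terms, `d²` from the bound on `b`, and `3 K²`
  -- from the Gaussian fourth moments. Each term pairs one tail with the full trace `S`.
  set δ : ℕ → ℝ≥0∞ := fun n => ‖R‖ₑ ^ 2 * (4 * ((d : ℝ≥0∞) ^ 2 * (3 * K ^ 2 * (tail n * S)) +
    (d : ℝ≥0∞) ^ 2 * (3 * K ^ 2 * (S * tail n)))) with hδ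
  have hδ0 : Tendsto δ atTop (𝓝 0) := by
    have e1 : δ = fun n => (‖R‖ₑ ^ 2 * (4 * (2 * ((d : ℝ≥0∞) ^ 2 * (3 * K ^ 2 * S))))) * tail n := by
      funext n
      simp only [hδ]
      ring
    rw [e1]
    have h := ENNReal.Tendsto.const_mul
      (a := ‖R‖ₑ ^ 2 * (4 * (2 * ((d : ℝ≥0∞) ^ 2 * (3 * K ^ 2 * S))))) htail0 (.inr ?_)
    · simpa using h
    · have : S ≠ ∞ := hv.ne
      finiteness
  have hδt : ∀ n, δ n < ∞ := fun n => by
    have h1 : tail n ≠ ∞ := ne_top_of_le_ne_top hv.ne <| ENNReal.tsum_le_tsum fun i => by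
      split_ifs <;> simp
    have h2 : S ≠ ∞ := hv.ne
    simp only [hδ]
    finiteness
  refine ⟨δ, hδt, hδ0, fun {X} hX hG => ?_⟩
  have htX : ∀ n, AEStronglyMeasurable (fun ω => trunc e n (X ω)) P := fun n =>
    (trunc e n).continuous.comp_aestronglyMeasurable hX
  set D : ℕ → Ω → ℝ≥0∞ := fun n ω => ‖R‖ₑ *
    (d * (wienerNorm (X ω - trunc e n (X ω)) * wienerNorm (X ω)) +
      d * (wienerNorm (trunc e n (X ω)) * wienerNorm (X ω - trunc e n (X ω)))) with hD
  have hm1 : AEMeasurable (fun ω => wienerNorm (X ω)) P := aemeasurable_wienerNorm hX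
  have hm2 : ∀ n, AEMeasurable (fun ω => wienerNorm (trunc e n (X ω))) P := fun n =>
    aemeasurable_wienerNorm (htX n)
  have hm3 : ∀ n, AEMeasurable (fun ω => wienerNorm (X ω - trunc e n (X ω))) P := fun n =>
    aemeasurable_wienerNorm (hX.sub (htX n))
  have hm4 : ∀ n, AEMeasurable (fun ω => (d : ℝ≥0∞) ^ 2 *
      (wienerNorm (X ω - trunc e n (X ω)) * wienerNorm (X ω)) ^ 2) P := fun n =>
    (((hm3 n).mul hm1).pow_const 2).const_mul _
  have hDm : ∀ n, AEMeasurable (D n) P := fun n =>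
    ((((hm3 n).mul hm1).const_mul _).add (((hm2 n).mul (hm3 n)).const_mul _)).const_mul _
  -- The moment bound makes the Wiener norm almost surely finite, which puts the sample in the space
  -- where `b` is bilinear.
  have hfin : ∀ᵐ ω ∂P, wienerNorm (X ω) ≠ ∞ := by
    have h1 := (hG.lintegral_wienerNorm_pow_four_le hX hK).trans_lt
      (show (3 * (K : ℝ≥0∞) ^ 2) * S ^ 2 < ∞ by have : S ≠ ∞ := hv.ne; finiteness)
    filter_upwards [ae_lt_top' ((hm1.pow_const 2).pow_const 2) h1.ne] with ω hω h'
    simp [h'] at hω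
  have hle : ∀ n, ∀ᵐ ω ∂P, ‖R (nsB (X ω) (X ω)) - truncDrift R e n (X ω)‖ₑ ≤ D n ω := fun n => by
    filter_upwards [hfin] with ω hω
    rw [truncDrift, ← map_sub]
    exact (R.le_opENorm _).trans (mul_le_mul_right (enorm_nsB_sub_le hω (trunc_mem heW n _)) _)
  have hDδ : ∀ n, ∫⁻ ω, D n ω ^ 2 ∂P ≤ δ n := fun n => by
    have b1 := (hG.sub_trunc hC.orthonormal n).lintegral_wienerNorm_mul_le (hX.sub (htX n)) hG hX hK
    have b2 := (hG.trunc hC.orthonormal n).lintegral_wienerNorm_mul_le (htX n)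
      (hG.sub_trunc hC.orthonormal n) (hX.sub (htX n)) hK
    calc ∫⁻ ω, D n ω ^ 2 ∂P ≤ ∫⁻ ω, ‖R‖ₑ ^ 2 * (4 *
          ((d : ℝ≥0∞) ^ 2 * (wienerNorm (X ω - trunc e n (X ω)) * wienerNorm (X ω)) ^ 2 +
          (d : ℝ≥0∞) ^ 2 *
            (wienerNorm (trunc e n (X ω)) * wienerNorm (X ω - trunc e n (X ω))) ^ 2)) ∂P := by
          refine lintegral_mono fun ω => ?_
          simp only [hD]
          rw [mul_pow ‖R‖ₑ]
          refine mul_le_mul_right ((add_sq_le_four_mul _ _).trans (le_of_eq ?_)) _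
          rw [mul_pow (d : ℝ≥0∞), mul_pow (d : ℝ≥0∞)]
      _ ≤ δ n := by
          rw [lintegral_const_mul' _ _ (by finiteness), lintegral_const_mul' _ _ (by finiteness),
            lintegral_add_left' (hm4 n),
            lintegral_const_mul' _ _ (by finiteness), lintegral_const_mul' _ _ (by finiteness)]
          simp only [hδ]
          gcongr
  refine ⟨aestronglyMeasurable_of_enorm_sub_le
    (fun n => (continuous_truncDrift R heW n).comp_aestronglyMeasurable hX) hDm hle hDδ hδ0,
    fun n => (lintegral_mono_ae ?_).trans (hDδ n)⟩
  filter_upwards [hle n] with ω hω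
  exact pow_le_pow_left₀ zero_le hω 2

/-! ### Time averages of products of Gaussian processes -/

/-- The uniform distribution on `(0, 1]`. -/
def unifLaw : Measure ℝ := volume.restrict (Set.Ioc 0 1)

instance : IsProbabilityMeasure unifLaw := ⟨by simp [unifLaw]⟩

instance : NullSingletonClass unifLaw := by unfold unifLaw; infer_instance

lemma ae_unifLaw_pos : ∀ᵐ a ∂unifLaw, 0 < a :=
  (ae_restrict_mem measurableSet_Ioc).mono fun _ ha => ha.1

section Ergodic

variable {Ω : Type*} [MeasurableSpace Ω] {P : Measure Ω} [IsProbabilityMeasure P]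
  {A : Type*} {V : A → Ω → ℝ} {x y : ℝ → Ω → ℝ} {M m : ℝ}

/-- A mean ergodic theorem for products of two Gaussian processes with decaying correlations. -/
lemma tendsto_lintegral_average_mul (hV : IsCenteredGaussFamily V P)
    (hx : ∀ s, GaussSpan V P (x s)) (hy : ∀ s, GaussSpan V P (y s))
    (hxc : ∀ᵐ ω ∂P, Continuous fun s => x s ω) (hyc : ∀ᵐ ω ∂P, Continuous fun s => y s ω)
    (hxx : ∀ s t, |∫ ω, x s ω * x t ω ∂P| ≤ M) (hyy : ∀ s t, |∫ ω, y s ω * y t ω ∂P| ≤ M)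
    (hxy : ∀ s t, |∫ ω, x s ω * y t ω ∂P| ≤ M)
    (hxx0 : ∀ a b, 0 < a → 0 < b → a ≠ b →
      Tendsto (fun T : ℝ => ∫ ω, x (T * a) ω * x (T * b) ω ∂P) atTop (𝓝 0))
    (hxy0 : ∀ a b, 0 < a → 0 < b → a ≠ b →
      Tendsto (fun T : ℝ => ∫ ω, x (T * a) ω * y (T * b) ω ∂P) atTop (𝓝 0))
    (hlim : ∀ a, 0 < a → Tendsto (fun T : ℝ => ∫ ω, x (T * a) ω * y (T * a) ω ∂P) atTop (𝓝 m)) :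
    Tendsto (fun T : ℝ => ∫⁻ ω, ‖∫ a, (x (T * a) ω * y (T * a) ω - m) ∂unifLaw‖ₑ ^ 2 ∂P)
      atTop (𝓝 0) := by
  have hM : 0 ≤ M := (abs_nonneg _).trans (hxx 0 0)
  set g : ℝ → ℝ × Ω → ℝ := fun T z => x (T * z.1) z.2 * y (T * z.1) z.2 - m with hg
  have hf : ∀ s, MemLp (fun ω => x s ω * y s ω) 2 P := fun s => (hx s).memLp_mul hV (hy s)
  have hgL : ∀ T a, MemLp (fun ω => g T (a, ω)) 2 P := fun T a => (hf (T * a)).sub (memLp_const m)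
  -- Three Isserlis products, two cross terms with the centering and `m²`; this constant dominates
  -- every covariance of `g`.
  set B : ℝ := 3 * M ^ 2 + 2 * |m| * M + m ^ 2 with hB
  have hcov : ∀ T a b, ∫ ω, g T (a, ω) * g T (b, ω) ∂P =
      ((∫ ω, x (T * a) ω * y (T * a) ω ∂P) * (∫ ω, x (T * b) ω * y (T * b) ω ∂P) +
      (∫ ω, x (T * a) ω * x (T * b) ω ∂P) * (∫ ω, y (T * a) ω * y (T * b) ω ∂P) +
      (∫ ω, x (T * a) ω * y (T * b) ω ∂P) * (∫ ω, y (T * a) ω * x (T * b) ω ∂P))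
      - m * (∫ ω, x (T * a) ω * y (T * a) ω ∂P) - m * (∫ ω, x (T * b) ω * y (T * b) ω ∂P)
      + m ^ 2 := fun T a b => by
    rw [← GaussSpan.integral_mul_mul_mul hV (hx _) (hy _) (hx _) (hy _)]
    have i1 : Integrable (fun ω => x (T * a) ω * y (T * a) ω * (x (T * b) ω * y (T * b) ω)) P :=
      (hf _).integrable_mul (hf _)
    have i2 : Integrable (fun ω => m * (x (T * a) ω * y (T * a) ω)) P :=
      ((hf (T * a)).integrable one_le_two).const_mul m
    have i3 : Integrable (fun ω => m * (x (T * b) ω * y (T * b) ω)) P :=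
      ((hf (T * b)).integrable one_le_two).const_mul m
    have i4 : Integrable (fun _ : Ω => m ^ 2) P := integrable_const _
    have e1 : ∫ _ : Ω, m ^ 2 ∂P = m ^ 2 := by simp
    rw [← integral_const_mul, ← integral_const_mul, ← integral_sub' i1 i2,
      ← integral_sub' (i1.sub i2) i3, ← e1, ← integral_add' ((i1.sub i2).sub i3) i4]
    refine integral_congr_ae (.of_forall fun ω => ?_)
    simp only [hg, Pi.add_apply, Pi.sub_apply]
    ring
  have hyx : ∀ s t, ∫ ω, y s ω * x t ω ∂P = ∫ ω, x t ω * y s ω ∂P := fun s t =>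
    integral_congr_ae (.of_forall fun ω => mul_comm _ _)
  have hbound : ∀ T a b, |∫ ω, g T (a, ω) * g T (b, ω) ∂P| ≤ B := fun T a b => by
    rw [hcov, hyx]
    have pb : ∀ {p q : ℝ}, |p| ≤ M → |q| ≤ M → |p * q| ≤ M ^ 2 := fun hp hq => by
      rw [abs_mul, sq]; exact mul_le_mul hp hq (abs_nonneg _) hM
    have h1 := abs_le.1 (pb (hxy (T * a) (T * a)) (hxy (T * b) (T * b)))
    have h2 := abs_le.1 (pb (hxx (T * a) (T * b)) (hyy (T * a) (T * b)))
    have h3 := abs_le.1 (pb (hxy (T * a) (T * b)) (hxy (T * b) (T * a)))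
    have mb : ∀ {p : ℝ}, |p| ≤ M → |m * p| ≤ |m| * M := fun hp => by
      rw [abs_mul]; exact mul_le_mul_of_nonneg_left hp (abs_nonneg _)
    have h4 := abs_le.1 (mb (hxy (T * a) (T * a)))
    have h5 := abs_le.1 (mb (hxy (T * b) (T * b)))
    have h6 := sq_nonneg m
    rw [abs_le]
    constructor <;> linarith [h1.1, h1.2, h2.1, h2.2, h3.1, h3.2, h4.1, h4.2, h5.1, h5.2]
  have hgm : ∀ T, AEStronglyMeasurable (g T) (unifLaw.prod P) := fun T => by
    refine aestronglyMeasurable_uncurry_of_continuous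
      (X := fun a ω => x (T * a) ω * y (T * a) ω - m) (fun a => (hgL T a).1) ?_ unifLaw
    filter_upwards [hxc, hyc] with ω h1 h2
    exact ((h1.comp (continuous_const_mul T)).mul (h2.comp (continuous_const_mul T))).sub
      continuous_const
  have hgL2 : ∀ T, MemLp (g T) 2 (unifLaw.prod P) := fun T => by
    refine ⟨hgm T, (eLpNorm_two_lt_top_iff _).2 ?_⟩
    rw [lintegral_prod _ ((hgm T).enorm.pow_const 2)]
    have h1 : ∀ a, ∫⁻ ω, ‖g T (a, ω)‖ₑ ^ 2 ∂P ≤ ENNReal.ofReal B := fun a => by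
      have h2 : ∫⁻ ω, ‖g T (a, ω)‖ₑ ^ 2 ∂P = ENNReal.ofReal (∫ ω, g T (a, ω) * g T (a, ω) ∂P) := by
        have hi : Integrable (fun ω => g T (a, ω) * g T (a, ω)) P :=
          (hgL T a).integrable_mul (hgL T a)
        rw [ofReal_integral_eq_lintegral_ofReal hi (.of_forall fun ω => mul_self_nonneg _)]
        refine lintegral_congr fun ω => ?_
        rw [Real.enorm_eq_ofReal_abs, ← ENNReal.ofReal_pow (abs_nonneg _), sq_abs, sq]
      rw [h2]
      exact ENNReal.ofReal_le_ofReal ((le_abs_self _).trans (hbound T a a))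
    refine (lintegral_mono h1).trans_lt ?_
    simp
  -- Off the diagonal only the product of the two means survives in Isserlis' formula, and `m² - m²
  -- - m² + m² = 0`. In the second pairing decay of the `x` factor suffices, as the `y` factor is
  -- bounded.
  have hpt : ∀ a b, 0 < a → 0 < b → a ≠ b →
      Tendsto (fun T => ∫ ω, g T (a, ω) * g T (b, ω) ∂P) atTop (𝓝 0) := fun a b ha hb hab => by
    simp_rw [hcov, hyx]
    have t2 : Tendsto (fun T : ℝ => (∫ ω, x (T * a) ω * x (T * b) ω ∂P) *
        ∫ ω, y (T * a) ω * y (T * b) ω ∂P) atTop (𝓝 0) :=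
      (hxx0 a b ha hb hab).zero_mul_isBoundedUnder_le
        (isBoundedUnder_of ⟨M, fun T => hyy _ _⟩)
    have t3 := (hxy0 a b ha hb hab).mul (hxy0 b a hb ha hab.symm)
    have t4 := (((((hlim a ha).mul (hlim b hb)).add t2).add t3).sub
      ((hlim a ha).const_mul m)).sub ((hlim b hb).const_mul m)
    have t5 := t4.add (tendsto_const_nhds (x := m ^ 2))
    refine t5.trans_eq ?_
    congr 1
    ring
  set Z : ℝ → Ω → ℝ := fun T ω => ∫ a, g T (a, ω) ∂unifLaw with hZ
  have hZL : ∀ T, MemLp (Z T) 2 P := fun T => memLp_integral (hgL2 T)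
  -- The diagonal, where the covariance need not decay, has measure zero in each section.
  have hae : ∀ {a : ℝ}, ∀ᵐ b ∂unifLaw, a ≠ b := fun {a} =>
    (measure_eq_zero_iff_ae_notMem.1 (measure_singleton (μ := unifLaw) a)).mono
      fun b hb h => hb h.symm
  have hin : ∀ T a, ∫ ω, Z T ω * g T (a, ω) ∂P = ∫ b, ∫ ω, g T (a, ω) * g T (b, ω) ∂P ∂unifLaw :=
    fun T a => by
    simp_rw [mul_comm (Z T _)]
    exact integral_mul_integral (hgL2 T) (hgL T a)
  have hmeas : ∀ T {Y : Ω → ℝ}, MemLp Y 2 P →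
      AEStronglyMeasurable (fun a => ∫ ω, Y ω * g T (a, ω) ∂P) unifLaw := fun T Y hY => by
    have h1 : AEStronglyMeasurable (fun z : ℝ × Ω => Y z.2 * g T z) (unifLaw.prod P) :=
      hY.1.comp_snd.mul (hgm T)
    exact h1.integral_prod_right'
  have hpt2 : ∀ a, 0 < a → Tendsto (fun T => ∫ ω, Z T ω * g T (a, ω) ∂P) atTop (𝓝 0) :=
    fun a ha => by
    simp_rw [hin]
    rw [← integral_zero ℝ ℝ (μ := unifLaw)]
    refine tendsto_integral_filter_of_dominated_convergence (fun _ => B)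
      (.of_forall fun T => hmeas T (hgL T a)) (.of_forall fun T => .of_forall fun b =>
        hbound T a b) (integrable_const _) ?_
    filter_upwards [ae_unifLaw_pos, hae (a := a)] with b hb hab
    exact hpt a b ha hb hab
  -- The second moment of the average is a double integral of covariances. Dominated convergence is
  -- applied first in `b` (`hpt2`) and now in `a`.
  have hfinal : Tendsto (fun T => ∫ ω, Z T ω * Z T ω ∂P) atTop (𝓝 0) := by
    have h1 : ∀ T, ∫ ω, Z T ω * Z T ω ∂P = ∫ a, ∫ ω, Z T ω * g T (a, ω) ∂P ∂unifLaw := fun T =>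
      integral_mul_integral (hgL2 T) (hZL T)
    simp_rw [h1]
    rw [← integral_zero ℝ ℝ (μ := unifLaw)]
    refine tendsto_integral_filter_of_dominated_convergence (fun _ => B)
      (.of_forall fun T => hmeas T (hZL T)) (.of_forall fun T => .of_forall fun a => ?_)
        (integrable_const _) (ae_unifLaw_pos.mono hpt2)
    rw [hin]
    refine (norm_integral_le_of_norm_le_const (.of_forall fun b => hbound T a b)).trans ?_
    simp
  have h2 := (ENNReal.tendsto_ofReal hfinal)
  rw [ENNReal.ofReal_zero] at h2
  refine h2.congr fun T => ?_
  have hi : Integrable (fun ω => Z T ω * Z T ω) P := (hZL T).integrable_mul (hZL T)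
  rw [ofReal_integral_eq_lintegral_ofReal hi (.of_forall fun ω => mul_self_nonneg _)]
  refine lintegral_congr fun ω => ?_
  change _ = ‖Z T ω‖ₑ ^ 2
  rw [Real.enorm_eq_ofReal_abs, ← ENNReal.ofReal_pow (abs_nonneg _), sq_abs, sq]

end Ergodic

/-! ### The ergodic theorem for products of two modes. -/

section Modes

variable {d : ℕ} {ξ hurst : ℝ} {e : ℕ → H d} {σ lam : ℕ → ℝ} {C : H d →ₗ.[ℝ] H d}
  {R : H d →L[ℝ] H d} {Ω : Type*} [MeasurableSpace Ω] {P : Measure Ω} [IsProbabilityMeasure P]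
  {W : ℕ → ℝ → Ω → ℝ} {w : ℝ → Ω → H d}

/-- The covariance matrix of the stationary measure. -/
def qMat (hurst : ℝ) (σ lam : ℕ → ℝ) (i j : ℕ) : ℝ := if i = j then qBar hurst σ lam i else 0

/-- For `i = j` the mean converges by `tendsto_ouCov_self` and correlations decay by
`tendsto_ouCov_of_ne`; for `i ≠ j` independence makes the cross covariances zero. The cutoff `max ·
0` extends the process to all real times with continuous paths. -/
lemma tendsto_lintegral_average_modes (hC : SmallScale d ξ e σ lam C R)
    (hW : ∀ i, IsFBM hurst P (W i))
    (hindep : iIndepFun (fun i ω => fun t : ℝ≥0 => W i t ω) P)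
    (hw : IsFOU e σ C P W w) (hh : 0 < hurst) (hh1 : hurst ≤ 1 / 2) (i j : ℕ) :
    Tendsto (fun T : ℝ => ∫⁻ ω, ‖∫ a, (inner ℝ (e i) (w (max (T * a) 0) ω) *
      inner ℝ (e j) (w (max (T * a) 0) ω) - qMat hurst σ lam i j) ∂unifLaw‖ₑ ^ 2 ∂P)
      atTop (𝓝 0) := by
  have hV := isCenteredGaussFamily_noise hW hindep
  have hp : (0 : ℝ) < 2 * hurst := by linarith
  have hp1 : 2 * hurst ≤ 1 := by linarith
  have hcont : ∀ k, ∀ᵐ ω ∂P, Continuous fun s => inner ℝ (e k) (w (max s 0) ω) := fun k => by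
    filter_upwards [hw.continuous] with ω hω
    exact (innerSL ℝ (e k)).continuous.comp
      (hω.comp_continuous (f := fun s => max s 0) (by fun_prop)
        fun s => Set.mem_Ici.2 (le_max_right _ _))
  have hbd : ∀ k s t, |∫ ω, inner ℝ (e k) (w (max s 0) ω) * inner ℝ (e k) (w (max t 0) ω) ∂P| ≤
      covConst hurst lam * σ k ^ 2 := fun k s t => by
    rw [integral_mode_mul_mode hC hW hw hh hh1 (le_max_right _ _) (le_max_right _ _), abs_mul,
      abs_of_nonneg (sq_nonneg (σ k)), mul_comm]
    exact mul_le_mul_of_nonneg_right (hC.abs_cov_le hh hh1 (le_max_right _ _) k) (sq_nonneg _)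
  have hc0 := covConst_nonneg hC (hurst := hurst)
  have hcr : ∀ k, 0 ≤ covConst hurst lam * σ k ^ 2 := fun k => by positivity
  have hbd' : ∀ k k' : ℕ, covConst hurst lam * σ k ^ 2 ≤
      covConst hurst lam * σ k ^ 2 + covConst hurst lam * σ k' ^ 2 := fun k k' =>
    le_add_of_nonneg_right (hcr k')
  have hmax : ∀ {a : ℝ}, 0 < a → ∀ᶠ T : ℝ in atTop, max (T * a) 0 = T * a := fun {a} ha =>
    (eventually_ge_atTop 0).mono fun T hT => max_eq_left (mul_nonneg hT ha.le)
  have hdec : ∀ k a b, 0 < a → 0 < b → a ≠ b → Tendsto (fun T : ℝ => ∫ ω,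
      inner ℝ (e k) (w (max (T * a) 0) ω) * inner ℝ (e k) (w (max (T * b) 0) ω) ∂P)
      atTop (𝓝 0) := fun k a b ha hb hab => by
    have h := (tendsto_ouCov_of_ne hp hp1 (neg_pos.2 (hC.lam_neg k)) ha hb hab).const_mul (σ k ^ 2)
    rw [mul_zero] at h
    refine h.congr' ?_
    filter_upwards [hmax ha, hmax hb] with T h1 h2
    rw [integral_mode_mul_mode hC hW hw hh hh1 (le_max_right _ _) (le_max_right _ _), h1, h2]
  have hx : ∀ k s, GaussSpan (fun (a : ℕ × ℝ≥0) ω => W a.1 a.2 ω) P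
      fun ω => inner ℝ (e k) (w (max s 0) ω) := fun k s =>
    gaussSpan_mode hC hW hw hh hh1 (le_max_right _ _) k
  refine tendsto_lintegral_average_mul hV
    (x := fun s ω => inner ℝ (e i) (w (max s 0) ω)) (y := fun s ω => inner ℝ (e j) (w (max s 0) ω))
    (M := covConst hurst lam * σ i ^ 2 + covConst hurst lam * σ j ^ 2) (hx i) (hx j)
    (hcont i) (hcont j) (fun s t => (hbd i s t).trans (hbd' i j))
    (fun s t => (hbd j s t).trans ((hbd' j i).trans_eq (add_comm _ _))) (fun s t => ?_)
    (hdec i) (fun a b ha hb hab => ?_) fun a ha => ?_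
  · by_cases hij : i = j
    · subst hij
      exact (hbd i s t).trans (hbd' i i)
    · rw [integral_mode_mul_mode_of_ne hC hW hindep hw hh hh1 (le_max_right _ _)
        (le_max_right _ _) hij, abs_zero]
      exact add_nonneg (hcr i) (hcr j)
  · by_cases hij : i = j
    · subst hij
      exact hdec i a b ha hb hab
    · simp_rw [integral_mode_mul_mode_of_ne hC hW hindep hw hh hh1 (le_max_right _ _)
        (le_max_right _ _) hij]
      exact tendsto_const_nhds
  · by_cases hij : i = j
    · subst hij
      rw [qMat, if_pos rfl, qBar_eq hC]
      have h := ((tendsto_ouCov_self hp hp1 (neg_pos.2 (hC.lam_neg i))).comp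
        (tendsto_id.atTop_mul_const ha)).const_mul (σ i ^ 2)
      refine h.congr' ?_
      filter_upwards [hmax ha] with T h1
      rw [integral_mode_mul_mode hC hW hw hh hh1 (le_max_right _ _) (le_max_right _ _), h1]
      rfl
    · simp_rw [integral_mode_mul_mode_of_ne hC hW hindep hw hh hh1 (le_max_right _ _)
        (le_max_right _ _) hij]
      rw [qMat, if_neg hij]
      exact tendsto_const_nhds

end Modes

/-- The bound does not depend on `u`, so it survives averaging. A uniformly distributed rescaled
time can thus be treated as part of the probability space. -/
lemma GaussBound.uncurry {d : ℕ} {e : ℕ → H d} {v : ℕ → ℝ≥0∞} {Ω U : Type*} [MeasurableSpace Ω]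
    [MeasurableSpace U] {P : Measure Ω} [SFinite P] {ν : Measure U} [IsProbabilityMeasure ν]
    {X : U × Ω → H d} (hX : AEStronglyMeasurable X (ν.prod P))
    (h : ∀ u, GaussBound P e v fun ω => X (u, ω)) : GaussBound (ν.prod P) e v X := fun ℓ => by
  rw [lintegral_prod _ ((ℓ.continuous.comp_aestronglyMeasurable hX).enorm.pow_const 4)]
  refine (lintegral_mono fun u => h u ℓ).trans ?_
  simp

lemma truncDrift_zero {d : ℕ} {e : ℕ → H d} (R : H d →L[ℝ] H d) (heW : ∀ i, e i ∈ wienerSpace d)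
    (x : H d) : truncDrift R e 0 x = 0 := by
  rw [truncDrift_eq R heW, Finset.range_zero, Finset.sum_empty]

lemma timeAverage_eq {d : ℕ} {Ω : Type*} (R : H d →L[ℝ] H d) (w : ℝ → Ω → H d) {T : ℝ}
    (hT : 0 < T) (ω : Ω) : timeAverage R w T ω =
      ∫ a, R (nsB (w (max (T * a) 0) ω) (w (max (T * a) 0) ω)) ∂unifLaw := by
  have h := intervalIntegral.integral_comp_mul_left (fun s => R (nsB (w s ω) (w s ω))) hT.ne'
    (a := 0) (b := 1)
  rw [mul_zero, mul_one] at h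
  rw [timeAverage, ← h, intervalIntegral.integral_of_le zero_le_one, unifLaw]
  refine setIntegral_congr_fun measurableSet_Ioc fun a ha => ?_
  simp only [max_eq_left (mul_pos hT ha.1).le]

lemma tendsto_lintegral_sum_smul {Ω E ι : Type*} [MeasurableSpace Ω] {P : Measure Ω}
    [NormedAddCommGroup E] [NormedSpace ℝ E] (s : Finset ι) {c : ι → ℝ → Ω → ℝ} (v : ι → E)
    (hm : ∀ k T, AEStronglyMeasurable (c k T) P)
    (h : ∀ k, Tendsto (fun T => ∫⁻ ω, ‖c k T ω‖ₑ ^ 2 ∂P) atTop (𝓝 0)) :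
    Tendsto (fun T => ∫⁻ ω, ‖∑ k ∈ s, c k T ω • v k‖ₑ ^ 2 ∂P) atTop (𝓝 0) := by
  classical
  induction s using Finset.induction_on with
  | empty => simp
  | insert k s hk ih =>
    have h1 : Tendsto (fun T => 4 * (‖v k‖ₑ ^ 2 * ∫⁻ ω, ‖c k T ω‖ₑ ^ 2 ∂P +
        ∫⁻ ω, ‖∑ k ∈ s, c k T ω • v k‖ₑ ^ 2 ∂P)) atTop (𝓝 0) := by
      have t1 := ENNReal.Tendsto.const_mul (a := ‖v k‖ₑ ^ 2) (h k) (.inr (by finiteness))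
      have t2 := ENNReal.Tendsto.const_mul (a := 4) (t1.add ih) (.inr (by finiteness))
      simpa using t2
    refine tendsto_of_tendsto_of_tendsto_of_le_of_le tendsto_const_nhds h1 (fun _ => zero_le)
      fun T => ?_
    simp only
    have hm1 : AEMeasurable (fun ω => ‖v k‖ₑ ^ 2 * ‖c k T ω‖ₑ ^ 2) P :=
      ((hm k T).enorm.pow_const 2).const_mul _
    rw [← lintegral_const_mul' _ _ (by finiteness), ← lintegral_add_left' hm1,
      ← lintegral_const_mul' _ _ (by finiteness)]
    refine lintegral_mono fun ω => ?_
    simp only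
    rw [Finset.sum_insert hk]
    refine (pow_le_pow_left₀ zero_le (enorm_add_le _ _) 2).trans
      ((add_sq_le_four_mul _ _).trans (le_of_eq ?_))
    rw [enorm_smul, mul_pow, mul_comm (‖c k T ω‖ₑ ^ 2)]

/-! ### Processes in rescaled time. -/

section Rescaled

variable {Ω E : Type*} [MeasurableSpace Ω] {P : Measure Ω} [IsProbabilityMeasure P]
  [NormedAddCommGroup E] [NormedSpace ℝ E]

lemma continuous_rescaled {X : ℝ → E} (hX : ContinuousOn X (Set.Ici 0)) (T : ℝ) :
    Continuous fun a : ℝ => X (max (T * a) 0) :=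
  hX.comp_continuous (f := fun a => max (T * a) 0) (by fun_prop)
    fun _ => Set.mem_Ici.2 (le_max_right _ _)

lemma aestronglyMeasurable_rescaled {X : ℝ → Ω → E}
    (hX : ∀ t, 0 ≤ t → AEStronglyMeasurable (X t) P)
    (hc : ∀ᵐ ω ∂P, ContinuousOn (fun t => X t ω) (Set.Ici 0)) (T : ℝ) :
    AEStronglyMeasurable (fun z : ℝ × Ω => X (max (T * z.1) 0) z.2) (unifLaw.prod P) :=
  aestronglyMeasurable_uncurry_of_continuous (X := fun a ω => X (max (T * a) 0) ω)
    (fun _ => hX _ (le_max_right _ _)) (hc.mono fun _ h => continuous_rescaled h T) unifLaw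

lemma memLp_two_of_lintegral_sub_lt_top {α : Type*} [MeasurableSpace α] {m : Measure α}
    {f g : α → E} (hf : MemLp f 2 m) (hg : AEStronglyMeasurable g m)
    (h : ∫⁻ a, ‖f a - g a‖ₑ ^ 2 ∂m < ∞) : MemLp g 2 m := by
  have hsub : MemLp (fun a => f a - g a) 2 m := ⟨hf.1.sub hg, (eLpNorm_two_lt_top_iff _).2 h⟩
  refine (hf.sub hsub).congr_norm hg (.of_forall fun a => ?_)
  simp only [Pi.sub_apply, sub_sub_cancel]

end Rescaled

/-! ### Truncation errors, the ergodic limit and their combination. -/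

section Main

variable {d : ℕ} {ξ hurst : ℝ} {e : ℕ → H d} {σ lam : ℕ → ℝ} {C : H d →ₗ.[ℝ] H d}
  {R : H d →L[ℝ] H d} {Ω : Type*} [MeasurableSpace Ω] {P : Measure Ω} [IsProbabilityMeasure P]
  {W : ℕ → ℝ → Ω → ℝ} {w : ℝ → Ω → H d} {μ : Measure (H d)}

/-- The functional `(-C)⁻¹ b(w, w)` along the rescaled paths is square integrable, uniformly
approximated by its truncations. -/
lemma exists_error_process (hC : SmallScale d ξ e σ lam C R) (hW : ∀ i, IsFBM hurst P (W i))
    (hindep : iIndepFun (fun i ω => fun t : ℝ≥0 => W i t ω) P)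
    (hw : IsFOU e σ C P W w) (hh : 0 < hurst) (hh1 : hurst ≤ 1 / 2) :
    ∃ δ : ℕ → ℝ≥0∞, Tendsto δ atTop (𝓝 0) ∧ ∀ T : ℝ,
      MemLp (fun z : ℝ × Ω => R (nsB (w (max (T * z.1) 0) z.2) (w (max (T * z.1) 0) z.2))) 2
        (unifLaw.prod P) ∧
      ∀ n, MemLp (fun z : ℝ × Ω => truncDrift R e n (w (max (T * z.1) 0) z.2)) 2
          (unifLaw.prod P) ∧
        ∫⁻ z : ℝ × Ω, ‖R (nsB (w (max (T * z.1) 0) z.2) (w (max (T * z.1) 0) z.2)) -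
          truncDrift R e n (w (max (T * z.1) 0) z.2)‖ₑ ^ 2 ∂(unifLaw.prod P) ≤ δ n := by
  obtain ⟨heW, δ, hδt, hδ0, hδ⟩ := exists_truncation_error hC (gaussWeight_summable (hurst := hurst) hC)
    (unifLaw.prod P)
  refine ⟨δ, hδ0, fun T => ?_⟩
  have hX : AEStronglyMeasurable (fun z : ℝ × Ω => w (max (T * z.1) 0) z.2) (unifLaw.prod P) :=
    aestronglyMeasurable_rescaled hw.measurable hw.continuous T
  have hG : ∀ a : ℝ, GaussBound P e (gaussWeight hurst σ lam) (w (max (T * a) 0)) := fun a =>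
    gaussBound_process hC hW hindep hw hh hh1 (le_max_right _ _)
  obtain ⟨hm, hn⟩ := hδ hX (GaussBound.uncurry hX hG)
  have hF : MemLp (fun z : ℝ × Ω =>
      R (nsB (w (max (T * z.1) 0) z.2) (w (max (T * z.1) 0) z.2))) 2 (unifLaw.prod P) := by
    refine ⟨hm, (eLpNorm_two_lt_top_iff _).2 ?_⟩
    have h := (hn 0).trans_lt (hδt 0)
    simpa only [truncDrift_zero R heW, sub_zero] using h
  exact ⟨hF, fun n => ⟨memLp_two_of_lintegral_sub_lt_top hF
    ((continuous_truncDrift R heW n).comp_aestronglyMeasurable hX) ((hn n).trans_lt (hδt n)), hn n⟩⟩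

/-- The drift of the truncated functional. -/
def truncMean (hurst : ℝ) (σ lam : ℕ → ℝ) (R : H d →L[ℝ] H d) (e : ℕ → H d) (n : ℕ) : H d :=
  ∑ k ∈ Finset.range n ×ˢ Finset.range n, qMat hurst σ lam k.1 k.2 • R (nsB (e k.1) (e k.2))

/-- The covariance of `μ` identifies `truncMean` as the mean of the truncated functional; Jensen
then bounds the difference of means by the truncation error. -/
lemma exists_error_stationary (hC : SmallScale d ξ e σ lam C R) (hh : 0 < hurst)
    (hμ : IsCenteredGaussian (diagOp (qBar hurst σ lam) e) μ) :
    Integrable (fun r => R (nsB r r)) μ ∧ ∃ δ : ℕ → ℝ≥0∞, Tendsto δ atTop (𝓝 0) ∧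
      ∀ n, ‖truncMean hurst σ lam R e n - drift R μ‖ₑ ^ 2 ≤ δ n := by
  have := hμ.gaussian
  obtain ⟨heW, δ, hδt, hδ0, hδ⟩ := exists_truncation_error hC
    (gaussWeight_summable (hurst := hurst) hC) μ
  obtain ⟨hm, hn⟩ := hδ (X := fun r : H d => r) aestronglyMeasurable_id
    (gaussBound_stationary hC hh hμ)
  have hF : Integrable (fun r => R (nsB r r)) μ := by
    have h2 : MemLp (fun r => R (nsB r r)) 2 μ := by
      refine ⟨hm, (eLpNorm_two_lt_top_iff _).2 ?_⟩
      have h := (hn 0).trans_lt (hδt 0)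
      simpa only [truncDrift_zero R heW, sub_zero] using h
    exact h2.integrable one_le_two
  refine ⟨hF, δ, hδ0, fun n => ?_⟩
  have hL : ∀ i, MemLp (fun r : H d => inner ℝ (e i) r) 2 μ := fun i =>
    IsGaussian.memLp_dual μ (innerSL ℝ (e i)) 2 (by simp)
  have hi : ∀ i j, Integrable (fun r : H d => inner ℝ (e i) r * inner ℝ (e j) r) μ := fun i j =>
    (hL i).integrable_mul (hL j)
  have hFn : Integrable (truncDrift R e n) μ := by
    have : truncDrift R e n = fun x => _ := funext (truncDrift_eq R heW n)
    rw [this]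
    exact integrable_finsetSum _ fun i _ => integrable_finsetSum _ fun j _ => (hi i j).smul_const _
  have hmean : truncMean hurst σ lam R e n = ∫ r, truncDrift R e n r ∂μ := by
    simp_rw [truncDrift_eq R heW]
    rw [integral_finsetSum _ fun i _ => integrable_finsetSum _ fun j _ => (hi i j).smul_const _,
      truncMean, Finset.sum_product]
    refine Finset.sum_congr rfl fun i _ => ?_
    rw [integral_finsetSum _ fun j _ => (hi i j).smul_const _]
    refine Finset.sum_congr rfl fun j _ => ?_
    rw [integral_smul_const, integral_inner_mul_inner hC hh hμ, qMat]
  rw [hmean, drift, ← integral_sub hFn hF]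
  calc _ ≤ (∫⁻ r, ‖truncDrift R e n r - R (nsB r r)‖ₑ ∂μ) ^ 2 :=
        pow_le_pow_left₀ zero_le (enorm_integral_le_lintegral_enorm _) 2
    _ ≤ ∫⁻ r, ‖truncDrift R e n r - R (nsB r r)‖ₑ ^ 2 ∂μ :=
        sq_lintegral_le (hFn.1.sub hm).enorm
    _ = ∫⁻ r, ‖R (nsB r r) - truncDrift R e n r‖ₑ ^ 2 ∂μ := by
        refine lintegral_congr fun r => ?_
        rw [← ofReal_norm, ← ofReal_norm, norm_sub_rev]
    _ ≤ δ n := hn n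

/-- The truncated functional is a finite combination of products of two modes with fixed vectors, so
the ergodic theorem for such products applies termwise. -/
lemma tendsto_truncated_average (hC : SmallScale d ξ e σ lam C R) (hW : ∀ i, IsFBM hurst P (W i))
    (hindep : iIndepFun (fun i ω => fun t : ℝ≥0 => W i t ω) P)
    (hw : IsFOU e σ C P W w) (hh : 0 < hurst) (hh1 : hurst ≤ 1 / 2)
    (heW : ∀ i, e i ∈ wienerSpace d) (n : ℕ) :
    Tendsto (fun T : ℝ => ∫⁻ ω, ‖(∫ a, truncDrift R e n (w (max (T * a) 0) ω) ∂unifLaw) -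
      truncMean hurst σ lam R e n‖ₑ ^ 2 ∂P) atTop (𝓝 0) := by
  set c : ℕ × ℕ → ℝ → ℝ × Ω → ℝ := fun k T z => inner ℝ (e k.1) (w (max (T * z.1) 0) z.2) *
      inner ℝ (e k.2) (w (max (T * z.1) 0) z.2) - qMat hurst σ lam k.1 k.2 with hc
  have hin : ∀ᵐ ω ∂P, ∀ k, ContinuousOn (fun t => inner ℝ (e k) (w t ω)) (Set.Ici 0) := by
    filter_upwards [hw.continuous] with ω hω k
    exact (innerSL ℝ (e k)).continuous.comp_continuousOn hω
  have him : ∀ k t, 0 ≤ t → AEStronglyMeasurable (fun ω => inner ℝ (e k) (w t ω)) P :=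
    fun k t ht => (gaussSpan_mode hC hW hw hh hh1 ht k).1.1
  have hcm : ∀ k T, AEStronglyMeasurable (fun ω => ∫ a, c k T (a, ω) ∂unifLaw) P := fun k T => by
    have h1 : AEStronglyMeasurable (c k T) (unifLaw.prod P) :=
      ((aestronglyMeasurable_rescaled (him k.1) (hin.mono fun _ h => h k.1) T).mul
        (aestronglyMeasurable_rescaled (him k.2) (hin.mono fun _ h => h k.2) T)).sub
        aestronglyMeasurable_const
    exact h1.prod_swap.integral_prod_right'
  have h := tendsto_lintegral_sum_smul (P := P) (Finset.range n ×ˢ Finset.range n)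
    (c := fun k T ω => ∫ a, c k T (a, ω) ∂unifLaw) (fun k => R (nsB (e k.1) (e k.2))) hcm
    fun k => tendsto_lintegral_average_modes hC hW hindep hw hh hh1 k.1 k.2
  refine h.congr fun T => lintegral_congr_ae ?_
  filter_upwards [hin] with ω hω
  have hint : ∀ {f : ℝ → ℝ}, Continuous f → Integrable f unifLaw := fun hf =>
    (hf.integrableOn_Icc (a := 0) (b := 1)).mono_set Set.Ioc_subset_Icc_self
  have hint2 : ∀ i j, Integrable (fun a => inner ℝ (e i) (w (max (T * a) 0) ω) *
      inner ℝ (e j) (w (max (T * a) 0) ω)) unifLaw := fun i j =>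
    hint ((continuous_rescaled (hω i) T).mul (continuous_rescaled (hω j) T))
  congr 2
  simp_rw [truncDrift_eq R heW, ← Finset.sum_product']
  rw [integral_finsetSum _ fun k _ => (hint2 k.1 k.2).smul_const _, truncMean,
    ← Finset.sum_sub_distrib]
  refine Finset.sum_congr rfl fun k _ => ?_
  rw [integral_smul_const, ← sub_smul, integral_sub (hint2 k.1 k.2) (integrable_const _)]
  simp

/-- Integer horizons give one null set for all `T`: undo the scaling on `[0, N]` and restrict to
`[0, T]`. -/
lemma ae_intervalIntegrable {F : ℝ → Ω → H d}
    (hF : ∀ T : ℝ, MemLp (fun z : ℝ × Ω => F (max (T * z.1) 0) z.2) 2 (unifLaw.prod P)) :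
    ∀ᵐ ω ∂P, ∀ T, 0 < T → IntervalIntegrable (fun s => F s ω) volume 0 T := by
  have h1 : ∀ᵐ ω ∂P, ∀ N : ℕ, Integrable (fun a => F (max (N * a) 0) ω) unifLaw :=
    ae_all_iff.2 fun N => ((hF N).integrable one_le_two).prod_left_ae
  filter_upwards [h1] with ω hω T hT
  obtain ⟨N, hN⟩ := exists_nat_ge T
  have hN0 : (0 : ℝ) < N := hT.trans_le hN
  have h2 : IntervalIntegrable (fun a => F (N * a) ω) volume 0 1 := by
    rw [intervalIntegrable_iff_integrableOn_Ioc_of_le zero_le_one]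
    refine IntegrableOn.congr_fun (hω N) (fun a ha => ?_) measurableSet_Ioc
    simp only [max_eq_left (mul_pos hN0 ha.1).le]
  have h3 : IntervalIntegrable (fun s => F s ω) volume 0 N := by
    have h := h2.comp_mul_left (c := (N : ℝ)⁻¹)
    simpa [hN0.ne'] using h
  exact h3.mono_set (by rw [Set.uIcc_of_le hT.le, Set.uIcc_of_le hN0.le]; exact Set.Icc_subset_Icc_right hN)

/-- The deviation splits into the averaged truncation error, the fluctuation of the truncated
average around `r'`, and the bias `r' - r`. The first is at most `δ` by Jensen in the time variable.
-/
lemma lintegral_timeAverage_sub_le {T : ℝ} (hT : 0 < T) {n : ℕ}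
    {r r' : H d} {δ : ℝ≥0∞}
    (hF : MemLp (fun z : ℝ × Ω => R (nsB (w (max (T * z.1) 0) z.2) (w (max (T * z.1) 0) z.2))) 2
        (unifLaw.prod P))
    (hFn : MemLp (fun z : ℝ × Ω => truncDrift R e n (w (max (T * z.1) 0) z.2)) 2 (unifLaw.prod P))
    (hδ : ∫⁻ z : ℝ × Ω, ‖R (nsB (w (max (T * z.1) 0) z.2) (w (max (T * z.1) 0) z.2)) -
          truncDrift R e n (w (max (T * z.1) 0) z.2)‖ₑ ^ 2 ∂(unifLaw.prod P) ≤ δ) :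
    ∫⁻ ω, ‖timeAverage R w T ω - r‖ₑ ^ 2 ∂P ≤ 4 * (δ + 4 *
      ((∫⁻ ω, ‖(∫ a, truncDrift R e n (w (max (T * a) 0) ω) ∂unifLaw) - r'‖ₑ ^ 2 ∂P) +
        ‖r' - r‖ₑ ^ 2)) := by
  have hsub : MemLp (fun z : ℝ × Ω =>
      R (nsB (w (max (T * z.1) 0) z.2) (w (max (T * z.1) 0) z.2)) -
        truncDrift R e n (w (max (T * z.1) 0) z.2)) 2 (unifLaw.prod P) := hF.sub hFn
  set I : Ω → H d := fun ω => ∫ a, (R (nsB (w (max (T * a) 0) ω) (w (max (T * a) 0) ω)) -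
    truncDrift R e n (w (max (T * a) 0) ω)) ∂unifLaw with hI
  set J : Ω → H d := fun ω => (∫ a, truncDrift R e n (w (max (T * a) 0) ω) ∂unifLaw) - r' with hJ
  have hIm : AEStronglyMeasurable I P := (memLp_integral hsub).1
  have hJm : AEStronglyMeasurable J P := (memLp_integral hFn).1.sub aestronglyMeasurable_const
  have h1 : ∫⁻ ω, ‖I ω‖ₑ ^ 2 ∂P ≤ δ := by
    refine (lintegral_enorm_integral_sq_le hsub.1).trans ?_
    rwa [lintegral_prod _ (hsub.1.enorm.pow_const 2)] at hδ
  have h2 : ∀ᵐ ω ∂P, timeAverage R w T ω - r = I ω + (J ω + (r' - r)) := by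
    filter_upwards [(hF.integrable one_le_two).prod_left_ae,
      (hFn.integrable one_le_two).prod_left_ae] with ω h3 h4
    rw [timeAverage_eq R w hT, hI, hJ]
    simp only
    rw [integral_sub h3 h4]
    abel
  calc ∫⁻ ω, ‖timeAverage R w T ω - r‖ₑ ^ 2 ∂P
      ≤ ∫⁻ ω, 4 * (‖I ω‖ₑ ^ 2 + 4 * (‖J ω‖ₑ ^ 2 + ‖r' - r‖ₑ ^ 2)) ∂P := by
        refine lintegral_mono_ae ?_
        filter_upwards [h2] with ω hω
        rw [hω]
        refine (pow_le_pow_left₀ zero_le (enorm_add_le _ _) 2).trans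
          ((add_sq_le_four_mul _ _).trans ?_)
        refine mul_le_mul_right (add_le_add le_rfl ?_) _
        exact (pow_le_pow_left₀ zero_le (enorm_add_le (J ω) (r' - r)) 2).trans (add_sq_le_four_mul _ _)
    _ = 4 * (∫⁻ ω, ‖I ω‖ₑ ^ 2 ∂P + 4 * (∫⁻ ω, ‖J ω‖ₑ ^ 2 ∂P + ‖r' - r‖ₑ ^ 2)) := by
        rw [lintegral_const_mul' _ _ (by finiteness), lintegral_add_left' (hIm.enorm.pow_const 2),
          lintegral_const_mul' _ _ (by finiteness), lintegral_add_left' (hJm.enorm.pow_const 2)]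
        simp
    _ ≤ _ := by gcongr

end Main

end

end ItoStokes

theorem lemma3p3 {d : ℕ} (hd : d = 2 ∨ d = 3) {hurst : ℝ} (hurst_gt : 1 / 4 < hurst)
    (hurst_le : hurst ≤ 1 / 2) {ξ : ℝ} {e : ℕ → ItoStokes.H d} {σ lam : ℕ → ℝ}
    {C : ItoStokes.H d →ₗ.[ℝ] ItoStokes.H d} {R : ItoStokes.H d →L[ℝ] ItoStokes.H d}
    (hC : ItoStokes.SmallScale d ξ e σ lam C R)
    {Ω : Type*} [MeasurableSpace Ω] {P : Measure Ω} [IsProbabilityMeasure P]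
    {W : ℕ → ℝ → Ω → ℝ} (hW : ∀ i, ItoStokes.IsFBM hurst P (W i))
    (hindep : iIndepFun (fun i ω => fun t : ℝ≥0 => W i t ω) P)
    {w : ℝ → Ω → ItoStokes.H d} (hw : ItoStokes.IsFOU e σ C P W w)
    {μ : Measure (ItoStokes.H d)}
    (hμ : ItoStokes.IsCenteredGaussian
      (ItoStokes.diagOp (ItoStokes.qBar hurst σ lam) e) μ) :
    Integrable (fun r => R (ItoStokes.nsB r r)) μ ∧
    (∀ᵐ ω ∂P, ∀ T, 0 < T → IntervalIntegrable
      (fun s => R (ItoStokes.nsB (w s ω) (w s ω))) volume 0 T) ∧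
    (∀ T, 0 < T → MemLp (ItoStokes.timeAverage R w T) 2 P) ∧
    Tendsto (fun T => eLpNorm
      (fun ω => ItoStokes.timeAverage R w T ω - ItoStokes.drift R μ) 2 P) atTop (𝓝 0) := by
  have hh : 0 < hurst := by linarith
  obtain ⟨heW, -⟩ := ItoStokes.exists_truncation_error hC
    (ItoStokes.gaussWeight_summable (hurst := hurst) hC) P
  obtain ⟨hμi, δ', hδ'0, hδ'⟩ := ItoStokes.exists_error_stationary hC hh hμ
  obtain ⟨δ, hδ0, hδ⟩ := ItoStokes.exists_error_process hC hW hindep hw hh hurst_le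
  refine ⟨hμi, ItoStokes.ae_intervalIntegrable
    (F := fun s ω => R (ItoStokes.nsB (w s ω) (w s ω))) fun T => (hδ T).1, fun T hT => ?_, ?_⟩
  · rw [funext (ItoStokes.timeAverage_eq R w hT)]
    exact ItoStokes.memLp_integral (hδ T).1
  · have hsq : Tendsto (fun T => ∫⁻ ω, ‖ItoStokes.timeAverage R w T ω - ItoStokes.drift R μ‖ₑ ^ 2 ∂P)
        atTop (𝓝 0) := by
      rw [ENNReal.tendsto_nhds_zero]
      intro ε hε
      have t1 : Tendsto (fun n => 4 * (δ n + 4 * (0 + δ' n))) atTop (𝓝 0) := by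
        have h1 := ENNReal.Tendsto.const_mul (a := 4) ((tendsto_const_nhds (x := (0 : ℝ≥0∞))).add hδ'0)
          (.inr (by finiteness))
        have h2 := ENNReal.Tendsto.const_mul (a := 4) (hδ0.add h1) (.inr (by finiteness))
        simpa using h2
      -- The truncation level is fixed before the horizon: with zero fluctuation the bound is
      -- already below `ε`, and the true fluctuation tends to zero as `T → ∞` for this `n`.
      obtain ⟨n, hn⟩ := (t1.eventually_lt_const hε).exists
      have h1 := ENNReal.Tendsto.const_mul (a := 4)
        ((ItoStokes.tendsto_truncated_average hC hW hindep hw hh hurst_le heW n).add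
          (tendsto_const_nhds (x := δ' n))) (.inr (by finiteness))
      have h2 := ENNReal.Tendsto.const_mul (a := 4)
        ((tendsto_const_nhds (x := δ n)).add h1) (.inr (by finiteness))
      filter_upwards [h2.eventually_lt_const hn, eventually_gt_atTop 0] with T hT hT0
      refine (ItoStokes.lintegral_timeAverage_sub_le hT0 (hδ T).1 ((hδ T).2 n).1
        ((hδ T).2 n).2 (r' := ItoStokes.truncMean hurst σ lam R e n)).trans (le_trans ?_ hT.le)
      gcongr
      exact hδ' n
    simp_rw [← ItoStokes.eLpNorm_two_sq] at hsq
    have h := (ENNReal.continuous_rpow_const (y := (1 / 2 : ℝ))).tendsto _ |>.comp hsq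
    rw [ENNReal.zero_rpow_of_pos (by norm_num)] at h
    refine h.congr fun T => ?_
    rw [Function.comp_apply, ← ENNReal.rpow_two, ← ENNReal.rpow_mul]
    norm_num
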